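/- For an origin-symmetric star body $K\subset\mathbb R^m$ (compact, star-shaped about $0$, $0\in\operatorname{int}K$, with continuous Minkowski functional $\|x\|_K=\min\{a\ge 0: x\in aK\}$), $K$ is called the intersection body of an origin-symmetric star body $L$ if $\|\xi\|_K^{-1}=\mathrm{vol}_{m-1}(L\cap\xi^\perp)$ for all $\xi\in S^{m-1}$. An origin-symmetric star body $K$ is an intersection body if it lies in the closure of the class of intersection bodies of star bodies for the radial metric $\sup_{\xi\in S^{m-1}}\bigl|\|\xi\|_K^{-1}-\|\xi\|_M^{-1}\bigr|$. A convex body is a compact convex set with the origin in its interior. **Theorem.** Let $n\ge 5$. There is an origin-symmetric convex body $K$ in $\mathbb R^n$ that is not an intersection body, but such that for every $(n-1)$-dimensional linear subspace $V$ of $\mathbb R^n$ the section $K\cap V$ is an intersection body in $V$. More precisely, fix $x_0\in S^{n-1}$ and, for $\varepsilon>0$ and $\theta\in S^{n-1}$, put $f_\varepsilon(\theta)=2\exp\bigl(-\tfrac{|\theta\mp x_0|^2}{\varepsilon^2-|\theta\mp x_0|^2}\bigr)$ if $|\theta\mp x_0|<\varepsilon$ (for $\varepsilon\le 1$ at most one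 sign is possible), and $f_\varepsilon(\theta)=0$ otherwise. Then there is $\varepsilon_0>0$ such that for every $\varepsilon\in(0,\varepsilon_0)$ there is a body $K$ with the above properties satisfying $$\|x\|_K^{-1}=\Bigl(\bigl(1-f_\varepsilon(x/|x|)\bigr)\,|x|^{-n+1}\Bigr)^{\wedge},$$ where the Fourier transform is that of tempered distributions, $\langle\hat f,\phi\rangle=\langle f,\hat\phi\rangle$ for Schwartz functions $\phi$, with $\hat\phi(x)=\int_{\mathbb R^n}\phi(y)e^{-i(x,y)}\,dy$. -/

import Mathlib

open MeasureTheory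
open scoped SchwartzMap

noncomputable section

/-- Lebesgue measure of a finite-dimensional Euclidean space `E`, normalised so that the unit cube
spanned by an orthonormal basis has measure one. It is spelled out, instead of written `volume`,
because `volume` on a subspace could also be read as the restriction of the ambient measure. -/
def lebesgue (E : Type*) [NormedAddCommGroup E] [InnerProductSpace ℝ E] [FiniteDimensional ℝ E]
    [MeasurableSpace E] [BorelSpace E] : Measure E :=
  (stdOrthonormalBasis ℝ E).toBasis.addHaar

/-- `S` is symmetric about the origin. -/
def IsOriginSymmetric {E : Type*} [AddCommGroup E] (S : Set E) : Prop :=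
  ∀ x ∈ S, -x ∈ S

/-- Convex bodies: compact convex sets with the origin in the interior. -/
structure IsConvexBody {E : Type*} [NormedAddCommGroup E] [NormedSpace ℝ E] (K : Set E) :
    Prop where
  isCompact : IsCompact K
  convex : Convex ℝ K
  zero_mem_interior : (0 : E) ∈ interior K

/-- Star bodies: compact sets, star-shaped about the origin, with the origin in the interior and
with continuous Minkowski functional `‖x‖_K`, which is Mathlib's `gauge K x`. -/
structure IsStarBody {E : Type*} [NormedAddCommGroup E] [NormedSpace ℝ E] (K : Set E) :
    Prop where
  isCompact : IsCompact K
  starConvex : StarConvex ℝ 0 K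
  zero_mem_interior : (0 : E) ∈ interior K
  continuous_gauge : Continuous (gauge K)

/-- The radial function `ρ_K(x) = ‖x‖_K⁻¹`. -/
def radialFunction {E : Type*} [NormedAddCommGroup E] [NormedSpace ℝ E] (K : Set E) (x : E) : ℝ :=
  (gauge K x)⁻¹

section Intersection

variable {E : Type*} [NormedAddCommGroup E] [InnerProductSpace ℝ E] [FiniteDimensional ℝ E]
  [MeasurableSpace E] [BorelSpace E]

/-- The volume of the central hyperplane section `L ∩ ξ^⊥`, as a subset of the Euclidean space
`ξ^⊥` of dimension one less. -/
def centralSectionVolume (L : Set E) (ξ : E) : ℝ :=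
  (lebesgue (ℝ ∙ ξ)ᗮ).real {y : (ℝ ∙ ξ)ᗮ | (y : E) ∈ L}

/-- `K` is the intersection body of `L`, both being origin-symmetric star bodies. -/
structure IsIntersectionBodyOf (K L : Set E) : Prop where
  starBody_left : IsStarBody K
  symmetric_left : IsOriginSymmetric K
  starBody_right : IsStarBody L
  symmetric_right : IsOriginSymmetric L
  radial_eq : ∀ ξ : E, ‖ξ‖ = 1 → radialFunction K ξ = centralSectionVolume L ξ

/-- Intersection bodies: the closure, within the origin-symmetric star bodies, of the class of
intersection bodies of star bodies in the radial metric `sup_{‖ξ‖ = 1} |ρ_K(ξ) - ρ_M(ξ)|`. -/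
structure IsIntersectionBody (K : Set E) : Prop where
  starBody : IsStarBody K
  symmetric : IsOriginSymmetric K
  mem_closure : ∀ δ : ℝ, 0 < δ → ∃ M L : Set E, IsIntersectionBodyOf M L ∧
    ∀ ξ : E, ‖ξ‖ = 1 → |radialFunction K ξ - radialFunction M ξ| ≤ δ

end Intersection

/-- The Fourier transform `φ^(x) = ∫ φ(y) exp(-i (x, y)) dy` of a test function. -/
def testFourier {n : ℕ} (φ : 𝓢(EuclideanSpace ℝ (Fin n), ℂ)) (x : EuclideanSpace ℝ (Fin n)) : ℂ :=
  ∫ y, φ y * Complex.exp (-(Complex.I * ((inner ℝ x y : ℝ) : ℂ)))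

/-- The function `g` is the Fourier transform of the function `f` in the sense of tempered
distributions: `⟨g, φ⟩ = ⟨f, φ^⟩` for every Schwartz function `φ`, with both pairings given by
convergent integrals. -/
def IsDistributionalFourierTransform {n : ℕ} (f g : EuclideanSpace ℝ (Fin n) → ℝ) : Prop :=
  ∀ φ : 𝓢(EuclideanSpace ℝ (Fin n), ℂ),
    Integrable (fun x => (f x : ℂ) * testFourier φ x) ∧
    Integrable (fun x => (g x : ℂ) * φ x) ∧
    ∫ x, (g x : ℂ) * φ x = ∫ x, (f x : ℂ) * testFourier φ x

/-- The even bump `f_ε` around `±x₀` (used on the unit sphere, with `‖x₀‖ = 1`). -/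
def bump {E : Type*} [NormedAddCommGroup E] (x₀ : E) (ε : ℝ) (x : E) : ℝ :=
  if ‖x - x₀‖ < ε then 2 * Real.exp (-(‖x - x₀‖ ^ 2 / (ε ^ 2 - ‖x - x₀‖ ^ 2)))
  else if ‖x + x₀‖ < ε then 2 * Real.exp (-(‖x + x₀‖ ^ 2 / (ε ^ 2 - ‖x + x₀‖ ^ 2)))
  else 0

/-- The function `(1 - f_ε(θ)) r^{-n+1}` on `ℝⁿ` in polar coordinates `x = r θ`. -/
def perturbedKernel {n : ℕ} (x₀ : EuclideanSpace ℝ (Fin n)) (ε : ℝ)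
    (x : EuclideanSpace ℝ (Fin n)) : ℝ :=
  (1 - bump x₀ ε (‖x‖⁻¹ • x)) * ‖x‖ ^ (-(n : ℤ) + 1)

end

/-! Put `k = n - 1`, let `f` be the bump on the sphere, and let `g = 1 - f`, an even function on the
sphere. The Fourier transform of `g(x/‖x‖) ‖x‖ ^ (-k)` is `π ‖ξ‖⁻¹ R g(ξ)`, where `R` is the
spherical Radon transform, the integral over the unit sphere of `ξ^⊥`
(`isDistributionalFourierTransform_angular`). So the body is forced: its radial function on the
sphere has to be `π R g`.

Convexity: `R g` depends only on `z = ⟨ξ, x₀⟩`, and with `δ = ε² / 2` the part `R f` of it is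
`O(√δ)` together with two derivatives in `z` (`exists_capIntegral_small`). Each of the last two
costs a factor `δ⁻¹`, while a cap of angular radius about `√δ` on a sphere of dimension at least `3`
has measure `O(δ^(3/2))`; here `n ≥ 5` is used. A body of revolution this close in `C²` to a ball is
convex (`inv_sub_bound`, `convexOn_revolutionGauge`).

Not an intersection body: if `M` is the intersection body of `L`, then `ρ_M = k⁻¹ R(ρ_L ^ k)`, so
its preimage under the Fourier transform is nonnegative, and this survives radial limits when tested
against a Schwartz function whose transform is a bump near `x₀`. But `g x₀ = -1`
(`not_isIntersectionBody_of_neg`).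

Sections: for `ξ` in a hyperplane `V` with unit normal `v`, Fubini turns `R g(ξ)` into the Radon
transform inside `V` of `H(u) = ∫ g(u + t v) ‖u + t v‖ ^ (-k) dt`
(`sphericalRadon_eq_sphericalRadon_lineIntegral`). Each such integral runs along a great semicircle,
which meets the caps in a short arc only, so `H > 0` (`exists_lineIntegral_oneSubBump_pos`). Hence
`K ∩ V` is exactly the intersection body of the star body with radial function `(π (n - 2) H) ^ (1 /
(n - 2))`. Averaging over semicircles removes the negativity that a single direction detects. -/

noncomputable section

set_option linter.unusedSectionVars false

/-! ### Polar coordinates for Haar measures. -/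

section Polar

open Set Metric Module

variable {E : Type*} [NormedAddCommGroup E] [NormedSpace ℝ E] [FiniteDimensional ℝ E]
  [MeasurableSpace E] [BorelSpace E] [Nontrivial E] (μ : Measure E) [μ.IsAddHaarMeasure]

theorem integral_volumeIoiPow (m : ℕ) (f : ℝ → ℝ) :
    ∫ r : Ioi (0 : ℝ), f r ∂(Measure.volumeIoiPow m) = ∫ r in Ioi (0 : ℝ), r ^ m * f r := by
  simp only [Measure.volumeIoiPow, ENNReal.ofReal]
  rw [integral_withDensity_eq_integral_smul,
    integral_subtype_comap measurableSet_Ioi fun a ↦ Real.toNNReal (a ^ m) • f a,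
    setIntegral_congr_fun measurableSet_Ioi fun x hx ↦ ?_]
  · rw [NNReal.smul_def, Real.coe_toNNReal _ (pow_nonneg hx.out.le _), smul_eq_mul]
  · exact (measurable_subtype_coe.pow_const _).real_toNNReal

theorem integral_eq_integral_toSphere_prod (F : E → ℝ) :
    ∫ x, F x ∂μ = ∫ p : sphere (0 : E) 1 × Ioi (0 : ℝ), F ((p.2 : ℝ) • (p.1 : E))
      ∂(μ.toSphere.prod (.volumeIoiPow (finrank ℝ E - 1))) := by
  calc
    ∫ x, F x ∂μ = ∫ x : ({(0)}ᶜ : Set E), F x ∂(μ.comap (↑)) := by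
      rw [integral_subtype_comap (measurableSet_singleton _).compl F, restrict_compl_singleton]
    _ = _ := by
      rw [← μ.measurePreserving_homeomorphUnitSphereProd.integral_comp
        (Homeomorph.measurableEmbedding _)]
      refine integral_congr_ae (.of_forall fun x => ?_)
      have hx : ‖(x : E)‖ ≠ 0 := norm_ne_zero_iff.2 x.2
      simp [smul_smul, hx]

theorem integrable_toSphere_prod {F : E → ℝ} (hF : Integrable F μ) :
    Integrable (fun p : sphere (0 : E) 1 × Ioi (0 : ℝ) => F ((p.2 : ℝ) • (p.1 : E)))
      (μ.toSphere.prod (.volumeIoiPow (finrank ℝ E - 1))) := by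
  rw [← μ.measurePreserving_homeomorphUnitSphereProd.integrable_comp_emb
        (Homeomorph.measurableEmbedding _)]
  have h1 : IntegrableOn F ({(0 : E)}ᶜ) μ := hF.integrableOn
  rw [integrableOn_iff_comap_subtypeVal (measurableSet_singleton _).compl] at h1
  refine h1.congr (.of_forall fun x => ?_)
  have hx : ‖(x : E)‖ ≠ 0 := norm_ne_zero_iff.2 x.2
  simp [smul_smul, hx]

theorem integral_eq_integral_toSphere {F : E → ℝ} (hF : Integrable F μ) :
    ∫ x, F x ∂μ = ∫ θ : sphere (0 : E) 1,
      (∫ r in Ioi (0 : ℝ), r ^ (finrank ℝ E - 1) * F (r • (θ : E))) ∂μ.toSphere := by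
  rw [integral_eq_integral_toSphere_prod, integral_prod _ (integrable_toSphere_prod μ hF)]
  congr with θ
  exact integral_volumeIoiPow _ fun r => F (r • (θ : E))

/-- The radial factor contributes `∫₀¹ r^(d-1) dr = 1/d`. This permits every spherical integral
below to be written as a ball integral of a function homogeneous of degree zero, so that no surface
measure on subspheres is needed. -/
theorem finrank_mul_setIntegral_ball_radial (a : E → ℝ) :
    (finrank ℝ E : ℝ) * ∫ x in ball (0 : E) 1, a (‖x‖⁻¹ • x) ∂μ =
      ∫ θ : sphere (0 : E) 1, a θ ∂μ.toSphere := by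
  have hd : 0 < finrank ℝ E := finrank_pos
  rw [← integral_indicator measurableSet_ball, integral_eq_integral_toSphere_prod]
  have : ∀ p : sphere (0 : E) 1 × Ioi (0 : ℝ),
      (ball (0 : E) 1).indicator (fun x => a (‖x‖⁻¹ • x)) ((p.2 : ℝ) • (p.1 : E)) =
        a p.1 * (Iio (1 : ℝ)).indicator 1 (p.2 : ℝ) := by
    rintro ⟨⟨θ, hθ⟩, ⟨r, hr⟩⟩
    have hr' : (0 : ℝ) < r := hr
    have hθ' : ‖θ‖ = 1 := by simpa using hθ
    by_cases h : r < 1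
    · simp [indicator, norm_smul, hθ', abs_of_pos hr', h, smul_smul, hr'.ne']
    · simp [indicator, norm_smul, hθ', abs_of_pos hr', h]
  simp_rw [this]
  rw [integral_prod_mul (fun θ : sphere (0 : E) 1 => a θ)
    (fun r : Ioi (0 : ℝ) => (Iio (1 : ℝ)).indicator 1 (r : ℝ)),
    integral_volumeIoiPow _ ((Iio (1 : ℝ)).indicator 1)]
  have h2 : ∫ r in Ioi (0 : ℝ), r ^ (finrank ℝ E - 1) * (Iio (1 : ℝ)).indicator 1 r =
      (finrank ℝ E : ℝ)⁻¹ := by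
    have : ∀ r : ℝ, r ^ (finrank ℝ E - 1) * (Iio (1 : ℝ)).indicator 1 r =
        (Iio (1 : ℝ)).indicator (fun r => r ^ (finrank ℝ E - 1)) r := by
      intro r; by_cases h : r < 1 <;> simp [h]
    simp_rw [this]
    rw [setIntegral_indicator measurableSet_Iio, Ioi_inter_Iio, ← integral_Ioc_eq_integral_Ioo,
      ← intervalIntegral.integral_of_le zero_le_one, integral_pow]
    rw [Nat.sub_add_cancel hd]
    simp [hd.ne', Nat.cast_sub (Nat.succ_le_of_lt hd)]
  rw [h2]
  field_simp

/-- Integration in polar coordinates, the directions being averaged over the unit ball. -/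
theorem integral_eq_setIntegral_ball {F : E → ℝ} (hF : Integrable F μ) :
    ∫ x, F x ∂μ = (finrank ℝ E : ℝ) * ∫ x in ball (0 : E) 1,
      (∫ r in Ioi (0 : ℝ), r ^ (finrank ℝ E - 1) * F (r • (‖x‖⁻¹ • x))) ∂μ := by
  rw [integral_eq_integral_toSphere μ hF, ← finrank_mul_setIntegral_ball_radial μ
    (fun θ => ∫ r in Ioi (0 : ℝ), r ^ (finrank ℝ E - 1) * F (r • θ))]

end Polar

/-! ### Orthogonal splitting along a unit vector and transport by isometries. -/

section Slice

open Module

theorem norm_slice_sq {U W : Type*} [NormedAddCommGroup U] [InnerProductSpace ℝ U]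
    [NormedAddCommGroup W] [InnerProductSpace ℝ W] (i : U →ₗᵢ[ℝ] W) {v : W} (hv : ‖v‖ = 1)
    (ho : ∀ u, inner ℝ (i u) v = 0) (u : U) (t : ℝ) :
    ‖i u + t • v‖ ^ 2 = ‖u‖ ^ 2 + t ^ 2 := by
  rw [norm_add_sq_real, inner_smul_right, ho, norm_smul, hv, i.norm_map]
  simp

variable {U W : Type*} [NormedAddCommGroup U] [InnerProductSpace ℝ U] [FiniteDimensional ℝ U]
  [MeasurableSpace U] [BorelSpace U] [NormedAddCommGroup W] [InnerProductSpace ℝ W]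
  [FiniteDimensional ℝ W] [MeasurableSpace W] [BorelSpace W]

instance : (lebesgue W).IsAddHaarMeasure := by unfold lebesgue; infer_instance

theorem lebesgue_measurePreserving (f : U ≃ₗᵢ[ℝ] W) :
    MeasurePreserving f (lebesgue U) (lebesgue W) :=
  f.measurePreserving

theorem lebesgue_ball_eq (h : finrank ℝ U = finrank ℝ W) :
    (lebesgue U).real (Metric.ball 0 1) = (lebesgue W).real (Metric.ball 0 1) := by
  let f : U ≃ₗᵢ[ℝ] W := (stdOrthonormalBasis ℝ U).equiv (stdOrthonormalBasis ℝ W) (finCongr h)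
  rw [measureReal_def, measureReal_def, ← (lebesgue_measurePreserving f).measure_preimage
    Metric.isOpen_ball.measurableSet.nullMeasurableSet]
  congr 2
  ext x
  simp

/-- Orthogonal decomposition of `W` along a unit vector `v` as a homeomorphism `U × ℝ ≃ W`. -/
theorem exists_slice_homeomorph (i : U →ₗᵢ[ℝ] W) (v : W) (hv : ‖v‖ = 1)
    (ho : ∀ u, inner ℝ (i u) v = 0) (hd : finrank ℝ W = finrank ℝ U + 1) :
    ∃ e : U × ℝ ≃ₜ W, (∀ p, e p = i p.1 + p.2 • v) ∧
      MeasurePreserving e ((lebesgue U).prod volume) (lebesgue W) := by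
  let l : WithLp 2 (U × ℝ) →ₗ[ℝ] W :=
    { toFun := fun p => i p.fst + p.snd • v
      map_add' := fun p q => by simp [add_smul]; abel
      map_smul' := fun c p => by simp [smul_smul] }
  have hl : ∀ p, ‖l p‖ = ‖p‖ := by
    intro p
    have h1 : ‖l p‖ ^ 2 = ‖p‖ ^ 2 := by
      change ‖i p.fst + p.snd • v‖ ^ 2 = _
      rw [norm_add_sq_real, inner_smul_right, ho, norm_smul, hv, i.norm_map,
        WithLp.prod_norm_sq_eq_of_L2]
      simp
    exact (sq_eq_sq₀ (norm_nonneg _) (norm_nonneg _)).1 h1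
  let li : WithLp 2 (U × ℝ) →ₗᵢ[ℝ] W := ⟨l, hl⟩
  have hf : finrank ℝ (WithLp 2 (U × ℝ)) = finrank ℝ W := by
    rw [hd, (WithLp.linearEquiv 2 ℝ (U × ℝ)).finrank_eq]; simp
  let f : WithLp 2 (U × ℝ) ≃ₗᵢ[ℝ] W := li.toLinearIsometryEquiv hf
  refine ⟨(WithLp.prodContinuousLinearEquiv 2 ℝ U ℝ).symm.toHomeomorph.trans f.toHomeomorph,
    fun p => rfl, ?_⟩
  exact f.measurePreserving.comp (WithLp.volume_preserving_toLp U ℝ)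

theorem exists_orthonormalBasis_apply_zero {m : ℕ} (h : finrank ℝ U = m + 1) {u : U}
    (hu : ‖u‖ = 1) : ∃ b : OrthonormalBasis (Fin (m + 1)) ℝ U, b 0 = u := by
  have hv : Orthonormal ℝ (({0} : Set (Fin (m + 1))).domRestrict fun _ => u) := by
    refine ⟨fun _ => hu, fun i j hij => ?_⟩
    exact absurd (Subsingleton.elim i j) hij
  obtain ⟨b, hb⟩ := hv.exists_orthonormalBasis_extension_of_card_eq (by simpa using h)
  exact ⟨b, hb 0 rfl⟩

theorem exists_linearIsometryEquiv_map_unit (h : finrank ℝ U = finrank ℝ W) {u : U} {w : W}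
    (hu : ‖u‖ = 1) (hw : ‖w‖ = 1) : ∃ f : U ≃ₗᵢ[ℝ] W, f u = w := by
  have : Nontrivial U := ⟨⟨u, 0, fun h0 => by simp [h0] at hu⟩⟩
  obtain ⟨m, hm⟩ : ∃ m, finrank ℝ U = m + 1 :=
    ⟨finrank ℝ U - 1, (Nat.sub_add_cancel finrank_pos).symm⟩
  obtain ⟨b, hb⟩ := exists_orthonormalBasis_apply_zero hm hu
  obtain ⟨c, hc⟩ := exists_orthonormalBasis_apply_zero (h ▸ hm) hw
  refine ⟨b.equiv c (Equiv.refl _), ?_⟩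
  rw [← hb, OrthonormalBasis.equiv_apply_basis, Equiv.refl_apply, hc]

end Slice

/-! ### Origin-symmetric star bodies and their Minkowski functionals. -/

section StarBody

open Set Metric Module
open scoped Pointwise

/-- Continuous, absolutely homogeneous functions that are positive off the origin: the Minkowski
functionals of origin-symmetric star bodies. -/
structure IsMinkowskiFunctional {E : Type*} [NormedAddCommGroup E] [NormedSpace ℝ E]
    (N : E → ℝ) : Prop where
  continuous : Continuous N
  smul : ∀ (c : ℝ) (x : E), N (c • x) = |c| * N x
  pos : ∀ x, x ≠ 0 → 0 < N x

namespace IsMinkowskiFunctional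

variable {E : Type*} [NormedAddCommGroup E] [NormedSpace ℝ E] {N : E → ℝ}

theorem zero (h : IsMinkowskiFunctional N) : N 0 = 0 := by
  simpa using h.smul 0 0

theorem nonneg (h : IsMinkowskiFunctional N) (x : E) : 0 ≤ N x := by
  rcases eq_or_ne x 0 with rfl | hx
  · exact h.zero.ge
  · exact (h.pos x hx).le

theorem mem_smul_iff (h : IsMinkowskiFunctional N) {r : ℝ} (hr : 0 < r) (x : E) :
    x ∈ r • {x | N x ≤ 1} ↔ N x ≤ r := by
  rw [mem_smul_set_iff_inv_smul_mem₀ hr.ne', mem_ofPred_eq, h.smul, abs_of_pos (inv_pos.2 hr),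
    inv_mul_le_iff₀ hr, mul_one]

theorem gauge_eq (h : IsMinkowskiFunctional N) : gauge {x | N x ≤ 1} = N := by
  ext x
  apply le_antisymm
  · rcases eq_or_ne x 0 with rfl | hx
    · simp [h.zero]
    · exact gauge_le_of_mem (h.nonneg x) ((h.mem_smul_iff (h.pos x hx) x).2 le_rfl)
  · refine le_csInf ⟨N x + 1, ?_, ?_⟩ ?_
    · have := h.nonneg x; change 0 < N x + 1; positivity
    · exact (h.mem_smul_iff (by have := h.nonneg x; positivity) x).2 (by linarith)
    · rintro r ⟨hr, hx⟩
      exact (h.mem_smul_iff hr x).1 hx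

theorem isOriginSymmetric (h : IsMinkowskiFunctional N) : IsOriginSymmetric {x | N x ≤ 1} := by
  intro x hx
  have := h.smul (-1) x
  simp only [neg_smul, one_smul, abs_neg, abs_one, one_mul] at this
  simpa [this] using hx

theorem zero_mem_interior (h : IsMinkowskiFunctional N) : (0 : E) ∈ interior {x | N x ≤ 1} := by
  rw [mem_interior_iff_mem_nhds]
  have := h.continuous.tendsto 0
  rw [h.zero] at this
  filter_upwards [this.eventually (gt_mem_nhds one_pos)] with x hx using hx.le

theorem isCompact [FiniteDimensional ℝ E] (h : IsMinkowskiFunctional N) :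
    IsCompact {x | N x ≤ 1} := by
  have : ProperSpace E := FiniteDimensional.proper_real E
  refine isCompact_of_isClosed_isBounded (isClosed_le h.continuous continuous_const) ?_
  -- The unit sphere is empty only when the space is zero. Otherwise the positive minimum of `N` on
  -- it bounds the body.
  rcases (sphere (0 : E) 1).eq_empty_or_nonempty with hs | hs
  · refine (isBounded_closedBall (x := (0 : E)) (r := 0)).subset fun x _ => ?_
    by_contra hx
    have hx' : ‖x‖ ≠ 0 := by simpa using hx
    have : ‖x‖⁻¹ • x ∈ sphere (0 : E) 1 := by simp [norm_smul, hx']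
    simp [hs] at this
  · obtain ⟨u, hu, hmin⟩ := (isCompact_sphere (0 : E) 1).exists_isMinOn hs h.continuous.continuousOn
    have hu0 : 0 < N u := h.pos u (by rintro rfl; simp at hu)
    refine (isBounded_closedBall (x := (0 : E)) (r := (N u)⁻¹)).subset fun x hx => ?_
    rw [mem_closedBall_zero_iff]
    rcases eq_or_ne x 0 with rfl | hx0
    · simpa using hu0.le
    have hx' : ‖x‖ ≠ 0 := by simpa using hx0
    have h1 : N u ≤ N (‖x‖⁻¹ • x) := hmin (by simp [norm_smul, hx'])
    rw [h.smul, abs_of_nonneg (by positivity)] at h1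
    have hx1 : N x ≤ 1 := hx
    have hp : 0 < ‖x‖ := by positivity
    rw [le_inv_comm₀ hp hu0]
    calc N u ≤ ‖x‖⁻¹ * N x := h1
      _ ≤ ‖x‖⁻¹ * 1 := by gcongr
      _ = _ := mul_one _

theorem isStarBody [FiniteDimensional ℝ E] (h : IsMinkowskiFunctional N) :
    IsStarBody {x | N x ≤ 1} where
  isCompact := h.isCompact
  starConvex := by
    rw [starConvex_zero_iff]
    intro x hx a ha0 ha1
    have hx' : N x ≤ 1 := hx
    rw [mem_ofPred_eq, h.smul, abs_of_nonneg ha0]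
    nlinarith [h.nonneg x]
  zero_mem_interior := h.zero_mem_interior
  continuous_gauge := by rw [h.gauge_eq]; exact h.continuous

theorem isConvexBody [FiniteDimensional ℝ E] (h : IsMinkowskiFunctional N)
    (hc : ConvexOn ℝ univ N) : IsConvexBody {x | N x ≤ 1} where
  isCompact := h.isCompact
  convex := by simpa using hc.convex_le 1
  zero_mem_interior := h.zero_mem_interior

theorem comp_linearIsometry {F : Type*} [NormedAddCommGroup F] [NormedSpace ℝ F]
    (h : IsMinkowskiFunctional N) (i : F →ₗᵢ[ℝ] E) : IsMinkowskiFunctional fun x => N (i x) where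
  continuous := h.continuous.comp i.continuous
  smul c x := by simp [h.smul]
  pos x hx := h.pos _ ((map_ne_zero_iff i i.injective).2 hx)

/-- The volume of a star body in polar coordinates. -/
theorem measureReal_eq [FiniteDimensional ℝ E] [MeasurableSpace E] [BorelSpace E] [Nontrivial E]
    (μ : Measure E) [μ.IsAddHaarMeasure] (h : IsMinkowskiFunctional N) :
    μ.real {x | N x ≤ 1} = ∫ x in ball (0 : E) 1, (N (‖x‖⁻¹ • x))⁻¹ ^ finrank ℝ E ∂μ := by
  have hd : 0 < finrank ℝ E := finrank_pos
  have hm : MeasurableSet {x | N x ≤ 1} := (isClosed_le h.continuous continuous_const).measurableSet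
  have hi : Integrable (indicator {x | N x ≤ 1} (1 : E → ℝ)) μ :=
    (integrable_indicator_iff hm).2 (integrableOn_const h.isCompact.measure_lt_top.ne)
  rw [← integral_indicator_one hm, integral_eq_setIntegral_ball μ hi, ← integral_const_mul]
  refine integral_congr_ae (ae_restrict_of_ae ?_)
  have h0 : ∀ᵐ x ∂μ, x ≠ 0 := by simp [ae_iff]
  filter_upwards [h0] with x hx
  have hx' : ‖x‖ ≠ 0 := by simpa using hx
  set u := ‖x‖⁻¹ • x
  have hu : 0 < N u := h.pos u (smul_ne_zero (inv_ne_zero hx') hx)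
  have h2 : ∀ r ∈ Ioi (0 : ℝ), r ^ (finrank ℝ E - 1) * indicator {x | N x ≤ 1} (1 : E → ℝ) (r • u) =
      (Iic (N u)⁻¹).indicator (fun r => r ^ (finrank ℝ E - 1)) r := by
    intro r (hr : 0 < r)
    have : N (r • u) ≤ 1 ↔ r ≤ (N u)⁻¹ := by
      rw [h.smul, abs_of_pos hr, ← le_div_iff₀ hu, one_div]
    by_cases h3 : r ≤ (N u)⁻¹
    · simp [indicator, this, h3]
    · simp [indicator, this, h3]
  rw [setIntegral_congr_fun measurableSet_Ioi h2, setIntegral_indicator measurableSet_Iic,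
    Ioi_inter_Iic, ← intervalIntegral.integral_of_le (by positivity), integral_pow,
    Nat.sub_add_cancel hd]
  have : (finrank ℝ E : ℝ) ≠ 0 := by positivity
  simp only [Nat.cast_sub (Nat.succ_le_of_lt hd), Nat.cast_one, Nat.succ_eq_add_one, zero_add,
    sub_add_cancel, zero_pow hd.ne', sub_zero]
  field_simp

end IsMinkowskiFunctional

variable {E : Type*} [NormedAddCommGroup E] [NormedSpace ℝ E] {L : Set E}

theorem IsStarBody.isMinkowskiFunctional_gauge (h : IsStarBody L) (hs : IsOriginSymmetric L) :
    IsMinkowskiFunctional (gauge L) where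
  continuous := h.continuous_gauge
  smul c x := by
    rcases le_total 0 c with hc | hc
    · rw [gauge_smul_of_nonneg hc, abs_of_nonneg hc, smul_eq_mul]
    · rw [← gauge_neg (fun x hx => hs x hx), ← neg_smul, gauge_smul_of_nonneg (neg_nonneg.2 hc),
        abs_of_nonpos hc, smul_eq_mul]
  pos x hx := (gauge_pos (absorbent_nhds_zero (mem_interior_iff_mem_nhds.1 h.zero_mem_interior))
    (NormedSpace.isVonNBounded_of_isBounded ℝ h.isCompact.isBounded)).2 hx

/-- Star-shapedness puts the points of gauge less than one in `L`; those of gauge one are limits `r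
• x` with `r → 1` from below, and `L` is closed. -/
theorem IsStarBody.eq_gauge_le_one (h : IsStarBody L) (hs : IsOriginSymmetric L) :
    L = {x | gauge L x ≤ 1} := by
  have hN := h.isMinkowskiFunctional_gauge hs
  have habs : Absorbent ℝ L :=
    absorbent_nhds_zero (mem_interior_iff_mem_nhds.1 h.zero_mem_interior)
  apply Subset.antisymm
  · exact fun x hx => gauge_le_one_of_mem hx
  · intro x (hx : gauge L x ≤ 1)
    have hlt : ∀ y, gauge L y < 1 → y ∈ L := by
      intro y hy
      obtain ⟨r, hr0, hr1, z, hz, rfl⟩ := exists_lt_of_gauge_lt habs hy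
      exact starConvex_zero_iff.1 h.starConvex hz hr0.le hr1.le
    have hcl : x ∈ closure L := by
      have hc : Filter.Tendsto (fun r : ℝ => r • x) (nhdsWithin 1 (Iio 1)) (nhds x) := by
        have : Filter.Tendsto (fun r : ℝ => r • x) (nhds 1) (nhds ((1 : ℝ) • x)) :=
          (continuous_id.smul continuous_const).tendsto 1
        rw [one_smul] at this
        exact this.mono_left nhdsWithin_le_nhds
      refine mem_closure_of_tendsto hc ?_
      filter_upwards [self_mem_nhdsWithin, nhdsWithin_le_nhds (lt_mem_nhds zero_lt_one)]
        with r hr hr0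
      apply hlt
      have hr1 : r < 1 := hr
      rw [hN.smul, abs_of_pos hr0]
      nlinarith [hN.nonneg x]
    rwa [h.isCompact.isClosed.closure_eq] at hcl

end StarBody

/-! ### Even functions on the sphere, and the radial Gaussian integral. -/

section Angular

open Set Metric Module Filter
open scoped Topology

/-- Even functions that are homogeneous of degree zero and continuous off the origin, that is,
the extensions of continuous even functions on the unit sphere. -/
structure IsEvenAngular {E : Type*} [NormedAddCommGroup E] [NormedSpace ℝ E] (g : E → ℝ) :
    Prop where
  continuousOn : ContinuousOn g {0}ᶜ
  smul : ∀ (c : ℝ) (x : E), c ≠ 0 → g (c • x) = g x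

namespace IsEvenAngular

variable {E : Type*} [NormedAddCommGroup E] [NormedSpace ℝ E] {g : E → ℝ}

theorem neg (h : IsEvenAngular g) (x : E) : g (-x) = g x := by
  simpa using h.smul (-1) x (by norm_num)

theorem radial (h : IsEvenAngular g) {x : E} (hx : x ≠ 0) : g (‖x‖⁻¹ • x) = g x :=
  h.smul _ _ (by simpa using hx)

theorem measurable [MeasurableSpace E] [BorelSpace E] (h : IsEvenAngular g) : Measurable g :=
  measurable_of_continuousOn_compl_singleton 0 h.continuousOn

theorem exists_bound [FiniteDimensional ℝ E] (h : IsEvenAngular g) :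
    ∃ C, 0 ≤ C ∧ ∀ x, |g x| ≤ C := by
  have : ProperSpace E := FiniteDimensional.proper_real E
  obtain ⟨C, hC⟩ := (isCompact_sphere (0 : E) 1).exists_bound_of_continuousOn
    (h.continuousOn.mono fun x hx => by rintro rfl; simp at hx)
  refine ⟨max C |g 0|, le_max_of_le_right (abs_nonneg _), fun x => ?_⟩
  rcases eq_or_ne x 0 with rfl | hx
  · exact le_max_right _ _
  · rw [← h.radial hx]
    exact le_max_of_le_left (hC _ (by simp [norm_smul, hx]))

theorem comp_linearIsometry {F : Type*} [NormedAddCommGroup F] [NormedSpace ℝ F]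
    (h : IsEvenAngular g) (i : F →ₗᵢ[ℝ] E) : IsEvenAngular fun x => g (i x) where
  continuousOn := h.continuousOn.comp i.continuous.continuousOn fun _ hx =>
    (map_ne_zero_iff i i.injective).2 hx
  smul c x hc := by simp [h.smul c _ hc]

variable [FiniteDimensional ℝ E] [MeasurableSpace E] [BorelSpace E] [Nontrivial E]
  (μ : Measure E) [μ.IsAddHaarMeasure]

theorem integrableOn_ball (h : IsEvenAngular g) : IntegrableOn g (ball 0 1) μ := by
  obtain ⟨C, -, hC⟩ := h.exists_bound
  exact Measure.integrableOn_of_bounded measure_ball_lt_top.ne h.measurable.aestronglyMeasurable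
    (M := C) (.of_forall hC)

/-- Both sides are the same spherical integral: the radial integrals of `r^d` and `r^(d-1)` over
`(0, 1)` are `1/(d+1)` and `1/d`. This removes the weight `‖u‖` that the Gaussian limit produces. -/
theorem setIntegral_ball_mul_norm (h : IsEvenAngular g) :
    (finrank ℝ E + 1 : ℝ) * ∫ x in ball (0 : E) 1, g x * ‖x‖ ∂μ =
      finrank ℝ E * ∫ x in ball (0 : E) 1, g x ∂μ := by
  have hd : 0 < finrank ℝ E := finrank_pos
  have hi : Integrable ((ball (0 : E) 1).indicator fun x => g x * ‖x‖) μ := by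
    rw [integrable_indicator_iff measurableSet_ball]
    obtain ⟨C, hC0, hC⟩ := h.exists_bound
    refine Measure.integrableOn_of_bounded (M := C) measure_ball_lt_top.ne
      (h.measurable.mul measurable_norm).aestronglyMeasurable ?_
    refine (ae_restrict_mem measurableSet_ball).mono fun x hx => ?_
    have hx' : ‖x‖ ≤ 1 := by simpa using (mem_ball_zero_iff.1 hx).le
    rw [norm_mul, norm_norm]
    calc _ ≤ C * 1 := by gcongr; exact hC x
      _ = C := mul_one _
  rw [← integral_indicator measurableSet_ball, integral_eq_setIntegral_ball μ hi]
  have h0 : ∀ᵐ x ∂μ, x ≠ 0 := by simp [ae_iff]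
  have : ∫ x in ball (0 : E) 1, (∫ r in Ioi (0 : ℝ), r ^ (finrank ℝ E - 1) *
      (ball (0 : E) 1).indicator (fun x => g x * ‖x‖) (r • (‖x‖⁻¹ • x))) ∂μ =
      ∫ x in ball (0 : E) 1, g x * (finrank ℝ E + 1 : ℝ)⁻¹ ∂μ := by
    refine integral_congr_ae (ae_restrict_of_ae ?_)
    filter_upwards [h0] with x hx
    have hu : ‖‖x‖⁻¹ • x‖ = 1 := by simp [norm_smul, hx]
    have h2 : ∀ r ∈ Ioi (0 : ℝ), r ^ (finrank ℝ E - 1) *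
        (ball (0 : E) 1).indicator (fun x => g x * ‖x‖) (r • (‖x‖⁻¹ • x)) =
        (Iio (1 : ℝ)).indicator (fun r => g x * r ^ finrank ℝ E) r := by
      intro r (hr : 0 < r)
      have h3 : ‖r • (‖x‖⁻¹ • x)‖ = r := by rw [norm_smul, hu, mul_one, Real.norm_of_nonneg hr.le]
      by_cases h4 : r < 1
      · rw [indicator_of_mem (by simpa [h3] using h4), indicator_of_mem (by simpa using h4), h3,
          h.smul _ _ hr.ne', h.radial hx]
        nth_rewrite 2 [← Nat.sub_add_cancel hd]
        rw [pow_succ]; ring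
      · rw [indicator_of_notMem (by simpa [h3] using h4), indicator_of_notMem (by simpa using h4),
          mul_zero]
    rw [setIntegral_congr_fun measurableSet_Ioi h2, setIntegral_indicator measurableSet_Iio,
      Ioi_inter_Iio, ← integral_Ioc_eq_integral_Ioo,
      ← intervalIntegral.integral_of_le zero_le_one, intervalIntegral.integral_const_mul,
      integral_pow]
    simp
  rw [this, integral_mul_const]
  field_simp

end IsEvenAngular

/-- By evenness this is half the Fourier transform of a Gaussian. As a function of `a` the right
side has total mass `π` for every `h` and concentrates at `a = 0` as `h → 0`; this is the source of
the factor `π` and of the restriction to `ξ^⊥`. -/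
theorem integral_Ioi_exp_mul_cos {h : ℝ} (hh : 0 < h) (a : ℝ) :
    ∫ r in Ioi (0 : ℝ), Real.exp (-(h ^ 2 / 2) * r ^ 2) * Real.cos (r * a) =
      √(2 * Real.pi) / (2 * h) * Real.exp (-(a ^ 2 / (2 * h ^ 2))) := by
  have h1 := integral_comp_abs (f := fun r => Real.exp (-(h ^ 2 / 2) * r ^ 2) * Real.cos (r * a))
  have h2 : ∀ x : ℝ, Real.exp (-(h ^ 2 / 2) * |x| ^ 2) * Real.cos (|x| * a) =
      (Complex.exp (Complex.I * a * x) * Complex.exp (-((h ^ 2 / 2 : ℝ) : ℂ) * x ^ 2)).re := by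
    intro x
    have e1 : Complex.exp (-((h ^ 2 / 2 : ℝ) : ℂ) * x ^ 2) =
        ((Real.exp (-(h ^ 2 / 2) * x ^ 2) : ℝ) : ℂ) := by push_cast; rfl
    have e2 : Complex.exp (Complex.I * a * x) = Complex.exp (((x * a : ℝ) : ℂ) * Complex.I) := by
      push_cast; ring_nf
    rw [e1, e2, Complex.re_mul_ofReal, Complex.exp_ofReal_mul_I_re, sq_abs]
    rcases abs_choice x with hx | hx <;> rw [hx] <;> simp [mul_comm]
  have hb : 0 < ((h ^ 2 / 2 : ℝ) : ℂ).re := by rw [Complex.ofReal_re]; positivity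
  have h3 : Integrable fun x : ℝ =>
      Complex.exp (Complex.I * a * x) * Complex.exp (-((h ^ 2 / 2 : ℝ) : ℂ) * x ^ 2) := by
    refine (integrable_cexp_quadratic hb (Complex.I * a) 0).congr (.of_forall fun x => ?_)
    simp only []
    rw [← Complex.exp_add]; ring_nf
  simp_rw [h2] at h1
  have h4 := integral_re h3
  simp only [RCLike.re_eq_complex_re] at h4
  rw [h4, fourierIntegral_gaussian hb] at h1
  have h5 : ((Real.pi : ℂ) / ((h ^ 2 / 2 : ℝ) : ℂ)) ^ (1 / 2 : ℂ) =
      ((√(2 * Real.pi) / h : ℝ) : ℂ) := by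
    rw [← Complex.ofReal_div, show (1 / 2 : ℂ) = ((1 / 2 : ℝ) : ℂ) by push_cast; rfl,
      ← Complex.ofReal_cpow (by positivity), ← Real.sqrt_eq_rpow]
    congr 1
    rw [show Real.pi / (h ^ 2 / 2) = 2 * Real.pi / h ^ 2 by field_simp,
      Real.sqrt_div (by positivity), Real.sqrt_sq hh.le]
  have h6 : Complex.exp (-(a : ℂ) ^ 2 / (4 * ((h ^ 2 / 2 : ℝ) : ℂ))) =
      ((Real.exp (-(a ^ 2 / (2 * h ^ 2))) : ℝ) : ℂ) := by
    push_cast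
    congr 1
    have : (h : ℂ) ≠ 0 := by exact_mod_cast hh.ne'
    field_simp
    ring
  rw [h5, h6, ← Complex.ofReal_mul, Complex.ofReal_re] at h1
  have : √(2 * Real.pi) / (2 * h) = (√(2 * Real.pi) / h) / 2 := by field_simp
  rw [this]
  linarith

section Integrability

variable {E : Type*} [NormedAddCommGroup E] [NormedSpace ℝ E] [FiniteDimensional ℝ E]
  [MeasurableSpace E] [BorelSpace E] [Nontrivial E] (μ : Measure E) [μ.IsAddHaarMeasure]

/-- In dimension `k + 1` the weight `r^(-k)` cancels the Jacobian `r^k` exactly, so integrability is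
a one-dimensional question about `w`. -/
theorem integrable_inv_norm_pow_mul {w : ℝ → ℝ} {k : ℕ} (hd : finrank ℝ E = k + 1)
    (hw : IntegrableOn w (Ioi 0)) : Integrable (fun x : E => (‖x‖ ^ k)⁻¹ * w ‖x‖) μ := by
  refine (integrable_fun_norm_addHaar μ (f := fun r => (r ^ k)⁻¹ * w r)).2 ?_
  refine hw.congr_fun (fun r (hr : 0 < r) => ?_) measurableSet_Ioi
  have : r ^ k ≠ 0 := by positivity
  simp [hd, this]

end Integrability

end Angular

/-! ### Gaussian regularization of the Fourier transform and its limit. -/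

section Fourier

open Set Metric Module Filter
open scoped Topology

variable {E : Type*} [NormedAddCommGroup E] [InnerProductSpace ℝ E] [FiniteDimensional ℝ E]
  [MeasurableSpace E] [BorelSpace E]

/-- The Fourier transform of `g x * ‖x‖ ^ (-k) * exp (-h² ‖x‖² / 2)`, `k = dim E - 1`. -/
def gaussianRadon (g : E → ℝ) (h : ℝ) (ξ : E) : ℝ :=
  finrank ℝ E * ∫ x in ball (0 : E) 1, g x *
    (√(2 * Real.pi) / (2 * h) * Real.exp (-((inner ℝ (‖x‖⁻¹ • x) ξ) ^ 2 / (2 * h ^ 2)))) ∂lebesgue E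

theorem integrable_gaussian_angular [Nontrivial E] {g : E → ℝ} (hg : IsEvenAngular g) {k : ℕ}
    (hd : finrank ℝ E = k + 1) {h : ℝ} (hh : 0 < h) :
    Integrable (fun x => g x * (‖x‖ ^ k)⁻¹ * Real.exp (-(h ^ 2 / 2) * ‖x‖ ^ 2)) (lebesgue E) := by
  obtain ⟨C, hC0, hC⟩ := hg.exists_bound
  have h1 := (integrable_inv_norm_pow_mul (lebesgue E) hd
    (integrable_exp_neg_mul_sq (b := h ^ 2 / 2) (by positivity)).integrableOn).const_mul C
  refine h1.mono' ?_ (.of_forall fun x => ?_)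
  · have := hg.measurable
    apply Measurable.aestronglyMeasurable
    fun_prop
  · rw [norm_mul, norm_mul, mul_assoc, norm_inv, norm_pow, norm_norm,
      Real.norm_of_nonneg (Real.exp_nonneg _)]
    gcongr
    exact hC x

theorem integral_gaussian_angular_cos [Nontrivial E] {g : E → ℝ} (hg : IsEvenAngular g) {k : ℕ}
    (hd : finrank ℝ E = k + 1) {h : ℝ} (hh : 0 < h) (ξ : E) :
    ∫ x, g x * (‖x‖ ^ k)⁻¹ * Real.exp (-(h ^ 2 / 2) * ‖x‖ ^ 2) * Real.cos (inner ℝ x ξ)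
        ∂lebesgue E =
      gaussianRadon g h ξ := by
  have hi : Integrable (fun x => g x * (‖x‖ ^ k)⁻¹ * Real.exp (-(h ^ 2 / 2) * ‖x‖ ^ 2) *
      Real.cos (inner ℝ x ξ)) (lebesgue E) := by
    refine (integrable_gaussian_angular hg hd hh).mul_bdd (c := 1) ?_ (.of_forall fun x => ?_)
    · exact (by fun_prop : Continuous fun x : E => Real.cos (inner ℝ x ξ)).aestronglyMeasurable
    · exact Real.abs_cos_le_one _
  rw [integral_eq_setIntegral_ball _ hi, gaussianRadon]
  congr 1
  have h0 : ∀ᵐ x ∂lebesgue E, x ≠ 0 := by simp [ae_iff]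
  refine integral_congr_ae (ae_restrict_of_ae ?_)
  filter_upwards [h0] with x hx
  rw [← integral_Ioi_exp_mul_cos hh, ← integral_const_mul]
  refine setIntegral_congr_fun measurableSet_Ioi fun r (hr : 0 < r) => ?_
  have hu : ‖‖x‖⁻¹ • x‖ = 1 := by simp [norm_smul, hx]
  have h3 : ‖r • (‖x‖⁻¹ • x)‖ = r := by rw [norm_smul, hu, mul_one, Real.norm_of_nonneg hr.le]
  have h4 : r ^ k ≠ 0 := by positivity
  simp only [h3, hd, Nat.add_sub_cancel, hg.smul _ _ hr.ne', hg.radial hx, real_inner_smul_left]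
  field_simp

theorem integral_gaussian_angular_sin {g : E → ℝ} (hg : IsEvenAngular g) {k : ℕ} (h : ℝ) (ξ : E) :
    ∫ x, g x * (‖x‖ ^ k)⁻¹ * Real.exp (-(h ^ 2 / 2) * ‖x‖ ^ 2) * Real.sin (inner ℝ x ξ)
      ∂lebesgue E = 0 := by
  have h1 := integral_neg_eq_self (fun x => g x * (‖x‖ ^ k)⁻¹ * Real.exp (-(h ^ 2 / 2) * ‖x‖ ^ 2) *
    Real.sin (inner ℝ x ξ)) (lebesgue E)
  simp only [hg.neg, norm_neg, inner_neg_left, Real.sin_neg, mul_neg, integral_neg] at h1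
  linarith

theorem integral_gaussian_angular_cexp [Nontrivial E] {g : E → ℝ} (hg : IsEvenAngular g) {k : ℕ}
    (hd : finrank ℝ E = k + 1) {h : ℝ} (hh : 0 < h) (ξ : E) :
    ∫ x, ((g x * (‖x‖ ^ k)⁻¹ * Real.exp (-(h ^ 2 / 2) * ‖x‖ ^ 2) : ℝ) : ℂ) *
      Complex.exp (-(Complex.I * ((inner ℝ x ξ : ℝ) : ℂ))) ∂lebesgue E = gaussianRadon g h ξ := by
  have hi := integrable_gaussian_angular hg hd hh
  have hc : Integrable (fun x => g x * (‖x‖ ^ k)⁻¹ * Real.exp (-(h ^ 2 / 2) * ‖x‖ ^ 2) *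
      Real.cos (inner ℝ x ξ)) (lebesgue E) := by
    refine hi.mul_bdd (c := 1) ?_ (.of_forall fun x => Real.abs_cos_le_one _)
    exact (by fun_prop : Continuous fun x : E => Real.cos (inner ℝ x ξ)).aestronglyMeasurable
  have hs : Integrable (fun x => g x * (‖x‖ ^ k)⁻¹ * Real.exp (-(h ^ 2 / 2) * ‖x‖ ^ 2) *
      Real.sin (inner ℝ x ξ)) (lebesgue E) := by
    refine hi.mul_bdd (c := 1) ?_ (.of_forall fun x => Real.abs_sin_le_one _)
    exact (by fun_prop : Continuous fun x : E => Real.sin (inner ℝ x ξ)).aestronglyMeasurable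
  rw [← integral_gaussian_angular_cos hg hd hh]
  have h1 : ∀ x : E, ((g x * (‖x‖ ^ k)⁻¹ * Real.exp (-(h ^ 2 / 2) * ‖x‖ ^ 2) : ℝ) : ℂ) *
      Complex.exp (-(Complex.I * ((inner ℝ x ξ : ℝ) : ℂ))) =
      ((g x * (‖x‖ ^ k)⁻¹ * Real.exp (-(h ^ 2 / 2) * ‖x‖ ^ 2) * Real.cos (inner ℝ x ξ) : ℝ) : ℂ) -
      ((g x * (‖x‖ ^ k)⁻¹ * Real.exp (-(h ^ 2 / 2) * ‖x‖ ^ 2) * Real.sin (inner ℝ x ξ) : ℝ) : ℂ) *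
        Complex.I := by
    intro x
    have : -(Complex.I * ((inner ℝ x ξ : ℝ) : ℂ)) = ((-inner ℝ x ξ : ℝ) : ℂ) * Complex.I := by
      push_cast; ring
    rw [this, Complex.exp_mul_I, ← Complex.ofReal_cos, ← Complex.ofReal_sin, Real.cos_neg,
      Real.sin_neg]
    push_cast
    ring
  simp_rw [h1]
  rw [integral_sub hc.ofReal (hs.ofReal.mul_const _), integral_mul_const,
    integral_complex_ofReal, integral_complex_ofReal, integral_gaussian_angular_sin hg]
  simp

section Slicing

variable {U : Type*} [NormedAddCommGroup U] [InnerProductSpace ℝ U] [FiniteDimensional ℝ U]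
  [MeasurableSpace U] [BorelSpace U]

/-- The integrand of `gaussianRadon` in coordinates along and across `ξ = c • v`, with the
longitudinal coordinate scaled by `h`. -/
def slicedIntegrand (g : E → ℝ) (i : U →ₗᵢ[ℝ] E) (v : E) (c h : ℝ) (p : U × ℝ) : ℝ :=
  (ball (0 : E) 1).indicator g (i p.1 + (h * p.2) • v) *
    Real.exp (-(c ^ 2 * p.2 ^ 2 / (2 * ‖i p.1 + (h * p.2) • v‖ ^ 2)))

/-- Inside the unit ball `‖x‖ < 1`, so dropping `‖x‖²` from the denominator only weakens the
exponential decay. The resulting bound does not involve `h`, which is what dominated convergence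
needs. -/
theorem norm_slicedIntegrand_le (i : U →ₗᵢ[ℝ] E) {v : E} (hv : ‖v‖ = 1)
    (ho : ∀ u, inner ℝ (i u) v = 0)
    {g : E → ℝ} {C : ℝ} (hC0 : 0 ≤ C) (hC : ∀ x, |g x| ≤ C) (c : ℝ)
    {h : ℝ} (hh : 0 < h) (p : U × ℝ) :
    ‖slicedIntegrand g i v c h p‖ ≤
      (ball (0 : U) 1).indicator (fun _ => C) p.1 * Real.exp (-(c ^ 2 / 2) * p.2 ^ 2) := by
  have hn := norm_slice_sq i hv ho p.1 (h * p.2)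
  rw [slicedIntegrand, norm_mul, Real.norm_of_nonneg (Real.exp_nonneg _)]
  by_cases hx : ‖i p.1 + (h * p.2) • v‖ < 1
  · have hx2 : ‖i p.1 + (h * p.2) • v‖ ^ 2 < 1 := by
      have := norm_nonneg (i p.1 + (h * p.2) • v); nlinarith
    have hu : ‖p.1‖ < 1 := by
      have : ‖p.1‖ ^ 2 < 1 := by nlinarith [sq_nonneg (h * p.2)]
      nlinarith [norm_nonneg p.1]
    rw [indicator_of_mem (by simpa using hx), indicator_of_mem (by simpa using hu)]
    gcongr
    · exact hC _
    · rcases eq_or_ne p.2 0 with h0 | h0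
      · simp [h0]
      have hpos : 0 < ‖i p.1 + (h * p.2) • v‖ ^ 2 := by rw [hn]; positivity
      rw [neg_mul, neg_le_neg_iff, div_mul_eq_mul_div]
      apply div_le_div_of_nonneg_left (by positivity) (by positivity)
      linarith
  · rw [indicator_of_notMem (by simpa using hx)]
    simp only [norm_zero, zero_mul]
    exact mul_nonneg (indicator_nonneg (fun _ _ => hC0) _) (Real.exp_nonneg _)

theorem integrable_slice_bound (C : ℝ) {c : ℝ} (hc : 0 < c) :
    Integrable (fun p : U × ℝ => (ball (0 : U) 1).indicator (fun _ => C) p.1 *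
      Real.exp (-(c ^ 2 / 2) * p.2 ^ 2)) ((lebesgue U).prod volume) := by
  refine Integrable.mul_prod (f := (ball (0 : U) 1).indicator (fun _ => C)) ?_
    (integrable_exp_neg_mul_sq (by positivity))
  exact (integrable_indicator_iff measurableSet_ball).2 (integrableOn_const measure_ball_lt_top.ne)

theorem measurable_slicedIntegrand (i : U →ₗᵢ[ℝ] E) (v : E) {g : E → ℝ} (hg : Measurable g)
    (c h : ℝ) :
    Measurable (slicedIntegrand g i v c h) := by
  unfold slicedIntegrand
  have h1 : Measurable fun p : U × ℝ => i p.1 + (h * p.2) • v := by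
    have := i.continuous
    exact (by fun_prop : Continuous fun p : U × ℝ => i p.1 + (h * p.2) • v).measurable
  refine ((hg.indicator measurableSet_ball).comp h1).mul ?_
  fun_prop

theorem integrable_slicedIntegrand (i : U →ₗᵢ[ℝ] E) {v : E} (hv : ‖v‖ = 1)
    (ho : ∀ u, inner ℝ (i u) v = 0)
    {g : E → ℝ} (hg : IsEvenAngular g) {c h : ℝ} (hc : 0 < c)
    (hh : 0 < h) : Integrable (slicedIntegrand g i v c h) ((lebesgue U).prod volume) := by
  obtain ⟨C, hC0, hC⟩ := hg.exists_bound
  exact (integrable_slice_bound C hc).mono'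
    (measurable_slicedIntegrand i v hg.measurable c h).aestronglyMeasurable
    (.of_forall (norm_slicedIntegrand_le i hv ho hC0 hC c hh))

/-- The Gaussian has width of order `h` across `ξ^⊥`. Rescaling the coordinate along `v` by `h`
absorbs the prefactor `1 / h` and leaves an integrand with a limit. -/
theorem gaussianRadon_eq_integral_slicedIntegrand [Nontrivial E] (i : U →ₗᵢ[ℝ] E) {v : E}
    (hv : ‖v‖ = 1) (ho : ∀ u, inner ℝ (i u) v = 0)
    (hd : finrank ℝ E = finrank ℝ U + 1) {g : E → ℝ} (hg : IsEvenAngular g) {c h : ℝ} (hc : 0 < c)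
    (hh : 0 < h) :
    gaussianRadon g h (c • v) = finrank ℝ E * (√(2 * Real.pi) / 2) *
      ∫ p, slicedIntegrand g i v c h p ∂((lebesgue U).prod volume) := by
  obtain ⟨e, he, hmp⟩ := exists_slice_homeomorph i v hv ho hd
  set Q : E → ℝ := fun x => (ball (0 : E) 1).indicator g x *
    Real.exp (-((inner ℝ (‖x‖⁻¹ • x) (c • v)) ^ 2 / (2 * h ^ 2))) with hQ
  have hQi : Integrable Q (lebesgue E) := by
    have := (integrable_indicator_iff measurableSet_ball).2 (hg.integrableOn_ball (lebesgue E))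
    refine this.mul_bdd (c := 1) ?_ (.of_forall fun x => ?_)
    · apply Measurable.aestronglyMeasurable
      fun_prop
    · rw [Real.norm_of_nonneg (Real.exp_nonneg _)]
      apply Real.exp_le_one_iff.2
      have : 0 ≤ (inner ℝ (‖x‖⁻¹ • x) (c • v)) ^ 2 / (2 * h ^ 2) := by positivity
      linarith
  have h1 : gaussianRadon g h (c • v) = finrank ℝ E * (√(2 * Real.pi) / (2 * h)) *
      ∫ x, Q x ∂lebesgue E := by
    rw [gaussianRadon, ← integral_indicator measurableSet_ball, mul_assoc]
    congr 1
    rw [← integral_const_mul]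
    congr with x
    by_cases hx : x ∈ ball (0 : E) 1
    · simp only [hQ, indicator_of_mem hx]; ring
    · simp only [hQ, indicator_of_notMem hx]; ring
  have hQe : ∀ u t, Q (e (u, h * t)) = slicedIntegrand g i v c h (u, t) := by
    intro u t
    simp only [hQ, he, slicedIntegrand]
    congr 3
    rw [inner_smul_left, inner_smul_right, inner_add_left, ho, inner_smul_left,
      real_inner_self_eq_norm_sq, hv]
    simp only [conj_trivial]
    -- At the origin both exponents vanish, since inverse and division of zero are zero.
    rcases eq_or_ne (i u + (h * t) • v) 0 with h0 | h0
    · simp [h0]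
    · have : ‖i u + (h * t) • v‖ ≠ 0 := by simpa using h0
      field_simp
      ring
  have h2 : ∫ x, Q x ∂lebesgue E =
      h * ∫ p, slicedIntegrand g i v c h p ∂((lebesgue U).prod volume) := by
    rw [← hmp.integral_comp e.measurableEmbedding, integral_prod, integral_prod,
      ← integral_const_mul]
    · congr with u
      have := Measure.integral_comp_mul_left (fun t => Q (e (u, t))) h
      simp only [hQe] at this
      rw [this, abs_of_pos (inv_pos.2 hh), smul_eq_mul]
      field_simp
    · exact integrable_slicedIntegrand i hv ho hg hc hh
    · exact (hmp.integrable_comp_emb e.measurableEmbedding).2 hQi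
  rw [h1, h2]
  field_simp

theorem abs_gaussianRadon_le [Nontrivial E] (i : U →ₗᵢ[ℝ] E) {v : E} (hv : ‖v‖ = 1)
    (ho : ∀ u, inner ℝ (i u) v = 0)
    (hd : finrank ℝ E = finrank ℝ U + 1) {g : E → ℝ}
    (hg : IsEvenAngular g) {C : ℝ} (hC0 : 0 ≤ C) (hC : ∀ x, |g x| ≤ C) {c h : ℝ} (hc : 0 < c)
    (hh : 0 < h) :
    |gaussianRadon g h (c • v)| ≤
      finrank ℝ E * Real.pi * C * (lebesgue U).real (ball 0 1) / c := by
  rw [gaussianRadon_eq_integral_slicedIntegrand i hv ho hd hg hc hh, abs_mul,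
    abs_of_nonneg (by positivity)]
  have h1 := norm_integral_le_of_norm_le (integrable_slice_bound (U := U) C hc)
    (.of_forall (norm_slicedIntegrand_le i hv ho hC0 hC c hh))
  rw [integral_prod_mul (μ := lebesgue U) (ν := volume) ((ball (0 : U) 1).indicator (fun _ => C))
    (fun t => Real.exp (-(c ^ 2 / 2) * t ^ 2)), integral_gaussian,
    integral_indicator_const _ measurableSet_ball, smul_eq_mul,
    show Real.pi / (c ^ 2 / 2) = 2 * Real.pi / c ^ 2 by field_simp,
    Real.sqrt_div (by positivity), Real.sqrt_sq hc.le] at h1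
  calc _ ≤ finrank ℝ E * (√(2 * Real.pi) / 2) *
        ((lebesgue U).real (ball 0 1) * C * (√(2 * Real.pi) / c)) := by
        gcongr; exact h1
    _ = finrank ℝ E * (√(2 * Real.pi) * √(2 * Real.pi)) * C * (lebesgue U).real (ball 0 1)
        / (2 * c) := by field_simp
    _ = _ := by rw [Real.mul_self_sqrt (by positivity)]; field_simp

/-- As `h → 0` the slice point tends to `i u`, and the remaining Gaussian in `t` integrates to
`√(2π) ‖u‖ / c`. The weight `‖u‖` is then traded for a dimensional factor by
`setIntegral_ball_mul_norm`. -/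
theorem tendsto_gaussianRadon [Nontrivial E] [Nontrivial U] (i : U →ₗᵢ[ℝ] E) {v : E} (hv : ‖v‖ = 1)
    (ho : ∀ u, inner ℝ (i u) v = 0)
    (hd : finrank ℝ E = finrank ℝ U + 1)
    {g : E → ℝ} (hg : IsEvenAngular g) {c : ℝ} (hc : 0 < c) :
    Tendsto (fun h => gaussianRadon g h (c • v)) (𝓝[>] 0)
      (𝓝 (Real.pi / c * (finrank ℝ U * ∫ u in ball (0 : U) 1, g (i u) ∂lebesgue U))) := by
  obtain ⟨C, hC0, hC⟩ := hg.exists_bound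
  have hgi := hg.comp_linearIsometry i
  have hlim : Tendsto (fun h => ∫ p, slicedIntegrand g i v c h p ∂((lebesgue U).prod volume))
      (𝓝[>] 0) (𝓝 (∫ p, (ball (0 : U) 1).indicator (fun u => g (i u)) p.1 *
        Real.exp (-(c ^ 2 * p.2 ^ 2 / (2 * ‖p.1‖ ^ 2))) ∂((lebesgue U).prod volume))) := by
    refine tendsto_integral_filter_of_dominated_convergence _ (.of_forall fun h =>
      (measurable_slicedIntegrand i v hg.measurable c h).aestronglyMeasurable)
      (eventually_nhdsWithin_of_forall fun h (hh : 0 < h) =>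
        .of_forall (norm_slicedIntegrand_le i hv ho hC0 hC c hh)) (integrable_slice_bound C hc) ?_
    have h0 : ∀ᵐ p ∂((lebesgue U).prod (volume : Measure ℝ)), p.1 ≠ 0 :=
      Measure.quasiMeasurePreserving_fst.ae (p := fun u : U => u ≠ 0) (by simp [ae_iff])
    filter_upwards [h0] with p hp
    refine Tendsto.mono_left ?_ nhdsWithin_le_nhds
    have hip : i p.1 ≠ 0 := (map_ne_zero_iff i i.injective).2 hp
    have hx : Tendsto (fun h : ℝ => i p.1 + (h * p.2) • v) (𝓝 0) (𝓝 (i p.1)) := by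
      have : Continuous fun h : ℝ => i p.1 + (h * p.2) • v := by fun_prop
      simpa using this.tendsto 0
    have hn : ‖i p.1‖ ≠ 0 := by simpa using hp
    refine Tendsto.mul ?_ ?_
    · by_cases hb : ‖p.1‖ < 1
      · rw [indicator_of_mem (by simpa using hb)]
        have h1 : Tendsto (fun h : ℝ => g (i p.1 + (h * p.2) • v)) (𝓝 0) (𝓝 (g (i p.1))) :=
          (hg.continuousOn.continuousAt (isOpen_compl_singleton.mem_nhds hip)).tendsto.comp hx
        refine h1.congr' ?_
        have : ∀ᶠ x in 𝓝 (i p.1), x ∈ ball (0 : E) 1 :=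
          isOpen_ball.mem_nhds (by simpa using hb)
        filter_upwards [hx.eventually this] with h hh
        rw [indicator_of_mem hh]
      · rw [indicator_of_notMem (by simpa using hb)]
        -- A component along `v` only increases the norm, so for `‖u‖ ≥ 1` the slice point is
        -- outside the open ball for every `h`. Hence no exceptional set is needed on the boundary.
        refine tendsto_const_nhds.congr fun h => ?_
        rw [indicator_of_notMem]
        rw [mem_ball_zero_iff, not_lt]
        have h1 := norm_slice_sq i hv ho p.1 (h * p.2)
        rw [not_lt] at hb
        have : 1 ≤ ‖i p.1 + (h * p.2) • v‖ ^ 2 := by nlinarith [sq_nonneg (h * p.2)]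
        nlinarith [norm_nonneg (i p.1 + (h * p.2) • v)]
    · have h2 : Tendsto (fun h : ℝ => ‖i p.1 + (h * p.2) • v‖) (𝓝 0) (𝓝 ‖i p.1‖) := hx.norm
      rw [i.norm_map] at h2 hn
      refine (Real.continuous_exp.tendsto _).comp (Tendsto.neg ?_)
      exact tendsto_const_nhds.div (tendsto_const_nhds.mul (h2.pow 2)) (by positivity)
  have hval : ∫ p, (ball (0 : U) 1).indicator (fun u => g (i u)) p.1 *
        Real.exp (-(c ^ 2 * p.2 ^ 2 / (2 * ‖p.1‖ ^ 2))) ∂((lebesgue U).prod volume) =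
      √(2 * Real.pi) / c * ∫ u in ball (0 : U) 1, g (i u) * ‖u‖ ∂lebesgue U := by
    rw [integral_prod, ← integral_indicator measurableSet_ball, ← integral_const_mul]
    · refine integral_congr_ae ?_
      have h0 : ∀ᵐ u ∂(lebesgue U), u ≠ 0 := by simp [ae_iff]
      filter_upwards [h0] with u hu
      have hu' : 0 < ‖u‖ := by positivity
      have h1 : ∀ t : ℝ, -(c ^ 2 * t ^ 2 / (2 * ‖u‖ ^ 2)) = -(c ^ 2 / (2 * ‖u‖ ^ 2)) * t ^ 2 := by
        intro t; ring
      simp_rw [h1]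
      rw [integral_const_mul, integral_gaussian,
        show Real.pi / (c ^ 2 / (2 * ‖u‖ ^ 2)) = 2 * Real.pi * (‖u‖ / c) ^ 2 by field_simp,
        Real.sqrt_mul (by positivity), Real.sqrt_sq (by positivity)]
      by_cases hb : u ∈ ball (0 : U) 1
      · simp only [indicator_of_mem hb]; field_simp
      · simp only [indicator_of_notMem hb]; ring
    · refine (integrable_slice_bound C hc).mono' ?_ ?_
      · apply Measurable.aestronglyMeasurable
        refine ((hgi.measurable.indicator measurableSet_ball).comp measurable_fst).mul ?_
        fun_prop
      · filter_upwards [Measure.quasiMeasurePreserving_fst.ae (p := fun u : U => u ≠ 0)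
          (by simp [ae_iff])] with p hp
        rw [norm_mul, Real.norm_of_nonneg (Real.exp_nonneg _)]
        by_cases hb : ‖p.1‖ < 1
        · rw [indicator_of_mem (by simpa using hb), indicator_of_mem (by simpa using hb)]
          have hpos : 0 < ‖p.1‖ := by positivity
          gcongr
          · exact hC _
          · rw [neg_mul, neg_le_neg_iff, div_mul_eq_mul_div]
            apply div_le_div_of_nonneg_left (by positivity) (by positivity)
            nlinarith
        · rw [indicator_of_notMem (by simpa using hb), indicator_of_notMem (by simpa using hb)]
          simp
  have hfin : Tendsto (fun h => gaussianRadon g h (c • v)) (𝓝[>] 0) _ :=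
    (hlim.const_mul (finrank ℝ E * (√(2 * Real.pi) / 2))).congr'
      (eventually_nhdsWithin_of_forall fun h (hh : 0 < h) =>
        (gaussianRadon_eq_integral_slicedIntegrand i hv ho hd hg hc hh).symm)
  convert hfin using 2
  rw [hval, ← hgi.setIntegral_ball_mul_norm (lebesgue U), hd]
  have hs : √(2 * Real.pi) * √(2 * Real.pi) = 2 * Real.pi := Real.mul_self_sqrt (by positivity)
  push_cast
  generalize (∫ u in ball (0 : U) 1, g (i u) * ‖u‖ ∂lebesgue U) = I at *
  calc _ = (finrank ℝ U + 1 : ℝ) / (2 * c) * (√(2 * Real.pi) * √(2 * Real.pi)) * I := by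
        rw [hs]; field_simp
    _ = _ := by ring

end Slicing

end Fourier

/-! ### The distributional Fourier transform as a spherical Radon transform. -/

section Fourier

open Set Metric Module Filter
open scoped Topology FourierTransform

/-- The spherical Radon transform `∫_{S ∩ ξ^⊥} g` of an even function on the sphere, the integral
over the sphere being written as an integral over the ball. -/
def sphericalRadon {E : Type*} [NormedAddCommGroup E] [InnerProductSpace ℝ E]
    [FiniteDimensional ℝ E] [MeasurableSpace E] [BorelSpace E] (g : E → ℝ) (ξ : E) : ℝ :=
  finrank ℝ (ℝ ∙ ξ)ᗮ * ∫ y in ball (0 : (ℝ ∙ ξ)ᗮ) 1, g (y : E) ∂lebesgue (ℝ ∙ ξ)ᗮ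

theorem finrank_orthogonal_span {E : Type*} [NormedAddCommGroup E] [InnerProductSpace ℝ E]
    {k : ℕ} (hd : finrank ℝ E = k + 1) {ξ : E} (hξ : ξ ≠ 0) : finrank ℝ (ℝ ∙ ξ)ᗮ = k := by
  have : Fact (finrank ℝ E = k + 1) := ⟨hd⟩
  exact Submodule.finrank_orthogonal_span_singleton hξ

section Limit

variable {E : Type*} [NormedAddCommGroup E] [InnerProductSpace ℝ E] [FiniteDimensional ℝ E]
  [MeasurableSpace E] [BorelSpace E] [Nontrivial E]

theorem inner_subtype_radial (ξ : E) (u : (ℝ ∙ ξ)ᗮ) :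
    inner ℝ ((ℝ ∙ ξ)ᗮ.subtypeₗᵢ u) (‖ξ‖⁻¹ • ξ) = 0 := by
  have := Submodule.mem_orthogonal_singleton_iff_inner_left.1 u.2
  simp [inner_smul_right, this]

theorem tendsto_gaussianRadon_sphericalRadon {k : ℕ} (hk : 1 ≤ k) (hd : finrank ℝ E = k + 1)
    {g : E → ℝ} (hg : IsEvenAngular g) {ξ : E} (hξ : ξ ≠ 0) :
    Tendsto (fun h => gaussianRadon g h ξ) (𝓝[>] 0)
      (𝓝 (Real.pi * ‖ξ‖⁻¹ * sphericalRadon g ξ)) := by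
  have hf := finrank_orthogonal_span hd hξ
  have : Nontrivial (ℝ ∙ ξ)ᗮ := nontrivial_of_finrank_pos (R := ℝ) (by omega)
  have hn : 0 < ‖ξ‖ := by positivity
  have h1 := tendsto_gaussianRadon (ℝ ∙ ξ)ᗮ.subtypeₗᵢ (v := ‖ξ‖⁻¹ • ξ) (by simp [norm_smul, hξ])
    (inner_subtype_radial ξ) (by omega) hg hn
  rw [smul_smul, mul_inv_cancel₀ hn.ne', one_smul] at h1
  exact h1

theorem exists_abs_gaussianRadon_le {k : ℕ} (hd : finrank ℝ E = k + 1)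
    {g : E → ℝ} (hg : IsEvenAngular g) :
    ∃ C, 0 ≤ C ∧ ∀ h > 0, ∀ ξ : E, ξ ≠ 0 → |gaussianRadon g h ξ| ≤ C * ‖ξ‖⁻¹ := by
  obtain ⟨C, hC0, hC⟩ := hg.exists_bound
  refine ⟨finrank ℝ E * Real.pi * C * (lebesgue (EuclideanSpace ℝ (Fin k))).real (ball 0 1),
    by positivity, fun h hh ξ hξ => ?_⟩
  have hf := finrank_orthogonal_span hd hξ
  have hn : 0 < ‖ξ‖ := by positivity
  have h1 := abs_gaussianRadon_le (ℝ ∙ ξ)ᗮ.subtypeₗᵢ (v := ‖ξ‖⁻¹ • ξ) (by simp [norm_smul, hξ])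
    (inner_subtype_radial ξ) (by omega) hg hC0 hC hn hh
  rw [smul_smul, mul_inv_cancel₀ hn.ne', one_smul] at h1
  -- All hyperplanes `ξ^⊥` have unit balls of the same volume as the model space, so the constant is
  -- independent of `ξ`.
  rwa [lebesgue_ball_eq (U := (ℝ ∙ ξ)ᗮ) (W := EuclideanSpace ℝ (Fin k)) (by simpa using hf),
    div_eq_mul_inv] at h1

theorem measurable_gaussianRadon {g : E → ℝ} (hg : IsEvenAngular g) (h : ℝ) :
    Measurable (gaussianRadon g h) := by
  unfold gaussianRadon
  refine Measurable.const_mul ?_ _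
  have hm := hg.measurable
  have : Measurable fun p : E × E => g p.2 * (√(2 * Real.pi) / (2 * h) *
      Real.exp (-((inner ℝ (‖p.2‖⁻¹ • p.2) p.1) ^ 2 / (2 * h ^ 2)))) := by fun_prop
  exact (this.stronglyMeasurable.integral_prod_right
    (ν := (lebesgue E).restrict (ball 0 1))).measurable

end Limit

variable {n : ℕ}

theorem testFourier_eq (φ : 𝓢(EuclideanSpace ℝ (Fin n), ℂ)) (x : EuclideanSpace ℝ (Fin n)) :
    testFourier φ x = 𝓕 φ ((2 * Real.pi)⁻¹ • x) := by
  rw [testFourier, SchwartzMap.fourier_coe, Real.fourier_eq']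
  congr with y
  rw [smul_eq_mul, mul_comm, inner_smul_right, real_inner_comm]
  congr 2
  push_cast
  have : (Real.pi : ℂ) ≠ 0 := by exact_mod_cast Real.pi_ne_zero
  field_simp

theorem exists_norm_testFourier_le (φ : 𝓢(EuclideanSpace ℝ (Fin n), ℂ)) :
    ∃ C, 0 ≤ C ∧ ∀ x, ‖testFourier φ x‖ ≤ C * (1 + ‖x‖ ^ 2)⁻¹ := by
  obtain ⟨A, hA0, hA⟩ := (𝓕 φ).decay 0 0
  obtain ⟨B, hB0, hB⟩ := (𝓕 φ).decay 2 0
  -- Quadratic decay is enough: after the Jacobian cancels `‖x‖ ^ (-k)`, only `∫ dr / (1 + r²)`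
  -- remains.
  refine ⟨A + (2 * Real.pi) ^ 2 * B, by positivity, fun x => ?_⟩
  have h1 := hA ((2 * Real.pi)⁻¹ • x)
  have h2 := hB ((2 * Real.pi)⁻¹ • x)
  rw [norm_iteratedFDeriv_zero, norm_smul, Real.norm_of_nonneg (by positivity)] at h2
  rw [norm_iteratedFDeriv_zero, pow_zero, one_mul] at h1
  rw [testFourier_eq, ← div_eq_mul_inv, le_div_iff₀ (by positivity)]
  have h3 : ‖x‖ ^ 2 * ‖𝓕 φ ((2 * Real.pi)⁻¹ • x)‖ ≤ (2 * Real.pi) ^ 2 * B := by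
    rw [mul_pow, inv_pow, mul_assoc, inv_mul_le_iff₀ (by positivity)] at h2
    exact h2
  linarith

theorem continuous_testFourier (φ : 𝓢(EuclideanSpace ℝ (Fin n), ℂ)) :
    Continuous (testFourier φ) := by
  have : testFourier φ = fun x => 𝓕 φ ((2 * Real.pi)⁻¹ • x) := funext (testFourier_eq φ)
  rw [this]
  exact (𝓕 φ).continuous.comp (continuous_const_smul _)

theorem exists_norm_pow_mul_schwartz_le (φ : 𝓢(EuclideanSpace ℝ (Fin n), ℂ)) (k : ℕ) :
    ∃ C, 0 ≤ C ∧ ∀ x, ‖x‖ ^ k * ‖φ x‖ ≤ C * (1 + ‖x‖ ^ 2)⁻¹ := by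
  obtain ⟨A, hA0, hA⟩ := φ.decay k 0
  obtain ⟨B, hB0, hB⟩ := φ.decay (k + 2) 0
  refine ⟨A + B, by positivity, fun x => ?_⟩
  have h1 := hA x
  have h2 := hB x
  rw [norm_iteratedFDeriv_zero] at h1 h2
  rw [← div_eq_mul_inv, le_div_iff₀ (by positivity)]
  rw [pow_add] at h2
  nlinarith

variable {k : ℕ}

theorem integrable_inv_norm_mul_schwartz (hk : 1 ≤ k)
    (φ : 𝓢(EuclideanSpace ℝ (Fin (k + 1)), ℂ)) : Integrable (fun x => ‖x‖⁻¹ * ‖φ x‖) := by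
  obtain ⟨C, hC0, hC⟩ := exists_norm_pow_mul_schwartz_le φ (k - 1)
  have h1 := (integrable_inv_norm_pow_mul (volume : Measure (EuclideanSpace ℝ (Fin (k + 1))))
    (k := k) (by simp) integrable_inv_one_add_sq.integrableOn).const_mul C
  refine h1.mono' ?_ (.of_forall fun x => ?_)
  · have := φ.continuous.measurable
    apply Measurable.aestronglyMeasurable
    fun_prop
  · rw [Real.norm_of_nonneg (by positivity)]
    rcases eq_or_ne x 0 with rfl | hx
    · simp only [norm_zero, inv_zero, zero_mul]; positivity
    have hn : 0 < ‖x‖ := by positivity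
    calc ‖x‖⁻¹ * ‖φ x‖ = (‖x‖ ^ k)⁻¹ * (‖x‖ ^ (k - 1) * ‖φ x‖) := by
          obtain ⟨j, rfl⟩ : ∃ j, k = j + 1 := ⟨k - 1, by omega⟩
          rw [Nat.add_sub_cancel, pow_succ]
          field_simp
      _ ≤ (‖x‖ ^ k)⁻¹ * (C * (1 + ‖x‖ ^ 2)⁻¹) := 
          mul_le_mul_of_nonneg_left (hC x) (by positivity)
      _ = _ := by ring

theorem integrable_angular_mul_testFourier {g : EuclideanSpace ℝ (Fin (k + 1)) → ℝ}
    (hg : IsEvenAngular g) (φ : 𝓢(EuclideanSpace ℝ (Fin (k + 1)), ℂ)) :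
    Integrable (fun x => ((g x * (‖x‖ ^ k)⁻¹ : ℝ) : ℂ) * testFourier φ x) := by
  obtain ⟨C, hC0, hC⟩ := exists_norm_testFourier_le φ
  obtain ⟨A, hA0, hA⟩ := hg.exists_bound
  have h1 := (integrable_inv_norm_pow_mul (volume : Measure (EuclideanSpace ℝ (Fin (k + 1))))
    (k := k) (by simp) integrable_inv_one_add_sq.integrableOn).const_mul (A * C)
  refine h1.mono' ?_ (.of_forall fun x => ?_)
  · have := (continuous_testFourier φ).measurable
    have := hg.measurable
    apply Measurable.aestronglyMeasurable
    fun_prop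
  · rw [norm_mul, Complex.norm_real, norm_mul, norm_inv, norm_pow, norm_norm]
    calc _ ≤ A * (‖x‖ ^ k)⁻¹ * (C * (1 + ‖x‖ ^ 2)⁻¹) := by
          gcongr
          · exact hA x
          · exact hC x
      _ = _ := by ring

/-- The multiplication formula, by Fubini. The Gaussian factor supplies the joint integrability
which the bare kernel `‖x‖ ^ (-k)` lacks. -/
theorem integral_gaussian_angular_mul_testFourier {g : EuclideanSpace ℝ (Fin (k + 1)) → ℝ}
    (hg : IsEvenAngular g) {h : ℝ} (hh : 0 < h) (φ : 𝓢(EuclideanSpace ℝ (Fin (k + 1)), ℂ)) :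
    ∫ x, ((g x * (‖x‖ ^ k)⁻¹ * Real.exp (-(h ^ 2 / 2) * ‖x‖ ^ 2) : ℝ) : ℂ) * testFourier φ x =
      ∫ y, (gaussianRadon g h y : ℂ) * φ y := by
  have hd : finrank ℝ (EuclideanSpace ℝ (Fin (k + 1))) = k + 1 := by simp
  have hG := (integrable_gaussian_angular hg hd hh).ofReal (𝕜 := ℂ)
  simp_rw [← integral_gaussian_angular_cexp hg hd hh, testFourier, ← integral_const_mul,
    ← integral_mul_const]
  rw [integral_integral_swap]
  · refine integral_congr_ae (.of_forall fun y => ?_)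
    refine integral_congr_ae (.of_forall fun x => ?_)
    simp only []
    ring
  · have h1 := (hG.mul_prod (ν := volume) φ.integrable).mul_bdd (c := 1)
      (g := fun p : EuclideanSpace ℝ (Fin (k + 1)) × EuclideanSpace ℝ (Fin (k + 1)) =>
        Complex.exp (-(Complex.I * ((inner ℝ p.1 p.2 : ℝ) : ℂ)))) ?_ ?_
    · refine h1.congr (.of_forall fun p => ?_)
      simp only [Function.uncurry]
      rw [mul_assoc]
      rfl
    · apply Continuous.aestronglyMeasurable
      fun_prop
    · refine .of_forall fun p => le_of_eq ?_
      rw [show -(Complex.I * ((inner ℝ p.1 p.2 : ℝ) : ℂ)) =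
        ((-inner ℝ p.1 p.2 : ℝ) : ℂ) * Complex.I by push_cast; ring]
      exact Complex.norm_exp_ofReal_mul_I _

/-- The Fourier transform of an even homogeneous function of degree `-k` on `ℝ^(k+1)` is given by
the spherical Radon transform. -/
theorem isDistributionalFourierTransform_angular (hk : 1 ≤ k)
    {g : EuclideanSpace ℝ (Fin (k + 1)) → ℝ} (hg : IsEvenAngular g) :
    IsDistributionalFourierTransform (fun x => g x * (‖x‖ ^ k)⁻¹)
      (fun x => Real.pi * ‖x‖⁻¹ * sphericalRadon g x) := by
  intro φ
  have hd : finrank ℝ (EuclideanSpace ℝ (Fin (k + 1))) = k + 1 := by simp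
  obtain ⟨C, hC0, hC⟩ := exists_abs_gaussianRadon_le hd hg
  have h0 : ∀ᵐ x : EuclideanSpace ℝ (Fin (k + 1)), x ≠ 0 := by simp [ae_iff]
  have hlim : ∀ᵐ x : EuclideanSpace ℝ (Fin (k + 1)),
      Tendsto (fun h => gaussianRadon g h x) (𝓝[>] 0)
        (𝓝 (Real.pi * ‖x‖⁻¹ * sphericalRadon g x)) :=
    h0.mono fun x hx => tendsto_gaussianRadon_sphericalRadon hk hd hg hx
  have hmeas : AEStronglyMeasurable (fun x => Real.pi * ‖x‖⁻¹ * sphericalRadon g x)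
      (volume : Measure (EuclideanSpace ℝ (Fin (k + 1)))) :=
    aestronglyMeasurable_of_tendsto_ae (𝓝[>] 0)
      (fun h => (measurable_gaussianRadon hg h).aestronglyMeasurable) hlim
  have hbound := (integrable_inv_norm_mul_schwartz hk φ).const_mul C
  have hφ := φ.continuous.aestronglyMeasurable (μ := volume)
  have hI := integrable_angular_mul_testFourier hg φ
  refine ⟨hI, ?_, ?_⟩
  · refine hbound.mono' ((Complex.continuous_ofReal.comp_aestronglyMeasurable hmeas).mul hφ) ?_
    filter_upwards [h0, hlim] with x hx hl
    rw [norm_mul, Complex.norm_real, ← mul_assoc]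
    gcongr
    refine le_of_tendsto hl.norm (eventually_nhdsWithin_of_forall fun h (hh : 0 < h) => ?_)
    exact hC h hh x hx
  -- Both sides of the regularized identity pass to the limit `h → 0`: this side is dominated by `C
  -- ‖x‖⁻¹ ‖φ x‖`, the other by the kernel without the Gaussian.
  · have hL : Tendsto (fun h : ℝ => ∫ x, (gaussianRadon g h x : ℂ) * φ x) (𝓝[>] 0)
        (𝓝 (∫ x, ((Real.pi * ‖x‖⁻¹ * sphericalRadon g x : ℝ) : ℂ) * φ x)) := by
      refine tendsto_integral_filter_of_dominated_convergence _ (.of_forall fun h => ?_)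
        (eventually_nhdsWithin_of_forall fun h (hh : 0 < h) => ?_) hbound ?_
      · exact (Complex.measurable_ofReal.comp
          (measurable_gaussianRadon hg h)).aestronglyMeasurable.mul hφ
      · filter_upwards [h0] with x hx
        rw [norm_mul, Complex.norm_real, ← mul_assoc]
        gcongr
        exact hC h hh x hx
      · filter_upwards [hlim] with x hl
        exact ((Complex.continuous_ofReal.tendsto _).comp hl).mul_const _
    have hR : Tendsto (fun h : ℝ => ∫ x, ((g x * (‖x‖ ^ k)⁻¹ *
        Real.exp (-(h ^ 2 / 2) * ‖x‖ ^ 2) : ℝ) : ℂ) * testFourier φ x) (𝓝[>] 0)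
        (𝓝 (∫ x, ((g x * (‖x‖ ^ k)⁻¹ : ℝ) : ℂ) * testFourier φ x)) := by
      have hg' := hg.measurable
      have hF := (continuous_testFourier φ).measurable
      refine tendsto_integral_filter_of_dominated_convergence _ (.of_forall fun h => ?_)
        (.of_forall fun h => .of_forall fun x => ?_) hI.norm (.of_forall fun x => ?_)
      · apply Measurable.aestronglyMeasurable
        fun_prop
      · rw [norm_mul, norm_mul, Complex.ofReal_mul, norm_mul]
        gcongr
        refine mul_le_of_le_one_right (norm_nonneg _) ?_
        rw [Complex.norm_real, Real.norm_of_nonneg (Real.exp_nonneg _)]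
        apply Real.exp_le_one_iff.2
        rw [neg_mul, neg_nonpos]
        positivity
      · refine Tendsto.mono_left ?_ nhdsWithin_le_nhds
        have : Continuous fun h : ℝ => ((g x * (‖x‖ ^ k)⁻¹ *
          Real.exp (-(h ^ 2 / 2) * ‖x‖ ^ 2) : ℝ) : ℂ) * testFourier φ x := by fun_prop
        simpa using this.tendsto 0
    refine tendsto_nhds_unique hL (hR.congr' ?_)
    exact eventually_nhdsWithin_of_forall fun h (hh : 0 < h) =>
      integral_gaussian_angular_mul_testFourier hg hh φ

end Fourier

/-! ### Nonnegativity of the Fourier preimage of an intersection body. -/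

section Positivity

open Set Metric Module Filter
open scoped Topology FourierTransform

section General

variable {E : Type*} [NormedAddCommGroup E] [InnerProductSpace ℝ E] [FiniteDimensional ℝ E]
  [MeasurableSpace E] [BorelSpace E]

theorem sphericalRadon_smul (g : E → ℝ) {c : ℝ} (hc : c ≠ 0) (ξ : E) :
    sphericalRadon g (c • ξ) = sphericalRadon g ξ := by
  have : (ℝ ∙ (c • ξ)) = (ℝ ∙ ξ) := Submodule.span_singleton_smul_eq (IsUnit.mk0 c hc) ξ
  -- The types involved depend on the span of `ξ`, so the equality of spans is applied to a function
  -- of the subspace.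
  let F : Submodule ℝ E → ℝ := fun S =>
    finrank ℝ Sᗮ * ∫ y in ball (0 : Sᗮ) 1, g (y : E) ∂lebesgue Sᗮ
  change F _ = F _
  rw [this]

theorem IsMinkowskiFunctional.isEvenAngular {N : E → ℝ} (h : IsMinkowskiFunctional N) (k : ℕ) :
    IsEvenAngular fun x => (‖x‖ * (N x)⁻¹) ^ k where
  continuousOn := by
    exact (continuous_norm.continuousOn.mul
      (h.continuous.continuousOn.inv₀ fun x hx => (h.pos x hx).ne')).pow k
  smul c x hc := by
    simp only [norm_smul, h.smul, Real.norm_eq_abs]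
    have : |c| ≠ 0 := abs_ne_zero.2 hc
    congr 1
    field_simp

/-- Polar coordinates in `ξ^⊥`, of dimension `k`: `k` times the volume is the integral of the `k`-th
power of the radial function. The factor `‖x‖` makes that radial function homogeneous of degree
zero. -/
theorem centralSectionVolume_eq_sphericalRadon {k : ℕ} (hk : 1 ≤ k) (hd : finrank ℝ E = k + 1)
    {N : E → ℝ} (h : IsMinkowskiFunctional N) {ξ : E} (hξ : ξ ≠ 0) :
    k * centralSectionVolume {x | N x ≤ 1} ξ =
      sphericalRadon (fun x => (‖x‖ * (N x)⁻¹) ^ k) ξ := by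
  have hf := finrank_orthogonal_span hd hξ
  have : Nontrivial (ℝ ∙ ξ)ᗮ := nontrivial_of_finrank_pos (R := ℝ) (by omega)
  have hi := h.comp_linearIsometry (ℝ ∙ ξ)ᗮ.subtypeₗᵢ
  have h1 := hi.measureReal_eq (lebesgue (ℝ ∙ ξ)ᗮ)
  rw [sphericalRadon, hf, centralSectionVolume]
  congr 1
  refine h1.trans (integral_congr_ae (.of_forall fun y => ?_))
  have h2 := hi.smul ‖y‖⁻¹ y
  simp only [abs_inv, abs_norm] at h2
  beta_reduce
  rw [h2, hf, mul_inv, inv_inv]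
  rfl

end General

/-- The test function is the inverse transform of a smooth bump. Its centre and radii carry the
factor `(2π)⁻¹` because `testFourier` has no `2π` in the exponent. -/
theorem exists_testFourier_bump {n : ℕ} (x₀ : EuclideanSpace ℝ (Fin n)) {r : ℝ} (hr : 0 < r) :
    ∃ (φ : 𝓢(EuclideanSpace ℝ (Fin n), ℂ)) (b : EuclideanSpace ℝ (Fin n) → ℝ),
      (∀ x, testFourier φ x = b x) ∧ (∀ x, 0 ≤ b x) ∧ (∀ x, b x ≠ 0 ↔ x ∈ ball x₀ r) := by
  have hp : 0 < 2 * Real.pi := by positivity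
  let f : ContDiffBump ((2 * Real.pi)⁻¹ • x₀) :=
    ⟨(2 * Real.pi)⁻¹ * (r / 2), (2 * Real.pi)⁻¹ * r, by positivity, by gcongr; linarith⟩
  have hs : HasCompactSupport fun x => (f x : ℂ) :=
    f.hasCompactSupport.comp_left (g := ((↑) : ℝ → ℂ)) Complex.ofReal_zero
  have hc : ContDiff ℝ (⊤ : ℕ∞) fun x => (f x : ℂ) := Complex.ofRealCLM.contDiff.comp f.contDiff
  let ψ : 𝓢(EuclideanSpace ℝ (Fin n), ℂ) := hs.toSchwartzMap hc
  refine ⟨𝓕⁻ ψ, fun x => f ((2 * Real.pi)⁻¹ • x), fun x => ?_, fun x => f.nonneg, fun x => ?_⟩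
  · rw [testFourier_eq, FourierTransform.fourier_fourierInv_eq]
    rfl
  · change _ ∈ Function.support f ↔ _
    rw [f.support_eq, mem_ball, mem_ball, dist_smul₀, Real.norm_of_nonneg (by positivity)]
    exact mul_lt_mul_iff_right₀ (by positivity)

variable {k : ℕ}

/-- A star body whose radial function is the Radon transform of a function that is somewhere
negative is not an intersection body. -/
theorem not_isIntersectionBody_of_neg (hk : 1 ≤ k) {g : EuclideanSpace ℝ (Fin (k + 1)) → ℝ}
    (hg : IsEvenAngular g) {K : Set (EuclideanSpace ℝ (Fin (k + 1)))}
    (hK : ∀ ξ, ‖ξ‖ = 1 → radialFunction K ξ = Real.pi * sphericalRadon g ξ)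
    {x₀ : EuclideanSpace ℝ (Fin (k + 1))} (hx₀ : x₀ ≠ 0) (hneg : g x₀ < 0) :
    ¬ IsIntersectionBody K := by
  intro hI
  have hd : finrank ℝ (EuclideanSpace ℝ (Fin (k + 1))) = k + 1 := by simp
  have hkpos : (0 : ℝ) < k := by exact_mod_cast hk
  have hev : ∀ᶠ x in 𝓝 x₀, g x < 0 :=
    (hg.continuousOn.continuousAt (isOpen_compl_singleton.mem_nhds hx₀)).eventually_lt_const hneg
  obtain ⟨r, hr, hball⟩ := Metric.eventually_nhds_iff_ball.1
    (hev.and (isOpen_compl_singleton.mem_nhds hx₀))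
  obtain ⟨φ, b, hφ, hb0, hbs⟩ := exists_testFourier_bump x₀ hr
  obtain ⟨hi1, hi2, heq⟩ := isDistributionalFourierTransform_angular hk hg φ
  have hre : ∀ f : EuclideanSpace ℝ (Fin (k + 1)) → ℝ,
      ∫ x, (f x : ℂ) * testFourier φ x = ((∫ x, f x * b x : ℝ) : ℂ) := by
    intro f
    rw [← integral_complex_ofReal]
    congr with x
    rw [hφ]; push_cast; rfl
  have hcneg : ∫ x, g x * (‖x‖ ^ k)⁻¹ * b x < 0 := by
    have h_int : Integrable fun x => g x * (‖x‖ ^ k)⁻¹ * b x := by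
      have := hi1.re
      refine this.congr (.of_forall fun x => ?_)
      simp only [hφ, ← Complex.ofReal_mul, RCLike.re_eq_complex_re, Complex.ofReal_re]
    have h1 : 0 < ∫ x, -(g x * (‖x‖ ^ k)⁻¹ * b x) := by
      have hnn : ∀ x, 0 ≤ -(g x * (‖x‖ ^ k)⁻¹ * b x) := by
        intro x
        by_cases hx : x ∈ ball x₀ r
        · have h2 := (hball x hx).1
          have h3 : 0 ≤ -g x * ((‖x‖ ^ k)⁻¹ * b x) :=
            mul_nonneg (by linarith) (mul_nonneg (by positivity) (hb0 x))
          linarith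
        · have : b x = 0 := by
            by_contra h; exact hx ((hbs x).1 h)
          simp [this]
      rw [integral_pos_iff_support_of_nonneg hnn h_int.neg]
      refine (measure_ball_pos volume x₀ hr).trans_le (measure_mono fun x hx => ?_)
      obtain ⟨h2, h3⟩ := hball x hx
      have h4 : ‖x‖ ≠ 0 := norm_ne_zero_iff.2 h3
      have h5 := (hbs x).2 hx
      simp only [Function.mem_support, ne_eq, neg_eq_zero, mul_eq_zero, h2.ne, inv_eq_zero,
        h5, or_false, false_or]
      exact pow_ne_zero k h4
    rw [integral_neg] at h1
    linarith
  set c := ∫ x, g x * (‖x‖ ^ k)⁻¹ * b x with hc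
  set D := ∫ x, ‖x‖⁻¹ * ‖φ x‖ with hD
  have hD0 : 0 ≤ D := integral_nonneg fun x => by positivity
  -- Pairing `‖x‖⁻¹` times the difference of radial functions with `φ` costs at most `D` times their
  -- distance. With this tolerance the cost stays strictly below `-c`, and `D + 1` avoids a division
  -- by zero.
  obtain ⟨M, L, hML, hclose⟩ := hI.mem_closure (-c / (D + 1)) (by apply div_pos <;> linarith)
  have hN := hML.starBody_right.isMinkowskiFunctional_gauge hML.symmetric_right
  have hgL := hN.isEvenAngular k
  set gL : EuclideanSpace ℝ (Fin (k + 1)) → ℝ := fun x => (‖x‖ * (gauge L x)⁻¹) ^ k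
  obtain ⟨hj1, hj2, heqL⟩ := isDistributionalFourierTransform_angular hk hgL φ
  rw [hre] at heq heqL
  have hcL : 0 ≤ ∫ x, gL x * (‖x‖ ^ k)⁻¹ * b x := by
    refine integral_nonneg fun x => mul_nonneg (mul_nonneg ?_ (by positivity)) (hb0 x)
    exact pow_nonneg (mul_nonneg (norm_nonneg _) (inv_nonneg.2 (gauge_nonneg _))) _
  set cL := ∫ x, gL x * (‖x‖ ^ k)⁻¹ * b x
  have hM : ∀ ξ, ‖ξ‖ = 1 → radialFunction M ξ = (k : ℝ)⁻¹ * sphericalRadon gL ξ := by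
    intro ξ hξ
    have hξ0 : ξ ≠ 0 := by rintro rfl; simp at hξ
    rw [hML.radial_eq ξ hξ, ← centralSectionVolume_eq_sphericalRadon hk hd hN hξ0,
      ← hML.starBody_right.eq_gauge_le_one hML.symmetric_right]
    field_simp
  -- The pairing of the difference with `φ` equals `c - (π k)⁻¹ cL`, by the Fourier identity for `g`
  -- and for `gL`. Since `cL ≥ 0` its absolute value is at least `-c`, a contradiction.
  have hdiff : ‖((c - (Real.pi * k)⁻¹ * cL : ℝ) : ℂ)‖ ≤ -c / (D + 1) * D := by
    have h1 : ((c - (Real.pi * k)⁻¹ * cL : ℝ) : ℂ) =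
        ∫ x, (((Real.pi * ‖x‖⁻¹ * sphericalRadon g x : ℝ) : ℂ) * φ x -
          (((Real.pi * k)⁻¹ : ℝ) : ℂ) *
            (((Real.pi * ‖x‖⁻¹ * sphericalRadon gL x : ℝ) : ℂ) * φ x)) := by
      rw [integral_sub hi2 (hj2.const_mul _), integral_const_mul, heq, heqL]
      push_cast
      rfl
    rw [h1, hD, ← integral_const_mul]
    refine norm_integral_le_of_norm_le ((integrable_inv_norm_mul_schwartz hk φ).const_mul _) ?_
    have h0 : ∀ᵐ x : EuclideanSpace ℝ (Fin (k + 1)), x ≠ 0 := by simp [ae_iff]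
    filter_upwards [h0] with x hx
    have hnx : ‖x‖ ≠ 0 := by simpa using hx
    have hu : ‖‖x‖⁻¹ • x‖ = 1 := by simp [norm_smul, hx]
    have h2 := hclose _ hu
    rw [hK _ hu, hM _ hu, sphericalRadon_smul _ (inv_ne_zero hnx),
      sphericalRadon_smul _ (inv_ne_zero hnx)] at h2
    have h3 : ((Real.pi * ‖x‖⁻¹ * sphericalRadon g x : ℝ) : ℂ) * φ x -
          (((Real.pi * k)⁻¹ : ℝ) : ℂ) *
            (((Real.pi * ‖x‖⁻¹ * sphericalRadon gL x : ℝ) : ℂ) * φ x) =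
        ((‖x‖⁻¹ * (Real.pi * sphericalRadon g x - (k : ℝ)⁻¹ * sphericalRadon gL x) : ℝ) : ℂ) *
          φ x := by
      push_cast
      have : (Real.pi : ℂ) ≠ 0 := by exact_mod_cast Real.pi_ne_zero
      have : (k : ℂ) ≠ 0 := by exact_mod_cast hkpos.ne'
      field_simp
    rw [h3, norm_mul, Complex.norm_real, norm_mul, norm_inv, norm_norm, Real.norm_eq_abs]
    calc _ ≤ ‖x‖⁻¹ * (-c / (D + 1)) * ‖φ x‖ := by gcongr
      _ = _ := by ring
  rw [Complex.norm_real, Real.norm_eq_abs] at hdiff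
  have h4 : 0 ≤ (Real.pi * k)⁻¹ * cL := mul_nonneg (by positivity) hcL
  have h5 : -c ≤ |c - (Real.pi * k)⁻¹ * cL| := by
    rw [abs_of_nonpos (by linarith)]; linarith
  have h6 : -c / (D + 1) * D < -c := by
    rw [div_mul_eq_mul_div, div_lt_iff₀ (by linarith)]
    nlinarith
  linarith

end Positivity

/-! ### The bump as a smooth function of the squared cosine. -/

section Profile

open Set Metric Module Filter Polynomial
open scoped Topology

/-- The smooth functions `y ↦ p (1 / y) exp (-1 / y)`, extended by zero to `y ≤ 0`. -/
def glue (p : ℝ[X]) (y : ℝ) : ℝ := p.eval y⁻¹ * expNegInvGlue y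

theorem continuous_glue (p : ℝ[X]) : Continuous (glue p) :=
  expNegInvGlue.continuous_polynomial_eval_inv_mul p

theorem measurable_glue (p : ℝ[X]) : Measurable (glue p) := (continuous_glue p).measurable

theorem hasDerivAt_glue (p : ℝ[X]) (y : ℝ) :
    HasDerivAt (glue p) (glue (X ^ 2 * (p - derivative p)) y) y :=
  expNegInvGlue.hasDerivAt_polynomial_eval_inv_mul p y

theorem glue_of_nonpos (p : ℝ[X]) {y : ℝ} (hy : y ≤ 0) : glue p y = 0 := by
  simp [glue, expNegInvGlue.zero_of_nonpos hy]

theorem exists_abs_glue_le (p : ℝ[X]) : ∃ A, 0 ≤ A ∧ ∀ y ≤ 1, |glue p y| ≤ A := by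
  obtain ⟨A, hA⟩ := (isCompact_Icc (a := (0 : ℝ)) (b := 1)).exists_bound_of_continuousOn
    (continuous_glue p).continuousOn
  have hA0 : 0 ≤ A := (norm_nonneg _).trans (hA 0 (by simp))
  refine ⟨A, hA0, fun y hy => ?_⟩
  rcases le_total y 0 with h | h
  · simpa [glue_of_nonpos p h] using hA0
  · exact hA y ⟨h, hy⟩

/-- The value at `√v = |cos α|` of the normalized bump of height two and width `δ`. -/
def bumpProfile (δ v : ℝ) : ℝ := 2 * Real.exp 1 * glue 1 (1 - (1 - √v) / δ)

/-- The derivative of `bumpProfile δ`. -/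
def bumpProfileDeriv (δ v : ℝ) : ℝ :=
  2 * Real.exp 1 * (glue (X ^ 2 * (1 - derivative 1)) (1 - (1 - √v) / δ) * (2 * δ * √v)⁻¹)

/-- The second derivative of `bumpProfile δ`. -/
def bumpProfileDeriv₂ (δ v : ℝ) : ℝ :=
  2 * Real.exp 1 *
    (glue (X ^ 2 * (X ^ 2 * (1 - derivative 1) - derivative (X ^ 2 * (1 - derivative 1))))
      (1 - (1 - √v) / δ) * (2 * δ * √v)⁻¹ * (2 * δ * √v)⁻¹ +
    glue (X ^ 2 * (1 - derivative 1)) (1 - (1 - √v) / δ) *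
      (-(2 * δ * (1 / (2 * √v))) / (2 * δ * √v) ^ 2))

variable {δ : ℝ}

theorem bumpProfile_arg_nonpos (hδ : 0 < δ) {v : ℝ} (hv : √v ≤ 1 - δ) :
    1 - (1 - √v) / δ ≤ 0 := by
  rw [sub_nonpos, le_div_iff₀ hδ]; linarith

theorem bumpProfile_arg_le_one (hδ : 0 < δ) {v : ℝ} (hv : v ≤ 1) : 1 - (1 - √v) / δ ≤ 1 := by
  have : √v ≤ 1 := by simpa using Real.sqrt_le_sqrt hv
  have : 0 ≤ (1 - √v) / δ := div_nonneg (by linarith) hδ.le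
  linarith

theorem bumpProfile_eq_zero (hδ : 0 < δ) {v : ℝ} (hv : √v ≤ 1 - δ) : bumpProfile δ v = 0 := by
  simp [bumpProfile, glue_of_nonpos _ (bumpProfile_arg_nonpos hδ hv)]

theorem bumpProfileDeriv_eq_zero (hδ : 0 < δ) {v : ℝ} (hv : √v ≤ 1 - δ) :
    bumpProfileDeriv δ v = 0 := by
  simp [bumpProfileDeriv, glue_of_nonpos _ (bumpProfile_arg_nonpos hδ hv)]

theorem bumpProfileDeriv₂_eq_zero (hδ : 0 < δ) {v : ℝ} (hv : √v ≤ 1 - δ) :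
    bumpProfileDeriv₂ δ v = 0 := by
  simp [bumpProfileDeriv₂, glue_of_nonpos _ (bumpProfile_arg_nonpos hδ hv)]

theorem bumpProfile_nonneg (δ v : ℝ) : 0 ≤ bumpProfile δ v := by
  have := expNegInvGlue.nonneg (1 - (1 - √v) / δ)
  simp only [bumpProfile, glue, eval_one, one_mul]
  positivity

theorem bumpProfile_le_two (hδ : 0 < δ) {v : ℝ} (hv : v ≤ 1) : bumpProfile δ v ≤ 2 := by
  have h1 := expNegInvGlue.monotone (bumpProfile_arg_le_one hδ hv)
  have h2 : expNegInvGlue 1 = Real.exp (-1) := by simp [expNegInvGlue]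
  rw [h2] at h1
  simp only [bumpProfile, glue, eval_one, one_mul]
  calc _ ≤ 2 * Real.exp 1 * Real.exp (-1) := by gcongr
    _ = 2 := by rw [mul_assoc, ← Real.exp_add]; simp

theorem continuous_bumpProfile (δ : ℝ) : Continuous (bumpProfile δ) := by
  have := continuous_glue 1
  unfold bumpProfile
  fun_prop

theorem measurable_bumpProfileDeriv (δ : ℝ) : Measurable (bumpProfileDeriv δ) := by
  have := measurable_glue (X ^ 2 * (1 - derivative 1))
  unfold bumpProfileDeriv
  fun_prop

theorem measurable_bumpProfileDeriv₂ (δ : ℝ) : Measurable (bumpProfileDeriv₂ δ) := by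
  have := measurable_glue (X ^ 2 * (1 - derivative 1))
  have := measurable_glue
    (X ^ 2 * (X ^ 2 * (1 - derivative 1) - derivative (X ^ 2 * (1 - derivative 1))))
  unfold bumpProfileDeriv₂
  fun_prop

theorem eventually_sqrt_le (hδ2 : δ ≤ 1 / 2) {v : ℝ} (hv : v ≤ 0) : ∀ᶠ u in 𝓝 v, √u ≤ 1 - δ := by
  have : Tendsto (fun u => √u) (𝓝 v) (𝓝 (√v)) := Real.continuous_sqrt.tendsto v
  rw [Real.sqrt_eq_zero_of_nonpos hv] at this
  filter_upwards [this.eventually (gt_mem_nhds (show (0 : ℝ) < 1 / 2 by norm_num))] with u hu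
  linarith

theorem hasDerivAt_bumpProfile_arg {v : ℝ} (hv : 0 < v) :
    HasDerivAt (fun v => 1 - (1 - √v) / δ) ((2 * δ * √v)⁻¹) v := by
  have h1 := (((Real.hasDerivAt_sqrt hv.ne').const_sub 1).div_const δ).const_sub 1
  refine h1.congr_deriv ?_
  have : √v ≠ 0 := by positivity
  rcases eq_or_ne δ 0 with rfl | hδ
  · simp
  field_simp

/-- The square root is not differentiable at zero, but for `δ ≤ 1/2` the profile vanishes near every
`v ≤ 0`, so it is differentiable on the whole line. -/
theorem hasDerivAt_bumpProfile (hδ : 0 < δ) (hδ2 : δ ≤ 1 / 2) (v : ℝ) :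
    HasDerivAt (bumpProfile δ) (bumpProfileDeriv δ v) v := by
  rcases le_or_gt v 0 with hv | hv
  · have he := eventually_sqrt_le hδ2 hv
    rw [bumpProfileDeriv_eq_zero hδ he.self_of_nhds]
    refine (hasDerivAt_const v (0 : ℝ)).congr_of_eventuallyEq ?_
    filter_upwards [he] with u hu using bumpProfile_eq_zero hδ hu
  · exact ((hasDerivAt_glue 1 _).comp v (hasDerivAt_bumpProfile_arg hv)).const_mul _

theorem hasDerivAt_bumpProfileDeriv (hδ : 0 < δ) (hδ2 : δ ≤ 1 / 2) (v : ℝ) :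
    HasDerivAt (bumpProfileDeriv δ) (bumpProfileDeriv₂ δ v) v := by
  rcases le_or_gt v 0 with hv | hv
  · have he := eventually_sqrt_le hδ2 hv
    rw [bumpProfileDeriv₂_eq_zero hδ he.self_of_nhds]
    refine (hasDerivAt_const v (0 : ℝ)).congr_of_eventuallyEq ?_
    filter_upwards [he] with u hu using bumpProfileDeriv_eq_zero hδ hu
  · have hs : 2 * δ * √v ≠ 0 := by positivity
    have h1 := ((Real.hasDerivAt_sqrt hv.ne').const_mul (2 * δ)).inv hs
    exact (((hasDerivAt_glue _ _).comp v (hasDerivAt_bumpProfile_arg hv)).mul h1).const_mul _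

/-- The argument of `glue` has slope `1 / (2 δ √v)`, and `√v ≥ 1/2` wherever the profile is not
zero; each derivative therefore costs one factor `1 / δ`. -/
theorem exists_bumpProfile_bound : ∃ A, 0 ≤ A ∧ ∀ δ, 0 < δ → δ ≤ 1 / 2 → ∀ v ≤ 1,
    |bumpProfileDeriv δ v| ≤ A / δ ∧ |bumpProfileDeriv₂ δ v| ≤ A / δ ^ 2 := by
  obtain ⟨A₁, h10, h1⟩ := exists_abs_glue_le (X ^ 2 * (1 - derivative 1))
  obtain ⟨A₂, h20, h2⟩ := exists_abs_glue_le
    (X ^ 2 * (X ^ 2 * (1 - derivative 1) - derivative (X ^ 2 * (1 - derivative 1))))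
  refine ⟨2 * Real.exp 1 * (A₂ + 2 * A₁), by positivity, fun δ hδ hδ2 v hv => ?_⟩
  rcases le_or_gt (√v) (1 - δ) with hs | hs
  · rw [bumpProfileDeriv_eq_zero hδ hs, bumpProfileDeriv₂_eq_zero hδ hs, abs_zero]
    constructor <;> positivity
  · have hs2 : 1 / 2 ≤ √v := by linarith
    have hy := bumpProfile_arg_le_one hδ hv
    have hinv : (2 * δ * √v)⁻¹ ≤ δ⁻¹ := by
      apply inv_anti₀ hδ; nlinarith
    have hinv0 : 0 < (2 * δ * √v)⁻¹ := by positivity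
    have hq : |-(2 * δ * (1 / (2 * √v))) / (2 * δ * √v) ^ 2| ≤ 2 / δ ^ 2 := by
      rw [neg_div, abs_neg, abs_of_nonneg (by positivity)]
      have e : 2 * δ * (1 / (2 * √v)) / (2 * δ * √v) ^ 2 = 1 / (4 * δ * √v ^ 3) := by
        field_simp; norm_num
      have h3 : (1 / 2 : ℝ) ^ 3 ≤ √v ^ 3 := by gcongr
      rw [e, div_le_div_iff₀ (by positivity) (by positivity)]
      nlinarith [mul_pos hδ hδ]
    constructor
    · rw [bumpProfileDeriv, abs_mul, abs_of_pos (by positivity : 0 < 2 * Real.exp 1), mul_div_assoc]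
      gcongr
      rw [abs_mul, abs_of_pos hinv0, div_eq_mul_inv (A₂ + 2 * A₁)]
      exact mul_le_mul (by linarith [h1 _ hy]) hinv hinv0.le (by positivity)
    · rw [bumpProfileDeriv₂, abs_mul, abs_of_pos (by positivity : 0 < 2 * Real.exp 1),
        mul_div_assoc]
      gcongr
      refine (abs_add_le _ _).trans ?_
      rw [abs_mul, abs_mul, abs_mul, abs_of_pos hinv0]
      calc _ ≤ A₂ * δ⁻¹ * δ⁻¹ + A₁ * (2 / δ ^ 2) := by
            gcongr
            · exact h2 _ hy
            · exact h1 _ hy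
        _ = _ := by field_simp

/-- For unit vectors `‖x ∓ x₀‖² = 2 ∓ 2 ⟨x, x₀⟩`, so with `δ = ε²/2` the condition `‖x ∓ x₀‖ < ε`
reads `±⟨x, x₀⟩ > 1 - δ`. The identity `-s / (ε² - s) = 1 - ε² / (ε² - s)` explains the constant `2
e`. Squaring the cosine treats both caps at once. -/
theorem bump_eq_bumpProfile {E : Type*} [NormedAddCommGroup E] [InnerProductSpace ℝ E] {x₀ x : E}
    (hx₀ : ‖x₀‖ = 1) (hx : ‖x‖ = 1) {ε : ℝ} (hε : 0 < ε) (hε1 : ε ≤ 1) :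
    bump x₀ ε x = bumpProfile (ε ^ 2 / 2) (inner ℝ x x₀ ^ 2) := by
  have h1 : ‖x - x₀‖ ^ 2 = 2 - 2 * inner ℝ x x₀ := by rw [norm_sub_sq_real, hx, hx₀]; ring
  have h2 : ‖x + x₀‖ ^ 2 = 2 + 2 * inner ℝ x x₀ := by rw [norm_add_sq_real, hx, hx₀]; ring
  have hlt : ∀ y : E, ‖y‖ < ε ↔ ‖y‖ ^ 2 < ε ^ 2 := fun y =>
    (sq_lt_sq₀ (norm_nonneg y) hε.le).symm
  have hglue : ∀ a : ℝ, 2 * Real.exp 1 * glue 1 (1 - (1 - a) / (ε ^ 2 / 2)) =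
      if 2 - 2 * a < ε ^ 2 then 2 * Real.exp (-((2 - 2 * a) / (ε ^ 2 - (2 - 2 * a)))) else 0 := by
    intro a
    have hw : 1 - (1 - a) / (ε ^ 2 / 2) = (ε ^ 2 - (2 - 2 * a)) / ε ^ 2 := by field_simp
    simp only [glue, eval_one, one_mul, hw, expNegInvGlue]
    split_ifs with h3 h4 h4
    · rw [div_le_iff₀ (by positivity)] at h3; linarith
    · simp
    · rw [mul_assoc, ← Real.exp_add]
      congr 2
      have : ε ^ 2 - (2 - 2 * a) ≠ 0 := by linarith
      rw [inv_div, eq_neg_iff_add_eq_zero, add_assoc, neg_add_eq_sub, ← sub_div]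
      rw [show 2 - 2 * a - ε ^ 2 = -(ε ^ 2 - (2 - 2 * a)) by ring, neg_div, div_self this]
      ring
    · exact absurd (div_nonpos_of_nonpos_of_nonneg (by linarith) (by positivity)) h3
  rw [bumpProfile, Real.sqrt_sq_eq_abs, hglue, bump]
  simp only [hlt, h1, h2]
  have hε2 : ε ^ 2 ≤ 1 := by nlinarith
  rcases le_total 0 (inner ℝ x x₀) with h0 | h0
  · rw [abs_of_nonneg h0, if_neg (show ¬ 2 + 2 * inner ℝ x x₀ < ε ^ 2 by linarith)]
  · rw [abs_of_nonpos h0, if_neg (show ¬ 2 - 2 * inner ℝ x x₀ < ε ^ 2 by linarith)]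
    simp only [mul_neg, sub_neg_eq_add]

end Profile

/-! ### Integrals of the bump over hyperplanes, and their smallness in `C²`. -/

section Cap

open Set Metric Module Filter
open scoped Topology

variable {F : Type*} [NormedAddCommGroup F] [InnerProductSpace ℝ F]

/-- The squared cosine of the angle between `x` and the unit vector `e`. -/
def cosSq (e x : F) : ℝ := inner ℝ (‖x‖⁻¹ • x) e ^ 2

theorem cosSq_nonneg (e x : F) : 0 ≤ cosSq e x := sq_nonneg _

theorem cosSq_le_one {e : F} (he : ‖e‖ = 1) (x : F) : cosSq e x ≤ 1 := by
  have h1 : |inner ℝ (‖x‖⁻¹ • x) e| ≤ 1 := by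
    refine (abs_real_inner_le_norm _ _).trans ?_
    rw [he, mul_one, norm_smul, norm_inv, norm_norm]
    exact inv_mul_le_one
  rw [cosSq, ← sq_abs]
  exact pow_le_one₀ (abs_nonneg _) h1

variable [FiniteDimensional ℝ F] [MeasurableSpace F] [BorelSpace F]

theorem measurable_cosSq (e : F) : Measurable (cosSq e) := by
  unfold cosSq; fun_prop

/-- The intersection of the unit ball with the double cone of directions at angle
less than `arccos (1 - δ)` from `± e`. -/
def capCone (e : F) (δ : ℝ) : Set F := {x | x ∈ ball (0 : F) 1 ∧ (1 - δ) ^ 2 < cosSq e x}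

theorem measurableSet_capCone (e : F) (δ : ℝ) : MeasurableSet (capCone e δ) :=
  measurableSet_ball.inter (measurableSet_lt measurable_const (measurable_cosSq e))

/-- A point of the cone has transverse part of norm below `√(2δ)`, in a space of dimension at least
three, and bounded height; this gives `δ^(3/2)`. -/
theorem capCone_measureReal_le (hd : 4 ≤ finrank ℝ F) {e : F} (he : ‖e‖ = 1) :
    ∃ A, 0 ≤ A ∧ ∀ δ, 0 < δ → δ ≤ 1 / 2 → (lebesgue F).real (capCone e δ) ≤ A * (δ * √δ) := by
  have he0 : e ≠ 0 := by rintro rfl; simp at he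
  obtain ⟨m, hm⟩ : ∃ m, finrank ℝ F = m + 1 := ⟨finrank ℝ F - 1, by omega⟩
  have hf := finrank_orthogonal_span hm he0
  have hnt : Nontrivial (ℝ ∙ e)ᗮ := nontrivial_of_finrank_pos (R := ℝ) (by omega)
  have ho : ∀ u : (ℝ ∙ e)ᗮ, inner ℝ ((ℝ ∙ e)ᗮ.subtypeₗᵢ u) e = 0 := fun u =>
    Submodule.mem_orthogonal_singleton_iff_inner_left.1 u.2
  obtain ⟨f, hfe, hmp⟩ := exists_slice_homeomorph (ℝ ∙ e)ᗮ.subtypeₗᵢ e he ho (by omega)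
  set ω := (lebesgue (ℝ ∙ e)ᗮ).real (ball 0 1)
  refine ⟨2 * √2 ^ 3 * ω, by positivity, fun δ hδ hδ2 => ?_⟩
  have hsub : f ⁻¹' (capCone e δ) ⊆ ball (0 : (ℝ ∙ e)ᗮ) (√(2 * δ)) ×ˢ Icc (-1 : ℝ) 1 := by
    rintro ⟨u, t⟩ ⟨hx, hc⟩
    have hn := norm_slice_sq (ℝ ∙ e)ᗮ.subtypeₗᵢ he ho u t
    rw [hfe] at hx hc
    simp only at hx hc
    set x := (ℝ ∙ e)ᗮ.subtypeₗᵢ u + t • e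
    rw [mem_ball_zero_iff] at hx
    have hie : inner ℝ x e = t := by
      rw [inner_add_left, ho, inner_smul_left, real_inner_self_eq_norm_sq, he]; simp
    have hx0 : ‖x‖ ≠ 0 := by
      intro h0
      rw [cosSq, h0, inv_zero, zero_smul, inner_zero_left] at hc
      nlinarith [sq_nonneg (1 - δ)]
    rw [cosSq, inner_smul_left, hie, conj_trivial, mul_pow, inv_pow, inv_mul_eq_div,
      lt_div_iff₀ (by positivity)] at hc
    have hx2 : ‖x‖ ^ 2 < 1 := by nlinarith [norm_nonneg x]
    constructor
    · rw [mem_ball_zero_iff]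
      apply Real.lt_sqrt_of_sq_lt
      have h1 : ‖x‖ ^ 2 * (2 * δ - δ ^ 2) ≤ 1 * (2 * δ) := by
        apply mul_le_mul hx2.le <;> nlinarith
      change ‖u‖ ^ 2 < 2 * δ
      nlinarith
    · have ht : t ^ 2 ≤ 1 := by nlinarith [sq_nonneg ‖u‖]
      exact abs_le.1 (by rw [← sq_le_one_iff_abs_le_one]; exact ht)
  rw [measureReal_def, ← hmp.measure_preimage (measurableSet_capCone e δ).nullMeasurableSet,
    ← measureReal_def]
  have hfin : ((lebesgue (ℝ ∙ e)ᗮ).prod volume)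
      (ball (0 : (ℝ ∙ e)ᗮ) (√(2 * δ)) ×ˢ Icc (-1 : ℝ) 1) ≠ ⊤ := by
    rw [Measure.prod_prod]
    exact ENNReal.mul_ne_top measure_ball_lt_top.ne (by simp)
  refine (measureReal_mono hsub hfin).trans ?_
  rw [measureReal_prod_prod, Measure.real_def, Measure.addHaar_ball _ _ (Real.sqrt_nonneg _)]
  rw [ENNReal.toReal_mul, ENNReal.toReal_ofReal (by positivity), hf]
  have h2 : √(2 * δ) ^ m ≤ √(2 * δ) ^ 3 :=
    pow_le_pow_of_le_one (Real.sqrt_nonneg _) (Real.sqrt_le_one.2 (by linarith)) (by omega)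
  have h3 : √(2 * δ) ^ 3 = √2 ^ 3 * (δ * √δ) := by
    rw [Real.sqrt_mul (by norm_num), mul_pow]
    congr 1
    rw [pow_succ, Real.sq_sqrt hδ.le]
  have h4 : (volume : Measure ℝ).real (Icc (-1) 1) = 2 := by
    rw [Real.volume_real_Icc]; norm_num
  rw [h4]
  calc _ ≤ √(2 * δ) ^ 3 * ω * 2 := by gcongr; exact le_rfl
    _ = _ := by rw [h3]; ring

theorem capArg_le_one {e : F} (he : ‖e‖ = 1) (z : ℝ) (x : F) : (1 - z ^ 2) * cosSq e x ≤ 1 := by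
  nlinarith [cosSq_nonneg e x, cosSq_le_one he x, sq_nonneg z, mul_nonneg (sq_nonneg z)
    (cosSq_nonneg e x)]

/-- The bump vanishes unless the hyperplane comes near the axis (`z² ≤ 2δ`) and the direction lies
in the cap around `e`. If `|z| > 1` the argument is nonpositive and its square root is zero, so
estimates hold for all real `z`. -/
theorem capArg_sqrt_le {e : F} (he : ‖e‖ = 1) {δ : ℝ} (hδ : 0 < δ) (hδ2 : δ ≤ 1 / 2) {z : ℝ} {x : F}
    (h : ¬ (z ^ 2 ≤ 2 * δ ∧ (1 - δ) ^ 2 < cosSq e x)) :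
    √((1 - z ^ 2) * cosSq e x) ≤ 1 - δ := by
  apply Real.sqrt_le_iff.2 ⟨by linarith, ?_⟩
  have h0 := cosSq_nonneg e x
  have h1 := cosSq_le_one he x
  by_cases hz : z ^ 2 ≤ 2 * δ
  · have h2 : cosSq e x ≤ (1 - δ) ^ 2 := by
      by_contra h3; exact h ⟨hz, not_le.1 h3⟩
    nlinarith [mul_nonneg (sq_nonneg z) h0]
  · rw [not_le] at hz
    rcases le_total 0 (1 - z ^ 2) with h3 | h3
    · nlinarith [sq_nonneg δ]
    · nlinarith [sq_nonneg (1 - δ)]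

/-- The integral of the bump of width `δ` over the intersection of the unit ball with a hyperplane
whose unit normal has scalar product `z` with the axis of the bump; `e` is a unit vector of that
hyperplane. -/
def capIntegral (e : F) (δ z : ℝ) : ℝ :=
  ∫ x in ball (0 : F) 1, bumpProfile δ ((1 - z ^ 2) * cosSq e x) ∂lebesgue F

/-- The derivative of `capIntegral e δ`. -/
def capIntegralDeriv (e : F) (δ z : ℝ) : ℝ :=
  ∫ x in ball (0 : F) 1, bumpProfileDeriv δ ((1 - z ^ 2) * cosSq e x) * (-(2 * z) * cosSq e x)
    ∂lebesgue F

/-- The second derivative of `capIntegral e δ`. -/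
def capIntegralDeriv₂ (e : F) (δ z : ℝ) : ℝ :=
  ∫ x in ball (0 : F) 1, (bumpProfileDeriv₂ δ ((1 - z ^ 2) * cosSq e x) * (-(2 * z) * cosSq e x) *
    (-(2 * z) * cosSq e x) + bumpProfileDeriv δ ((1 - z ^ 2) * cosSq e x) * (-2 * cosSq e x))
    ∂lebesgue F

variable {e : F} {δ : ℝ}

theorem integrableOn_ball_of_bound {f : F → ℝ} (hf : Measurable f) {C : ℝ} (hC : ∀ x, |f x| ≤ C) :
    Integrable f ((lebesgue F).restrict (ball 0 1)) :=
  Measure.integrableOn_of_bounded (M := C) measure_ball_lt_top.ne hf.aestronglyMeasurable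
    (.of_forall hC)

theorem hasDerivAt_capArg (e x : F) (z : ℝ) :
    HasDerivAt (fun z : ℝ => (1 - z ^ 2) * cosSq e x) (-(2 * z) * cosSq e x) z := by
  have := ((hasDerivAt_pow 2 z).const_sub 1).mul_const (cosSq e x)
  simpa using this

theorem hasDerivAt_capIntegral (he : ‖e‖ = 1) (hδ : 0 < δ) (hδ2 : δ ≤ 1 / 2) (z : ℝ) :
    HasDerivAt (capIntegral e δ) (capIntegralDeriv e δ z) z := by
  obtain ⟨A, hA0, hA⟩ := exists_bumpProfile_bound
  have hm := measurable_cosSq e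
  have hm0 := (continuous_bumpProfile δ).measurable
  have hm1 := measurable_bumpProfileDeriv δ
  refine (hasDerivAt_integral_of_dominated_loc_of_deriv_le (ball_mem_nhds z one_pos)
    (F := fun z x => bumpProfile δ ((1 - z ^ 2) * cosSq e x))
    (F' := fun z x => bumpProfileDeriv δ ((1 - z ^ 2) * cosSq e x) * (-(2 * z) * cosSq e x))
    (bound := fun _ => A / δ * (2 * (|z| + 1)))
    (.of_forall fun y => ?_) ?_ ?_ (.of_forall fun x y hy => ?_) ?_ (.of_forall fun x y hy => ?_)).2
  · exact (by fun_prop : Measurable fun x => bumpProfile δ ((1 - y ^ 2) * cosSq e x))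
      |>.aestronglyMeasurable
  · refine integrableOn_ball_of_bound (C := 2) (by fun_prop) fun x => ?_
    rw [abs_of_nonneg (bumpProfile_nonneg _ _)]
    exact bumpProfile_le_two hδ (capArg_le_one he z x)
  · exact (by fun_prop : Measurable fun x => bumpProfileDeriv δ ((1 - z ^ 2) * cosSq e x) *
      (-(2 * z) * cosSq e x)).aestronglyMeasurable
  · have hy' : |y| ≤ |z| + 1 := by
      have h1 : |y - z| < 1 := hy
      have := abs_sub_abs_le_abs_sub y z
      linarith
    rw [norm_mul]
    gcongr
    · exact (hA δ hδ hδ2 _ (capArg_le_one he y x)).1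
    · rw [Real.norm_eq_abs, abs_mul, abs_neg, abs_mul, abs_two, abs_of_nonneg (cosSq_nonneg e x)]
      refine (mul_le_of_le_one_right (by positivity) (cosSq_le_one he x)).trans (by gcongr)
  · exact integrableOn_const measure_ball_lt_top.ne
  · exact (hasDerivAt_bumpProfile hδ hδ2 _).comp y (hasDerivAt_capArg e x y)

theorem hasDerivAt_capIntegralDeriv (he : ‖e‖ = 1) (hδ : 0 < δ) (hδ2 : δ ≤ 1 / 2) (z : ℝ) :
    HasDerivAt (capIntegralDeriv e δ) (capIntegralDeriv₂ e δ z) z := by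
  obtain ⟨A, hA0, hA⟩ := exists_bumpProfile_bound
  have hm := measurable_cosSq e
  have hm1 := measurable_bumpProfileDeriv δ
  have hm2 := measurable_bumpProfileDeriv₂ δ
  have hc : ∀ y x, |-(2 * y) * cosSq e x| ≤ 2 * |y| := by
    intro y x
    rw [abs_mul, abs_neg, abs_mul, abs_two, abs_of_nonneg (cosSq_nonneg e x)]
    exact mul_le_of_le_one_right (by positivity) (cosSq_le_one he x)
  have hc2 : ∀ x, |-2 * cosSq e x| ≤ 2 := by
    intro x
    rw [abs_mul, abs_neg, abs_two, abs_of_nonneg (cosSq_nonneg e x)]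
    linarith [cosSq_le_one he x]
  refine (hasDerivAt_integral_of_dominated_loc_of_deriv_le (ball_mem_nhds z one_pos)
    (F := fun z x => bumpProfileDeriv δ ((1 - z ^ 2) * cosSq e x) * (-(2 * z) * cosSq e x))
    (F' := fun z x => bumpProfileDeriv₂ δ ((1 - z ^ 2) * cosSq e x) * (-(2 * z) * cosSq e x) *
      (-(2 * z) * cosSq e x) + bumpProfileDeriv δ ((1 - z ^ 2) * cosSq e x) * (-2 * cosSq e x))
    (bound := fun _ => A / δ ^ 2 * (2 * (|z| + 1)) * (2 * (|z| + 1)) + A / δ * 2)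
    (.of_forall fun y => ?_) ?_ ?_ (.of_forall fun x y hy => ?_) ?_ (.of_forall fun x y hy => ?_)).2
  · exact (by fun_prop : Measurable fun x => bumpProfileDeriv δ ((1 - y ^ 2) * cosSq e x) *
      (-(2 * y) * cosSq e x)).aestronglyMeasurable
  · refine integrableOn_ball_of_bound (C := A / δ * (2 * |z|)) (by fun_prop) fun x => ?_
    rw [abs_mul]
    gcongr
    · exact (hA δ hδ hδ2 _ (capArg_le_one he z x)).1
    · exact hc z x
  · exact (by fun_prop : Measurable fun x => bumpProfileDeriv₂ δ ((1 - z ^ 2) * cosSq e x) *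
      (-(2 * z) * cosSq e x) * (-(2 * z) * cosSq e x) +
      bumpProfileDeriv δ ((1 - z ^ 2) * cosSq e x) * (-2 * cosSq e x)).aestronglyMeasurable
  · have hy' : |y| ≤ |z| + 1 := by
      have h1 : |y - z| < 1 := hy
      have := abs_sub_abs_le_abs_sub y z
      linarith
    obtain ⟨hA1, hA2⟩ := hA δ hδ hδ2 _ (capArg_le_one he y x)
    have hcy := (hc y x).trans (show 2 * |y| ≤ 2 * (|z| + 1) by gcongr)
    refine (norm_add_le _ _).trans ?_
    refine add_le_add ?_ ?_
    · rw [norm_mul, norm_mul]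
      exact mul_le_mul (mul_le_mul hA2 hcy (norm_nonneg _) (by positivity)) hcy (norm_nonneg _)
        (by positivity)
    · rw [norm_mul]
      exact mul_le_mul hA1 (hc2 x) (norm_nonneg _) (by positivity)
  · exact integrableOn_const measure_ball_lt_top.ne
  · have h1 := ((hasDerivAt_id y).const_mul 2).neg.mul_const (cosSq e x)
    have h2 := ((hasDerivAt_bumpProfileDeriv hδ hδ2 _).comp y (hasDerivAt_capArg e x y)).mul h1
    refine h2.congr_deriv ?_
    simp only [Function.comp_apply, Pi.neg_apply, id, mul_one]

theorem abs_setIntegral_le_capCone {f : F → ℝ} {C : ℝ}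
    (h0 : ∀ x, ¬ (1 - δ) ^ 2 < cosSq e x → f x = 0) (hC : ∀ x, |f x| ≤ C) :
    |∫ x in ball (0 : F) 1, f x ∂lebesgue F| ≤ C * (lebesgue F).real (capCone e δ) := by
  have h1 : ∫ x in ball (0 : F) 1, f x ∂lebesgue F = ∫ x in capCone e δ, f x ∂lebesgue F := by
    refine (setIntegral_eq_of_subset_of_forall_sdiff_eq_zero measurableSet_ball
      (fun x hx => hx.1) fun x hx => h0 x fun h => hx.2 ⟨hx.1, h⟩)
  rw [h1]
  refine norm_setIntegral_le_of_norm_le_const (f := f) ?_ fun x _ => hC x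
  exact (measure_mono fun x hx => hx.1).trans_lt (measure_ball_lt_top (x := (0 : F)) (r := 1))

/-- The functions `capIntegral e δ` tend to zero together with two derivatives as `δ → 0`. -/
theorem exists_capIntegral_small (hd : 4 ≤ finrank ℝ F) (he : ‖e‖ = 1) {η : ℝ} (hη : 0 < η) :
    ∃ δ₀, 0 < δ₀ ∧ δ₀ ≤ 1 / 2 ∧ ∀ δ, 0 < δ → δ < δ₀ → ∀ z, |capIntegral e δ z| ≤ η ∧
      |capIntegralDeriv e δ z| ≤ η ∧ |capIntegralDeriv₂ e δ z| ≤ η := by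
  obtain ⟨A, hA0, hA⟩ := exists_bumpProfile_bound
  obtain ⟨B, hB0, hB⟩ := capCone_measureReal_le hd he
  have key : ∀ δ, 0 < δ → δ ≤ 1 / 2 → ∀ z, |capIntegral e δ z| ≤ (2 + 10 * A) * B * √δ ∧
      |capIntegralDeriv e δ z| ≤ (2 + 10 * A) * B * √δ ∧
      |capIntegralDeriv₂ e δ z| ≤ (2 + 10 * A) * B * √δ := by
    intro δ hδ hδ2 z
    have hle : ∀ C, 0 ≤ C → C ≤ (2 + 10 * A) / δ → C * (lebesgue F).real (capCone e δ) ≤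
        (2 + 10 * A) * B * √δ := by
      intro C hC0 hC
      calc _ ≤ (2 + 10 * A) / δ * (B * (δ * √δ)) := by
            gcongr; exact hB δ hδ hδ2
        _ = _ := by field_simp
    -- Where the integrand is not zero, `z² ≤ 2δ`. In the second derivative this turns the factor `4
    -- z²` into `8 δ`, reducing `A / δ²` to order `1 / δ`; against the cap measure `δ^(3/2)` a power
    -- `√δ` remains.
    have hz : ∀ x, √((1 - z ^ 2) * cosSq e x) ≤ 1 - δ ∨ z ^ 2 ≤ 2 * δ := by
      intro x
      by_cases h : z ^ 2 ≤ 2 * δ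
      · exact .inr h
      · exact .inl (capArg_sqrt_le he hδ hδ2 fun h' => h h'.1)
    have hz0 : ∀ x, ¬ (1 - δ) ^ 2 < cosSq e x → √((1 - z ^ 2) * cosSq e x) ≤ 1 - δ :=
      fun x hx => capArg_sqrt_le he hδ hδ2 fun h' => hx h'.2
    refine ⟨?_, ?_, ?_⟩
    · refine (abs_setIntegral_le_capCone (C := 2) (fun x hx => bumpProfile_eq_zero hδ (hz0 x hx))
        fun x => ?_).trans (hle 2 (by norm_num) ?_)
      · rw [abs_of_nonneg (bumpProfile_nonneg _ _)]
        exact bumpProfile_le_two hδ (capArg_le_one he z x)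
      · rw [le_div_iff₀ hδ]; nlinarith
    · refine (abs_setIntegral_le_capCone (C := A / δ * 2) (fun x hx => ?_)
        fun x => ?_).trans (hle _ (by positivity) ?_)
      · rw [bumpProfileDeriv_eq_zero hδ (hz0 x hx), zero_mul]
      · rcases hz x with h | h
        · rw [bumpProfileDeriv_eq_zero hδ h, zero_mul, abs_zero]; positivity
        · have hz1 : |z| ≤ 1 := by rw [← sq_le_one_iff_abs_le_one]; linarith
          rw [abs_mul]
          gcongr
          · exact (hA δ hδ hδ2 _ (capArg_le_one he z x)).1
          · rw [abs_mul, abs_neg, abs_mul, abs_two, abs_of_nonneg (cosSq_nonneg e x)]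
            nlinarith [cosSq_le_one he x, cosSq_nonneg e x, abs_nonneg z]
      · rw [div_mul_eq_mul_div]; gcongr; linarith
    · refine (abs_setIntegral_le_capCone (C := 10 * A / δ) (fun x hx => ?_)
        fun x => ?_).trans (hle _ (by positivity) ?_)
      · rw [bumpProfileDeriv₂_eq_zero hδ (hz0 x hx), bumpProfileDeriv_eq_zero hδ (hz0 x hx)]
        simp
      · rcases hz x with h | h
        · rw [bumpProfileDeriv₂_eq_zero hδ h, bumpProfileDeriv_eq_zero hδ h]
          simp only [zero_mul, add_zero, abs_zero]; positivity
        · obtain ⟨hA1, hA2⟩ := hA δ hδ hδ2 _ (capArg_le_one he z x)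
          have hc0 := cosSq_nonneg e x
          have hc1 := cosSq_le_one he x
          have h3 : |-(2 * z) * cosSq e x * (-(2 * z) * cosSq e x)| ≤ 8 * δ := by
            rw [show -(2 * z) * cosSq e x * (-(2 * z) * cosSq e x) = 4 * z ^ 2 * cosSq e x ^ 2 by
              ring, abs_of_nonneg (by positivity)]
            calc _ ≤ 4 * (2 * δ) * 1 := by gcongr; exact pow_le_one₀ hc0 hc1
              _ = _ := by ring
          have h4 : |-2 * cosSq e x| ≤ 2 := by
            rw [abs_mul, abs_neg, abs_two, abs_of_nonneg hc0]; linarith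
          refine (abs_add_le _ _).trans ?_
          rw [mul_assoc, abs_mul, abs_mul (bumpProfileDeriv _ _)]
          calc _ ≤ A / δ ^ 2 * (8 * δ) + A / δ * 2 :=
                add_le_add (mul_le_mul hA2 h3 (abs_nonneg _) (by positivity))
                  (mul_le_mul hA1 h4 (abs_nonneg _) (by positivity))
            _ = _ := by field_simp; ring
      · gcongr; linarith
  set D := (2 + 10 * A) * B
  have hD0 : 0 ≤ D := by positivity
  refine ⟨min (1 / 2) ((η / (D + 1)) ^ 2), by positivity, min_le_left _ _, fun δ hδ hδ0 z => ?_⟩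
  have hδ2 : δ ≤ 1 / 2 := hδ0.le.trans (min_le_left _ _)
  have hs : √δ ≤ η / (D + 1) :=
    Real.sqrt_le_iff.2 ⟨by positivity, hδ0.le.trans (min_le_right _ _)⟩
  have hfin : D * √δ ≤ η := by
    calc D * √δ ≤ (D + 1) * (η / (D + 1)) := by gcongr; linarith
      _ = η := by field_simp
  obtain ⟨h1, h2, h3⟩ := key δ hδ hδ2 z
  exact ⟨h1.trans hfin, h2.trans hfin, h3.trans hfin⟩

end Cap

/-! ### Convexity of bodies of revolution that are `C²`-close to a ball. -/

section Convexity

open Set Metric Module Filter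
open scoped Topology

variable {m m₁ m₂ : ℝ → ℝ}

theorem hasDerivAt_sqrt_one_add_sq (t : ℝ) :
    HasDerivAt (fun t : ℝ => √(1 + t ^ 2)) (t / √(1 + t ^ 2)) t := by
  have h1 := ((hasDerivAt_pow 2 t).const_add 1).sqrt (by positivity : (1 + t ^ 2 : ℝ) ≠ 0)
  refine h1.congr_deriv ?_
  have : √(1 + t ^ 2) ≠ 0 := by positivity
  simp
  field_simp

theorem hasDerivAt_slope_div_sqrt (a b t : ℝ) :
    HasDerivAt (fun t : ℝ => (a + b * t) / √(1 + t ^ 2)) ((b - a * t) / √(1 + t ^ 2) ^ 3) t := by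
  have hR : √(1 + t ^ 2) ≠ 0 := by positivity
  have hR2 : √(1 + t ^ 2) ^ 2 = 1 + t ^ 2 := Real.sq_sqrt (by positivity)
  have h1 := (((hasDerivAt_id t).const_mul b).const_add a).div (hasDerivAt_sqrt_one_add_sq t) hR
  refine h1.congr_deriv ?_
  simp only [id, mul_one]
  field_simp
  rw [hR2]
  ring

/-- With `z = (a + b t) / √(1 + t²)` and `w = (b - a t) / √(1 + t²)`, the second derivative is `(m +
m'' w² - m' z) / (1 + t²)^(3/2)`, and `z² + w² = a² + b² ≤ 1`. The assumed bound makes the numerator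
nonnegative. -/
theorem convexOn_perspective (h1 : ∀ z, HasDerivAt m (m₁ z) z) (h2 : ∀ z, HasDerivAt m₁ (m₂ z) z)
    (hm : ∀ z, |m₁ z| + |m₂ z| ≤ m z) {a b : ℝ} (hab : a ^ 2 + b ^ 2 ≤ 1) :
    ConvexOn ℝ univ fun t : ℝ => √(1 + t ^ 2) * m ((a + b * t) / √(1 + t ^ 2)) := by
  have hR : ∀ t : ℝ, √(1 + t ^ 2) ≠ 0 := fun t => by positivity
  have hR2 : ∀ t : ℝ, √(1 + t ^ 2) ^ 2 = 1 + t ^ 2 := fun t => Real.sq_sqrt (by positivity)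
  have hd1 : ∀ t, HasDerivAt (fun t : ℝ => √(1 + t ^ 2) * m ((a + b * t) / √(1 + t ^ 2)))
      (t / √(1 + t ^ 2) * m ((a + b * t) / √(1 + t ^ 2)) +
        m₁ ((a + b * t) / √(1 + t ^ 2)) * ((b - a * t) / (1 + t ^ 2))) t := by
    intro t
    have h3 := (hasDerivAt_sqrt_one_add_sq t).mul ((h1 _).comp t (hasDerivAt_slope_div_sqrt a b t))
    refine h3.congr_deriv ?_
    have hRt := hR t
    have hRR := hR2 t
    simp only [Function.comp_apply]
    generalize √(1 + t ^ 2) = R at *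
    rw [← hRR]
    field_simp
  have hd2 : ∀ t, HasDerivAt (fun t : ℝ => t / √(1 + t ^ 2) * m ((a + b * t) / √(1 + t ^ 2)) +
        m₁ ((a + b * t) / √(1 + t ^ 2)) * ((b - a * t) / (1 + t ^ 2)))
      ((m ((a + b * t) / √(1 + t ^ 2)) + m₂ ((a + b * t) / √(1 + t ^ 2)) *
        ((b - a * t) / √(1 + t ^ 2)) ^ 2 - m₁ ((a + b * t) / √(1 + t ^ 2)) *
        ((a + b * t) / √(1 + t ^ 2))) / √(1 + t ^ 2) ^ 3) t := by
    intro t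
    have hz := hasDerivAt_slope_div_sqrt a b t
    have hu := hasDerivAt_slope_div_sqrt 0 1 t
    simp only [zero_add, one_mul, zero_mul, sub_zero] at hu
    have hw : HasDerivAt (fun t : ℝ => (b - a * t) / (1 + t ^ 2)) _ t :=
      (((hasDerivAt_id t).const_mul a).const_sub b).div ((hasDerivAt_pow 2 t).const_add 1)
        (by positivity)
    have h3 := (hu.mul ((h1 _).comp t hz)).add (((h2 _).comp t hz).mul hw)
    refine h3.congr_deriv ?_
    have hRt := hR t
    simp only [Function.comp_apply, id, mul_one]
    generalize m ((a + b * t) / √(1 + t ^ 2)) = M0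
    generalize m₁ ((a + b * t) / √(1 + t ^ 2)) = M1
    generalize m₂ ((a + b * t) / √(1 + t ^ 2)) = M2
    have hRR := hR2 t
    generalize √(1 + t ^ 2) = R at *
    rw [← hRR]
    field_simp
    simp only [Nat.cast_ofNat, Nat.add_one_sub_one, pow_one]
    linear_combination (-(R * M1 * a)) * hRR
  have hderiv : deriv (fun t : ℝ => √(1 + t ^ 2) * m ((a + b * t) / √(1 + t ^ 2))) =
      fun t : ℝ => t / √(1 + t ^ 2) * m ((a + b * t) / √(1 + t ^ 2)) +
        m₁ ((a + b * t) / √(1 + t ^ 2)) * ((b - a * t) / (1 + t ^ 2)) :=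
    funext fun t => (hd1 t).deriv
  refine convexOn_of_deriv2_nonneg' convex_univ
    (fun t _ => (hd1 t).differentiableAt.differentiableWithinAt) ?_ fun t _ => ?_
  · rw [hderiv]
    exact fun t _ => (hd2 t).differentiableAt.differentiableWithinAt
  · rw [Function.iterate_succ, Function.iterate_one, Function.comp_apply, hderiv, (hd2 t).deriv]
    refine div_nonneg ?_ (by positivity)
    set z := (a + b * t) / √(1 + t ^ 2) with hz
    have hsum : z ^ 2 + ((b - a * t) / √(1 + t ^ 2)) ^ 2 ≤ 1 := by
      rw [hz, div_pow, div_pow, ← add_div, hR2, div_le_one (by positivity)]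
      nlinarith [sq_nonneg t]
    have hz1 : |z| ≤ 1 := by
      rw [← sq_le_one_iff_abs_le_one]
      nlinarith [sq_nonneg ((b - a * t) / √(1 + t ^ 2))]
    have hw1 : ((b - a * t) / √(1 + t ^ 2)) ^ 2 ≤ 1 := by nlinarith [sq_nonneg z]
    have e1 : |m₂ z * ((b - a * t) / √(1 + t ^ 2)) ^ 2| ≤ |m₂ z| := by
      rw [abs_mul, abs_of_nonneg (sq_nonneg ((b - a * t) / √(1 + t ^ 2)))]
      exact mul_le_of_le_one_right (abs_nonneg _) hw1
    have e2 : |m₁ z * z| ≤ |m₁ z| := by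
      rw [abs_mul]; exact mul_le_of_le_one_right (abs_nonneg _) hz1
    have := hm z
    linarith [neg_abs_le (m₂ z * ((b - a * t) / √(1 + t ^ 2)) ^ 2), le_abs_self (m₁ z * z)]

variable {E : Type*} [NormedAddCommGroup E] [InnerProductSpace ℝ E]

/-- The homogeneous function of degree one and of revolution about the axis `x₀` whose value at a
unit vector at angle `α` from `x₀` is `m (cos α)`. -/
def revolutionGauge (m : ℝ → ℝ) (x₀ x : E) : ℝ := ‖x‖ * m (inner ℝ (‖x‖⁻¹ • x) x₀)

theorem isMinkowskiFunctional_revolutionGauge (hc : Continuous m) (heven : ∀ z, m (-z) = m z)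
    (hpos : ∀ z, 0 < m z) (x₀ : E) : IsMinkowskiFunctional (revolutionGauge m x₀) where
  continuous := by
    rw [continuous_iff_continuousAt]
    intro x
    rcases eq_or_ne x 0 with rfl | hx
    · obtain ⟨M, hM⟩ := (isCompact_Icc (a := -‖x₀‖) (b := ‖x₀‖)).exists_bound_of_continuousOn
        hc.continuousOn
      have h1 : Tendsto (fun x : E => ‖x‖ * M) (𝓝 0) (𝓝 0) := by
        have : Continuous fun x : E => ‖x‖ * M := by fun_prop
        simpa using this.tendsto 0
      have h0 : revolutionGauge m x₀ (0 : E) = 0 := by simp [revolutionGauge]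
      rw [ContinuousAt, h0]
      refine squeeze_zero_norm (fun x => ?_) h1
      rw [revolutionGauge, norm_mul, norm_norm]
      gcongr
      refine hM _ (abs_le.1 ((abs_real_inner_le_norm _ _).trans ?_))
      refine mul_le_of_le_one_left (norm_nonneg _) ?_
      rw [norm_smul, norm_inv, norm_norm]
      exact inv_mul_le_one
    · have hn : ‖x‖ ≠ 0 := by simpa using hx
      have hi : ContinuousAt (fun x : E => inner ℝ (‖x‖⁻¹ • x) x₀) x := by
        have : ContinuousAt (fun x : E => ‖x‖⁻¹ • x) x :=
          (continuous_norm.continuousAt.inv₀ hn).smul continuousAt_id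
        exact this.inner continuousAt_const
      exact continuous_norm.continuousAt.mul (hc.continuousAt.comp hi)
  smul c x := by
    rcases eq_or_ne c 0 with rfl | hc0
    · simp [revolutionGauge]
    have habs : |c| ≠ 0 := abs_ne_zero.2 hc0
    simp only [revolutionGauge, norm_smul, Real.norm_eq_abs, mul_assoc, inner_smul_left,
      conj_trivial]
    congr 2
    rcases abs_choice c with h | h <;> rw [h] at habs ⊢
    · congr 1; field_simp
    · rw [← heven]; congr 1; field_simp
  pos x hx := mul_pos (norm_pos_iff.2 hx) (hpos _)

/-- The factor `d = ‖p‖` in the parameter normalizes the distance of the line from the origin to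
one, the form treated in `convexOn_perspective`. -/
theorem revolutionGauge_line {x₀ p u : E} {d : ℝ} (hd : ‖p‖ = d) (hd0 : 0 < d) (hu : ‖u‖ = 1)
    (hpu : inner ℝ p u = 0) (t : ℝ) :
    revolutionGauge m x₀ (p + (d * t) • u) = d * (√(1 + t ^ 2) *
      m ((inner ℝ (d⁻¹ • p) x₀ + inner ℝ u x₀ * t) / √(1 + t ^ 2))) := by
  have hn : ‖p + (d * t) • u‖ = d * √(1 + t ^ 2) := by
    have h1 : ‖p + (d * t) • u‖ ^ 2 = d ^ 2 * (1 + t ^ 2) := by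
      rw [norm_add_sq_real, inner_smul_right, hpu, norm_smul, hu, hd, Real.norm_eq_abs, mul_one,
        sq_abs]
      ring
    rw [← Real.sqrt_sq (norm_nonneg (p + (d * t) • u)), h1, Real.sqrt_mul (by positivity),
      Real.sqrt_sq hd0.le]
  rw [revolutionGauge, hn, mul_assoc]
  congr 3
  have : √(1 + t ^ 2) ≠ 0 := by positivity
  simp only [inner_smul_left, inner_add_left, conj_trivial]
  field_simp

theorem sq_inner_add_sq_inner_le {x₀ p u : E} (hx₀ : ‖x₀‖ = 1) (hp : ‖p‖ = 1) (hu : ‖u‖ = 1)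
    (hpu : inner ℝ p u = 0) : inner ℝ p x₀ ^ 2 + inner ℝ u x₀ ^ 2 ≤ 1 := by
  have h1 := sq_nonneg ‖x₀ - (inner ℝ p x₀ • p + inner ℝ u x₀ • u)‖
  rw [norm_sub_sq_real, norm_add_sq_real] at h1
  simp only [norm_smul, hp, hu, hx₀, inner_add_right, inner_smul_right, inner_smul_left, hpu,
    real_inner_comm p x₀, real_inner_comm u x₀, Real.norm_eq_abs, mul_one, mul_zero, add_zero,
    sq_abs] at h1
  nlinarith

/-- Convexity is tested on the line through `x` and `y`, written as `p + s u` with `p` the foot of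
the perpendicular from the origin. If `p = 0`, homogeneity reduces the claim to convexity of the
absolute value; otherwise `convexOn_perspective` applies. -/
theorem convexOn_revolutionGauge (h1 : ∀ z, HasDerivAt m (m₁ z) z)
    (h2 : ∀ z, HasDerivAt m₁ (m₂ z) z) (hm : ∀ z, |m₁ z| + |m₂ z| ≤ m z)
    {x₀ : E} (hx₀ : ‖x₀‖ = 1) (hN : IsMinkowskiFunctional (revolutionGauge m x₀)) :
    ConvexOn ℝ univ (revolutionGauge m x₀) := by
  refine ⟨convex_univ, fun x _ y _ a b ha hb hab => ?_⟩
  rcases eq_or_ne x y with rfl | hxy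
  · rw [← add_smul, hab, one_smul, smul_eq_mul, smul_eq_mul, ← add_mul, hab, one_mul]
  have hne : ‖y - x‖ ≠ 0 := norm_ne_zero_iff.2 (sub_ne_zero.2 hxy.symm)
  set u := ‖y - x‖⁻¹ • (y - x) with hu_def
  have hu : ‖u‖ = 1 := by rw [hu_def, norm_smul, norm_inv, norm_norm, inv_mul_cancel₀ hne]
  set p := x - inner ℝ x u • u with hp_def
  have hpu : inner ℝ p u = 0 := by
    rw [hp_def, inner_sub_left, inner_smul_left, real_inner_self_eq_norm_sq, hu]; simp
  set α := inner ℝ x u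
  set β := α + ‖y - x‖ with hβ
  have hx : x = p + α • u := by rw [hp_def]; abel
  have hy : y = p + β • u := by
    rw [hβ, add_smul, ← add_assoc, ← hx, hu_def, smul_smul, mul_inv_cancel₀ hne, one_smul]; abel
  have hcomb : a • x + b • y = p + (a * α + b * β) • u := by
    rw [hx, hy]
    calc _ = (a + b) • p + (a * α + b * β) • u := by module
      _ = _ := by rw [hab, one_smul]
  rw [hcomb, smul_eq_mul, smul_eq_mul]
  rcases eq_or_ne p 0 with hp | hp
  · rw [hx, hy, hp]
    simp only [zero_add, hN.smul]
    have h3 : |a * α + b * β| ≤ a * |α| + b * |β| := by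
      refine (abs_add_le _ _).trans ?_
      rw [abs_mul, abs_mul, abs_of_nonneg ha, abs_of_nonneg hb]
    nlinarith [hN.nonneg u]
  · have hd0 : 0 < ‖p‖ := by positivity
    have hline := revolutionGauge_line (m := m) (x₀ := x₀) rfl hd0 hu hpu
    have hab' : inner ℝ (‖p‖⁻¹ • p) x₀ ^ 2 + inner ℝ u x₀ ^ 2 ≤ 1 :=
      sq_inner_add_sq_inner_le hx₀ (by rw [norm_smul, norm_inv, norm_norm, inv_mul_cancel₀ hd0.ne'])
        hu (by rw [inner_smul_left, hpu, mul_zero])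
    have hconv := (convexOn_perspective h1 h2 hm hab').2 (mem_univ (α / ‖p‖)) (mem_univ (β / ‖p‖))
      ha hb hab
    have e1 : ∀ s : ℝ, s = ‖p‖ * (s / ‖p‖) := fun s => by field_simp
    rw [hx, hy, e1 α, e1 β, hline, hline]
    have e2 : a * (‖p‖ * (α / ‖p‖)) + b * (‖p‖ * (β / ‖p‖)) =
        ‖p‖ * (a • (α / ‖p‖) + b • (β / ‖p‖)) := by simp only [smul_eq_mul]; ring
    rw [e2, hline]
    simp only [smul_eq_mul] at hconv ⊢
    calc _ ≤ _ := mul_le_mul_of_nonneg_left hconv hd0.le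
      _ = _ := by ring

/-- Perturbations of a constant that are small in `C²` give convex bodies of revolution. -/
theorem inv_sub_bound {P P₁ P₂ : ℝ → ℝ} (h1 : ∀ z, HasDerivAt P (P₁ z) z)
    (h2 : ∀ z, HasDerivAt P₁ (P₂ z) z) {ω c : ℝ} (hω : 0 < ω) (hc : 0 < c)
    (hP : ∀ z, |P z| ≤ ω / 10 ∧ |P₁ z| ≤ ω / 10 ∧ |P₂ z| ≤ ω / 10) :
    ∃ m₁ m₂ : ℝ → ℝ, (∀ z, HasDerivAt (fun z => (c * (ω - P z))⁻¹) (m₁ z) z) ∧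
      (∀ z, HasDerivAt m₁ (m₂ z) z) ∧ (∀ z, |m₁ z| + |m₂ z| ≤ (c * (ω - P z))⁻¹) := by
  have hpos : ∀ z, 0 < ω - P z := fun z => by
    have := (abs_le.1 (hP z).1).2; linarith
  refine ⟨fun z => c⁻¹ * (P₁ z / (ω - P z) ^ 2),
    fun z => c⁻¹ * (P₂ z / (ω - P z) ^ 2 + 2 * P₁ z ^ 2 / (ω - P z) ^ 3), fun z => ?_,
    fun z => ?_, fun z => ?_⟩
  · have h3 := (((h1 z).const_sub ω).const_mul c).inv (mul_pos hc (hpos z)).ne'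
    refine h3.congr_deriv ?_
    have := (hpos z).ne'
    field_simp
  · have h3 := ((h2 z).div (((h1 z).const_sub ω).pow 2) (pow_pos (hpos z) 2).ne').const_mul c⁻¹
    refine h3.congr_deriv ?_
    have := (hpos z).ne'
    simp only [Pi.pow_apply]
    field_simp
    push_cast
    ring
  · obtain ⟨hP0, hP1, hP2⟩ := hP z
    have hq := hpos z
    have hq1 : 9 / 10 * ω ≤ ω - P z := by have := (abs_le.1 hP0).2; linarith
    rw [mul_inv, abs_mul, abs_mul, abs_of_pos (inv_pos.2 hc), ← mul_add]
    gcongr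
    have e0 : |P₁ z / (ω - P z) ^ 2| ≤ ω / 10 / (ω - P z) ^ 2 := by
      rw [abs_div, abs_of_pos (pow_pos hq 2)]; gcongr
    have e1 : |P₂ z / (ω - P z) ^ 2 + 2 * P₁ z ^ 2 / (ω - P z) ^ 3| ≤
        ω / 10 / (ω - P z) ^ 2 + 2 * (ω / 10) ^ 2 / (ω - P z) ^ 3 := by
      refine (abs_add_le _ _).trans ?_
      rw [abs_div, abs_div, abs_of_pos (pow_pos hq 2), abs_of_pos (pow_pos hq 3), abs_mul, abs_two,
        abs_pow]
      gcongr
    have e2 : ω / 10 / (ω - P z) ^ 2 + (ω / 10 / (ω - P z) ^ 2 +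
        2 * (ω / 10) ^ 2 / (ω - P z) ^ 3) ≤ (ω - P z)⁻¹ := by
      set q := ω - P z
      rw [inv_eq_one_div, div_add_div _ _ (by positivity) (by positivity),
        div_add_div _ _ (by positivity) (by positivity), div_le_div_iff₀ (by positivity) hq]
      -- Since `q ≥ 9ω/10`, the left side is far below `q²`; this is what the constant `1/10` is
      -- for.
      have h5 : ω / 10 * q + (ω / 10 * q + 2 * (ω / 10) ^ 2) ≤ q ^ 2 := by nlinarith
      have h6 := mul_le_mul_of_nonneg_left h5 (by positivity : 0 ≤ q ^ 5)
      nlinarith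
    linarith

end Convexity

/-! ### Projection of homogeneous functions along a line. -/

section Sections

open Set Metric Module Filter
open scoped Topology

theorem one_add_sq_le_norm_pow {s : ℝ} {t : ℝ} (hs : s ^ 2 = 1 + t ^ 2) (hs0 : 0 ≤ s) {k : ℕ}
    (hk : 2 ≤ k) : 1 + t ^ 2 ≤ s ^ k := by
  have h1 : 1 ≤ s := by nlinarith [sq_nonneg t]
  rw [← hs]
  exact pow_le_pow_right₀ h1 hk

/-- The measure `dr / r` is scale invariant and gives `[1, e]` mass `log e = 1`, whatever `q` is. -/
theorem setIntegral_Ioi_inv_indicator {q : ℝ} (hq : 0 < q) :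
    ∫ r in Ioi (0 : ℝ), r⁻¹ * (Icc 1 (Real.exp 1)).indicator 1 (r * q) = 1 := by
  have h1 : ∀ r ∈ Ioi (0 : ℝ), r⁻¹ * (Icc 1 (Real.exp 1)).indicator 1 (r * q) =
      (Icc q⁻¹ (Real.exp 1 * q⁻¹)).indicator (fun r => r⁻¹) r := by
    intro r _
    have : r * q ∈ Icc 1 (Real.exp 1) ↔ r ∈ Icc q⁻¹ (Real.exp 1 * q⁻¹) := by
      rw [mem_Icc, mem_Icc, ← div_eq_mul_inv, le_div_iff₀ hq, inv_le_iff_one_le_mul₀ hq]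
    by_cases h : r ∈ Icc q⁻¹ (Real.exp 1 * q⁻¹)
    · rw [indicator_of_mem (this.2 h), indicator_of_mem h]; simp
    · rw [indicator_of_notMem (mt this.1 h), indicator_of_notMem h, mul_zero]
  have hq' : 0 < q⁻¹ := inv_pos.2 hq
  have hsub : Icc q⁻¹ (Real.exp 1 * q⁻¹) ⊆ Ioi 0 := fun r hr => hq'.trans_le hr.1
  have hle : q⁻¹ ≤ Real.exp 1 * q⁻¹ :=
    le_mul_of_one_le_left hq'.le (Real.one_le_exp (by norm_num))
  rw [setIntegral_congr_fun measurableSet_Ioi h1, setIntegral_indicator measurableSet_Icc,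
    inter_eq_self_of_subset_right hsub, integral_Icc_eq_integral_Ioc,
    ← intervalIntegral.integral_of_le hle, integral_inv_of_pos hq' (by positivity),
    mul_div_cancel_right₀ _ hq'.ne', Real.log_exp]

section Marginal

variable {U W : Type*} [NormedAddCommGroup U] [InnerProductSpace ℝ U] [NormedAddCommGroup W]
  [InnerProductSpace ℝ W]

/-- The integral over the line through `i u` in direction `v` of the extension of `g` to a
homogeneous function of degree `-k`. -/
def lineIntegral (g : W → ℝ) (i : U →ₗᵢ[ℝ] W) (v : W) (k : ℕ) (u : U) : ℝ :=
  ∫ t : ℝ, g (i u + t • v) * (‖i u + t • v‖ ^ k)⁻¹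

theorem lineIntegral_smul {g : W → ℝ} (hg : IsEvenAngular g) (i : U →ₗᵢ[ℝ] W) (v : W) (d : ℕ)
    {c : ℝ} (hc : c ≠ 0) (u : U) :
    lineIntegral g i v (d + 1) (c • u) = (|c| ^ d)⁻¹ * lineIntegral g i v (d + 1) u := by
  have hc' : |c| ≠ 0 := abs_ne_zero.2 hc
  have h1 := Measure.integral_comp_mul_left
    (fun t : ℝ => g (i (c • u) + t • v) * (‖i (c • u) + t • v‖ ^ (d + 1))⁻¹) c
  have h2 : ∀ t : ℝ, g (i (c • u) + (c * t) • v) * (‖i (c • u) + (c * t) • v‖ ^ (d + 1))⁻¹ =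
      (|c| ^ (d + 1))⁻¹ * (g (i u + t • v) * (‖i u + t • v‖ ^ (d + 1))⁻¹) := by
    intro t
    have : i (c • u) + (c * t) • v = c • (i u + t • v) := by
      rw [map_smul, smul_add, smul_smul]
    rw [this, hg.smul _ _ hc, norm_smul, Real.norm_eq_abs, mul_pow, mul_inv]
    ring
  simp only [h2, integral_const_mul, smul_eq_mul, abs_inv] at h1
  change _ = |c|⁻¹ * lineIntegral g i v (d + 1) (c • u) at h1
  change (|c| ^ (d + 1))⁻¹ * lineIntegral g i v (d + 1) u = _ at h1
  rw [eq_inv_mul_iff_mul_eq₀ hc'] at h1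
  rw [← h1, pow_succ]
  field_simp

variable [FiniteDimensional ℝ U] [MeasurableSpace U] [BorelSpace U] [FiniteDimensional ℝ W]
  [MeasurableSpace W] [BorelSpace W]

/-- Projection of a homogeneous function along `v` commutes with integration over spheres. -/
theorem setIntegral_ball_eq_lineIntegral [Nontrivial U] [Nontrivial W] (i : U →ₗᵢ[ℝ] W) {v : W}
    (hv : ‖v‖ = 1) (ho : ∀ u, inner ℝ (i u) v = 0) {d : ℕ} (hU : finrank ℝ U = d)
    (hW : finrank ℝ W = d + 1) {g : W → ℝ} (hg : IsEvenAngular g) :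
    (d + 1 : ℝ) * ∫ x in ball (0 : W) 1, g x ∂lebesgue W =
      d * ∫ u in ball (0 : U) 1, lineIntegral g i v (d + 1) (‖u‖⁻¹ • u) ∂lebesgue U := by
  have hd : 1 ≤ d := hU ▸ finrank_pos
  obtain ⟨e, he, hmp⟩ := exists_slice_homeomorph i v hv ho (by rw [hW, hU])
  obtain ⟨C, hC0, hC⟩ := hg.exists_bound
  set pr : W → ℝ := fun x => ‖x - inner ℝ x v • v‖ with hpr
  have hpr_e : ∀ u (t : ℝ), pr (i u + t • v) = ‖u‖ := by
    intro u t
    have : inner ℝ (i u + t • v) v = t := by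
      rw [inner_add_left, ho, inner_smul_left, real_inner_self_eq_norm_sq, hv]; simp
    simp only [hpr, this, add_sub_cancel_right, i.norm_map]
  have hpr_smul : ∀ (r : ℝ) x, pr (r • x) = |r| * pr x := by
    intro r x
    simp only [hpr, inner_smul_left, conj_trivial]
    rw [mul_smul, ← smul_sub, norm_smul, Real.norm_eq_abs]
  have hpr_meas : Measurable pr := by simp only [hpr]; fun_prop
  have hI : Measurable ((Icc 1 (Real.exp 1)).indicator (1 : ℝ → ℝ)) :=
    measurable_one.indicator measurableSet_Icc
  -- The cutoff depends only on the norm of the component orthogonal to `v`. In polar coordinates on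
  -- `W` and on `U` alike, the radial integral is then `∫ dr / r` over an interval `[1/q, e/q]`,
  -- hence `1`. Computing `∫ F` in both ways gives the identity.
  set F : W → ℝ := fun x => g x * (‖x‖ ^ (d + 1))⁻¹ * (Icc 1 (Real.exp 1)).indicator 1 (pr x)
    with hF
  have hF_meas : Measurable F := by
    have := hg.measurable
    have := hI.comp hpr_meas
    simp only [Function.comp_def] at this
    simp only [hF]
    fun_prop
  have hFe : ∀ u (t : ℝ), F (e (u, t)) = (Icc 1 (Real.exp 1)).indicator 1 ‖u‖ *
      (g (i u + t • v) * (‖i u + t • v‖ ^ (d + 1))⁻¹) := by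
    intro u t
    simp only [hF, he, hpr_e]
    ring
  have hFei : Integrable (fun p => F (e p)) ((lebesgue U).prod volume) := by
    have hb : Integrable (fun p : U × ℝ => (closedBall (0 : U) (Real.exp 1)).indicator
        (fun _ => C) p.1 * (1 + p.2 ^ 2)⁻¹) ((lebesgue U).prod volume) := by
      refine Integrable.mul_prod (f := (closedBall (0 : U) (Real.exp 1)).indicator (fun _ => C)) ?_
        integrable_inv_one_add_sq
      exact (integrable_indicator_iff measurableSet_closedBall).2
        (integrableOn_const measure_closedBall_lt_top.ne)
    refine hb.mono' (hF_meas.comp e.measurable).aestronglyMeasurable (.of_forall ?_)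
    rintro ⟨u, t⟩
    rw [hFe]
    by_cases hu : ‖u‖ ∈ Icc 1 (Real.exp 1)
    · rw [indicator_of_mem hu, indicator_of_mem (by simpa using hu.2), Pi.one_apply, one_mul,
        norm_mul, norm_inv, norm_pow, norm_norm]
      have h1 : 1 + t ^ 2 ≤ ‖i u + t • v‖ ^ (d + 1) := by
        have h2 : 1 + t ^ 2 ≤ ‖i u + t • v‖ ^ 2 := by
          rw [norm_slice_sq i hv ho]
          have := hu.1
          nlinarith
        refine h2.trans (pow_le_pow_right₀ ?_ (by omega))
        nlinarith [norm_nonneg (i u + t • v), sq_nonneg t]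
      gcongr
      exact hC _
    · rw [indicator_of_notMem hu, zero_mul, norm_zero]
      exact mul_nonneg (indicator_nonneg (fun _ _ => hC0) _) (by positivity)
  have hFi : Integrable F (lebesgue W) := (hmp.integrable_comp_emb e.measurableEmbedding).1 hFei
  have hleft : ∫ x, F x ∂lebesgue W = (d + 1 : ℝ) * ∫ x in ball (0 : W) 1, g x ∂lebesgue W := by
    rw [integral_eq_setIntegral_ball _ hFi, hW]
    push_cast
    congr 1
    -- The orthogonal component vanishes only on the line spanned by `v`, which is proper and
    -- therefore null.
    have hvt : (ℝ ∙ v) ≠ ⊤ := by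
      intro h
      have h1 := finrank_span_singleton (K := ℝ) (v := v) (by rintro rfl; simp at hv)
      rw [h, finrank_top, hW] at h1
      omega
    have hnull := Measure.addHaar_submodule (lebesgue W) (ℝ ∙ v) hvt
    refine integral_congr_ae (ae_restrict_of_ae ?_)
    filter_upwards [compl_mem_ae_iff.2 hnull] with x hx
    have hx0 : x ≠ 0 := by rintro rfl; exact hx (Submodule.zero_mem _)
    have hxn : 0 < ‖x‖⁻¹ := by positivity
    have hq : 0 < pr (‖x‖⁻¹ • x) := by
      rw [hpr_smul]
      refine mul_pos (by positivity) (norm_pos_iff.2 fun h0 => hx ?_)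
      rw [sub_eq_zero] at h0
      exact Submodule.mem_span_singleton.2 ⟨_, h0.symm⟩
    have hu : ‖‖x‖⁻¹ • x‖ = 1 := by simp [norm_smul, hx0]
    have h2 : ∀ r ∈ Ioi (0 : ℝ), r ^ d * F (r • (‖x‖⁻¹ • x)) =
        g x * (r⁻¹ * (Icc 1 (Real.exp 1)).indicator 1 (r * pr (‖x‖⁻¹ • x))) := by
      intro r (hr : 0 < r)
      simp only [hF, hg.smul r _ hr.ne', hg.radial hx0, hpr_smul r, abs_of_pos hr, norm_smul r, hu,
        Real.norm_of_nonneg hr.le, mul_one]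
      field_simp
      ring
    rw [setIntegral_congr_fun measurableSet_Ioi h2, integral_const_mul,
      setIntegral_Ioi_inv_indicator hq, mul_one]
  have hright : ∫ x, F x ∂lebesgue W =
      d * ∫ u in ball (0 : U) 1, lineIntegral g i v (d + 1) (‖u‖⁻¹ • u) ∂lebesgue U := by
    rw [← hmp.integral_comp e.measurableEmbedding, integral_prod _ hFei]
    have h1 : ∀ u, ∫ t : ℝ, F (e (u, t)) =
        (Icc 1 (Real.exp 1)).indicator 1 ‖u‖ * lineIntegral g i v (d + 1) u := by
      intro u
      simp only [hFe, integral_const_mul, lineIntegral]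
    have h2 := hFei.integral_prod_left
    simp only [h1] at h2 ⊢
    rw [integral_eq_setIntegral_ball _ h2, hU]
    congr 1
    have h0 : ∀ᵐ u ∂lebesgue U, u ≠ 0 := by simp [ae_iff]
    refine integral_congr_ae (ae_restrict_of_ae ?_)
    filter_upwards [h0] with u hu
    have hn : ‖‖u‖⁻¹ • u‖ = 1 := by simp [norm_smul, hu]
    have h3 : ∀ r ∈ Ioi (0 : ℝ), r ^ (d - 1) * ((Icc 1 (Real.exp 1)).indicator 1 ‖r • (‖u‖⁻¹ • u)‖ *
        lineIntegral g i v (d + 1) (r • (‖u‖⁻¹ • u))) =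
        lineIntegral g i v (d + 1) (‖u‖⁻¹ • u) *
          (r⁻¹ * (Icc 1 (Real.exp 1)).indicator 1 (r * 1)) := by
      intro r (hr : 0 < r)
      rw [lineIntegral_smul hg i v d hr.ne', norm_smul, hn, Real.norm_of_nonneg hr.le,
        abs_of_pos hr]
      obtain ⟨j, rfl⟩ : ∃ j, d = j + 1 := ⟨d - 1, by omega⟩
      rw [Nat.add_sub_cancel, pow_succ]
      field_simp
    rw [setIntegral_congr_fun measurableSet_Ioi h3, integral_const_mul,
      setIntegral_Ioi_inv_indicator one_pos, mul_one]
  rw [← hleft, hright]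

/-- The projection of an even homogeneous function as a function on the sphere. -/
theorem isEvenAngular_lineIntegral (i : U →ₗᵢ[ℝ] W) {v : W} (hv : ‖v‖ = 1)
    (ho : ∀ u, inner ℝ (i u) v = 0) {d : ℕ} (hd : 1 ≤ d) {g : W → ℝ} (hg : IsEvenAngular g) :
    IsEvenAngular fun u => lineIntegral g i v (d + 1) (‖u‖⁻¹ • u) where
  continuousOn := by
    obtain ⟨C, hC0, hC⟩ := hg.exists_bound
    have hgm := hg.measurable
    intro u hu
    refine ContinuousAt.continuousWithinAt ?_
    have hne : ∀ᶠ w in 𝓝 u, w ≠ 0 := isOpen_compl_singleton.mem_nhds hu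
    have hsq : ∀ w : U, w ≠ 0 → ∀ t : ℝ, ‖i (‖w‖⁻¹ • w) + t • v‖ ^ 2 = 1 + t ^ 2 := by
      intro w hw t
      rw [norm_slice_sq i hv ho, norm_smul, norm_inv, norm_norm,
        inv_mul_cancel₀ (norm_ne_zero_iff.2 hw), one_pow]
    refine continuousAt_of_dominated (bound := fun t => C * (1 + t ^ 2)⁻¹) (.of_forall fun w => ?_)
      ?_ (integrable_inv_one_add_sq.const_mul C) (.of_forall fun t => ?_)
    · have : Measurable fun t : ℝ => i (‖w‖⁻¹ • w) + t • v := by fun_prop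
      apply Measurable.aestronglyMeasurable
      fun_prop
    · filter_upwards [hne] with w hw
      refine .of_forall fun t => ?_
      rw [norm_mul, norm_inv, norm_pow, norm_norm]
      gcongr
      · exact hC _
      · exact one_add_sq_le_norm_pow (hsq w hw t) (norm_nonneg _) (by omega)
    · have hx0 : i (‖u‖⁻¹ • u) + t • v ≠ 0 := by
        intro h0
        have := hsq u hu t
        rw [h0, norm_zero] at this
        nlinarith [sq_nonneg t]
      have h1 : ContinuousAt (fun w : U => i (‖w‖⁻¹ • w) + t • v) u := by
        have h2 : ContinuousAt (fun w : U => ‖w‖⁻¹ • w) u :=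
          (continuous_norm.continuousAt.inv₀ (norm_ne_zero_iff.2 hu)).smul continuousAt_id
        exact (i.continuous.continuousAt.comp h2).add continuousAt_const
      have h3 : ContinuousAt (fun w : U => g (i (‖w‖⁻¹ • w) + t • v)) u :=
        ContinuousAt.comp (f := fun w : U => i (‖w‖⁻¹ • w) + t • v)
          (hg.continuousOn.continuousAt (isOpen_compl_singleton.mem_nhds hx0)) h1
      exact h3.mul ((h1.norm.pow _).inv₀ (pow_ne_zero _ (norm_ne_zero_iff.2 hx0)))
  smul c u hc := by
    have hc' : |c| ≠ 0 := abs_ne_zero.2 hc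
    have h1 : ‖c • u‖⁻¹ • c • u = (|c|⁻¹ * c) • (‖u‖⁻¹ • u) := by
      rw [norm_smul, Real.norm_eq_abs, mul_inv, smul_smul, smul_smul]
      congr 1; ring
    have h2 : |(|c|⁻¹ * c)| = 1 := by rw [abs_mul, abs_inv, abs_abs, inv_mul_cancel₀ hc']
    simp only [h1]
    rw [lineIntegral_smul hg i v d (mul_ne_zero (inv_ne_zero hc') hc), h2, one_pow, inv_one,
      one_mul]

end Marginal

end Sections

/-! ### Arcs cut from great semicircles by small caps. -/

section Arc

open Set Metric Module Filter
open scoped Topology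

/-- The parameters `t` for which the angle between `(1, t)` and `(a, b)` is small. -/
def arcSet (a b δ : ℝ) : Set ℝ := {t | (1 - δ) ^ 2 * (1 + t ^ 2) < (a + b * t) ^ 2}

theorem measurableSet_arcSet (a b δ : ℝ) : MeasurableSet (arcSet a b δ) :=
  measurableSet_lt (by fun_prop) (by fun_prop)

/-- By the Lagrange identity `(a² + b²)(1 + t²) = (a + b t)² + (a t - b)²`, membership forces `|a t
- b| ≤ κ` on `[-M, M]`. It also forces `a² + b² > 1/4`; a very small `a` would then make `b` small
too, so `|a| ≥ 1 / (4M)` and division by `a` is controlled. -/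
theorem arcSet_inter_subset {a b δ κ M : ℝ} (hab : a ^ 2 + b ^ 2 ≤ 1) (hM : 1 ≤ M) (hδ : 0 < δ)
    (hδ2 : δ ≤ 1 / 2) (hκ0 : 0 ≤ κ) (hκ : κ ≤ 1 / 8) (hκδ : 2 * δ * (1 + M ^ 2) ≤ κ ^ 2) :
    arcSet a b δ ∩ Icc (-M) M ⊆ closedBall (b / a) (4 * M * κ) := by
  rintro t ⟨ht, htM⟩
  have ht' : (1 - δ) ^ 2 * (1 + t ^ 2) < (a + b * t) ^ 2 := ht
  have htM' : |t| ≤ M := abs_le.2 htM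
  have ht2 : t ^ 2 ≤ M ^ 2 := by
    rw [← sq_abs t]; gcongr
  have hid : (a ^ 2 + b ^ 2) * (1 + t ^ 2) = (a + b * t) ^ 2 + (a * t - b) ^ 2 := by ring
  have hsq : (a * t - b) ^ 2 ≤ κ ^ 2 := by
    have h1 : (a ^ 2 + b ^ 2) * (1 + t ^ 2) ≤ 1 * (1 + t ^ 2) := by gcongr
    have h2 : (2 * δ) * (1 + t ^ 2) ≤ 2 * δ * (1 + M ^ 2) := by gcongr
    nlinarith [mul_nonneg (sq_nonneg δ) (by positivity : (0 : ℝ) ≤ 1 + t ^ 2)]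
  have habs : |a * t - b| ≤ κ := abs_le_of_sq_le_sq hsq hκ0 |> fun h => abs_le.2 (abs_le.1 h)
  have hsum : 1 / 4 < a ^ 2 + b ^ 2 := by
    by_contra hcon
    rw [not_lt] at hcon
    have h1 : (a ^ 2 + b ^ 2) * (1 + t ^ 2) ≤ 1 / 4 * (1 + t ^ 2) := by gcongr
    have h2 : (1 / 4 : ℝ) ≤ (1 - δ) ^ 2 := by nlinarith
    have h3 : (1 / 4 : ℝ) * (1 + t ^ 2) ≤ (1 - δ) ^ 2 * (1 + t ^ 2) := by gcongr
    nlinarith [sq_nonneg (a * t - b)]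
  have ha : 1 ≤ 4 * M * |a| := by
    by_contra hcon
    rw [not_le] at hcon
    have h1 : |a * t| ≤ 1 / 4 := by
      rw [abs_mul]
      calc |a| * |t| ≤ |a| * M := by gcongr
        _ ≤ 1 / 4 := by linarith
    have h2 : |b| ≤ 3 / 8 := by
      have := abs_sub_abs_le_abs_sub b (a * t)
      rw [abs_sub_comm] at this
      linarith
    have h3 : |a| ≤ 1 / 4 := by nlinarith [abs_nonneg a]
    have h4 : a ^ 2 ≤ (1 / 4) ^ 2 := by rw [← sq_abs a]; gcongr
    have h5 : b ^ 2 ≤ (3 / 8) ^ 2 := by rw [← sq_abs b]; gcongr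
    norm_num at h4 h5
    linarith
  have ha0 : 0 < |a| := by
    by_contra hcon
    have : |a| = 0 := le_antisymm (not_lt.1 hcon) (abs_nonneg a)
    rw [this] at ha; linarith
  have ha1 : a ≠ 0 := abs_pos.1 ha0
  rw [mem_closedBall, Real.dist_eq, show t - b / a = (a * t - b) / a by field_simp, abs_div,
    div_le_iff₀ ha0]
  nlinarith

theorem exists_tail_small {η : ℝ} (hη : 0 < η) :
    ∃ M : ℝ, 1 ≤ M ∧ ∫ t : ℝ, (Icc (-M) M)ᶜ.indicator (fun t => (1 + t ^ 2)⁻¹) t ≤ η := by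
  have hlim : Tendsto (fun n : ℕ => ∫ t : ℝ,
      (Icc (-(n : ℝ)) n)ᶜ.indicator (fun t => (1 + t ^ 2)⁻¹) t) atTop (𝓝 (∫ _ : ℝ, (0 : ℝ))) := by
    refine tendsto_integral_of_dominated_convergence (fun t : ℝ => (1 + t ^ 2)⁻¹) (fun n => ?_)
      integrable_inv_one_add_sq (fun n => .of_forall fun t => ?_) (.of_forall fun t => ?_)
    · exact (integrable_inv_one_add_sq.indicator measurableSet_Icc.compl).aestronglyMeasurable
    · refine (norm_indicator_le_norm_self _ _).trans (le_of_eq ?_)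
      exact Real.norm_of_nonneg (by positivity)
    · refine tendsto_const_nhds.congr' ?_
      filter_upwards [eventually_ge_atTop ⌈|t|⌉₊] with n hn
      rw [indicator_of_notMem]
      rw [notMem_compl_iff, mem_Icc, ← abs_le]
      exact (Nat.le_ceil _).trans (by exact_mod_cast hn)
  rw [integral_zero] at hlim
  obtain ⟨n, hn1, hn⟩ := ((eventually_ge_atTop 1).and (hlim.eventually (gt_mem_nhds hη))).exists
  exact ⟨n, by exact_mod_cast hn1, hn.le⟩

/-- A great semicircle meets small caps in arcs of uniformly small length. -/
theorem exists_arcSet_small {η : ℝ} (hη : 0 < η) :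
    ∃ δ₀, 0 < δ₀ ∧ ∀ δ, 0 < δ → δ < δ₀ → ∀ a b : ℝ, a ^ 2 + b ^ 2 ≤ 1 →
      ∫ t : ℝ, (arcSet a b δ).indicator (fun t => (1 + t ^ 2)⁻¹) t ≤ η := by
  obtain ⟨M, hM, htail⟩ := exists_tail_small (half_pos hη)
  -- The interval has length `8 M κ ≤ η / 2`; the tail beyond `M` accounts for the other half.
  set κ := min (1 / 8) (η / (16 * M)) with hκ
  have hκ0 : 0 < κ := by positivity
  refine ⟨min (1 / 2) (κ ^ 2 / (2 * (1 + M ^ 2))), by positivity, fun δ hδ hδ0 a b hab => ?_⟩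
  have hδ2 : δ ≤ 1 / 2 := hδ0.le.trans (min_le_left _ _)
  have hκδ : 2 * δ * (1 + M ^ 2) ≤ κ ^ 2 := by
    have := hδ0.le.trans (min_le_right _ _)
    rw [le_div_iff₀ (by positivity)] at this
    linarith
  have hsub := arcSet_inter_subset hab hM hδ hδ2 hκ0.le (min_le_left _ _) hκδ
  have hi1 : Integrable ((Icc (-M) M)ᶜ.indicator fun t : ℝ => (1 + t ^ 2)⁻¹) :=
    integrable_inv_one_add_sq.indicator measurableSet_Icc.compl
  have hi2 : Integrable ((closedBall (b / a) (4 * M * κ)).indicator (1 : ℝ → ℝ)) :=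
    (integrable_indicator_iff measurableSet_closedBall).2
      (integrableOn_const measure_closedBall_lt_top.ne)
  have hle : ∀ t, (arcSet a b δ).indicator (fun t => (1 + t ^ 2)⁻¹) t ≤
      (Icc (-M) M)ᶜ.indicator (fun t : ℝ => (1 + t ^ 2)⁻¹) t +
        (closedBall (b / a) (4 * M * κ)).indicator (1 : ℝ → ℝ) t := by
    intro t
    have n1 : 0 ≤ (Icc (-M) M)ᶜ.indicator (fun t : ℝ => (1 + t ^ 2)⁻¹) t :=
      indicator_nonneg (fun t _ => by positivity) t
    have n2 : 0 ≤ (closedBall (b / a) (4 * M * κ)).indicator (1 : ℝ → ℝ) t :=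
      indicator_nonneg (fun t _ => zero_le_one) t
    by_cases ht : t ∈ arcSet a b δ
    · rw [indicator_of_mem ht]
      by_cases htM : t ∈ Icc (-M) M
      · rw [indicator_of_mem (hsub ⟨ht, htM⟩), Pi.one_apply]
        have : (1 + t ^ 2)⁻¹ ≤ 1 := inv_le_one_of_one_le₀ (by nlinarith [sq_nonneg t])
        linarith
      · rw [indicator_of_mem (mem_compl htM)]
        linarith
    · rw [indicator_of_notMem ht]
      linarith
  refine (integral_mono (integrable_inv_one_add_sq.indicator (measurableSet_arcSet a b δ))
    (hi1.add hi2) hle).trans ((integral_add hi1 hi2).trans_le ?_)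
  rw [integral_indicator_one measurableSet_closedBall, Real.volume_real_closedBall (by positivity)]
  have h4 : κ ≤ η / (16 * M) := min_le_right _ _
  rw [le_div_iff₀ (by positivity)] at h4
  linarith

end Arc

/-! ### Positivity of the projections of `1 - f`. -/

section Positivity

open Set Metric Module Filter
open scoped Topology

variable {E : Type*} [NormedAddCommGroup E] [InnerProductSpace ℝ E]

/-- The function `1 - f` on the sphere, `f` being the bump of width `δ` around `± x₀`. -/
def oneSubBump (x₀ : E) (δ : ℝ) (x : E) : ℝ := 1 - bumpProfile δ (cosSq x₀ x)

theorem isEvenAngular_oneSubBump (x₀ : E) (δ : ℝ) : IsEvenAngular (oneSubBump x₀ δ) where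
  continuousOn := by
    intro x hx
    refine ContinuousAt.continuousWithinAt ?_
    have h2 : ContinuousAt (fun w : E => ‖w‖⁻¹ • w) x :=
      (continuous_norm.continuousAt.inv₀ (norm_ne_zero_iff.2 hx)).smul continuousAt_id
    have h3 : ContinuousAt (cosSq x₀) x := (h2.inner continuousAt_const).pow 2
    exact continuousAt_const.sub ((continuous_bumpProfile δ).continuousAt.comp h3)
  smul c x hc := by
    have hc' : |c| ≠ 0 := abs_ne_zero.2 hc
    have : cosSq x₀ (c • x) = cosSq x₀ x := by
      simp only [cosSq, norm_smul, inner_smul_left, conj_trivial, Real.norm_eq_abs, mul_inv,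
        mul_pow, inv_pow, sq_abs]
      field_simp
    rw [oneSubBump, this, oneSubBump]

/-- The bump is at most `2` and lives on an arc `T`. As `k ≥ 2`, the weight is at most `(1 + t²)⁻¹`,
so with `J` the integral of the full weight the line integral is at least `J - 2 (J / 4)`. The
threshold serves all hyperplanes and directions at once. -/
theorem exists_lineIntegral_oneSubBump_pos {k : ℕ} (hk : 2 ≤ k) :
    ∃ δ₀, 0 < δ₀ ∧ ∀ δ, 0 < δ → δ < δ₀ → ∀ {U W : Type} [NormedAddCommGroup U]
      [InnerProductSpace ℝ U] [NormedAddCommGroup W] [InnerProductSpace ℝ W]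
      [FiniteDimensional ℝ W] [MeasurableSpace W] [BorelSpace W] (i : U →ₗᵢ[ℝ] W) (v x₀ : W),
      ‖v‖ = 1 → (∀ u, inner ℝ (i u) v = 0) → ‖x₀‖ = 1 → ∀ u : U, ‖u‖ = 1 →
      0 < lineIntegral (oneSubBump x₀ δ) i v k u := by
  have hwi : ∀ t : ℝ, (√(1 + t ^ 2) ^ k)⁻¹ ≤ (1 + t ^ 2)⁻¹ := fun t =>
    inv_anti₀ (by positivity)
      (one_add_sq_le_norm_pow (Real.sq_sqrt (by positivity)) (Real.sqrt_nonneg _) hk)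
  have hi : Integrable fun t : ℝ => (√(1 + t ^ 2) ^ k)⁻¹ := by
    refine integrable_inv_one_add_sq.mono' ?_ (.of_forall fun t => ?_)
    · apply Measurable.aestronglyMeasurable
      fun_prop
    · rw [Real.norm_of_nonneg (by positivity)]; exact hwi t
  have hJ : 0 < ∫ t : ℝ, (√(1 + t ^ 2) ^ k)⁻¹ := by
    rw [integral_pos_iff_support_of_nonneg (fun t => by positivity) hi]
    have : Function.support (fun t : ℝ => (√(1 + t ^ 2) ^ k)⁻¹) = univ :=
      eq_univ_of_forall fun t => by
        have : 0 < (√(1 + t ^ 2) ^ k)⁻¹ := by positivity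
        exact this.ne'
    rw [this]
    simp
  set J := ∫ t : ℝ, (√(1 + t ^ 2) ^ k)⁻¹
  obtain ⟨δ₁, hδ₁, harc⟩ := exists_arcSet_small (show 0 < J / 4 by positivity)
  refine ⟨min δ₁ (1 / 2), by positivity, ?_⟩
  intro δ hδ hδ0 U W _ _ _ _ _ _ _ i v x₀ hv ho hx₀ u hu
  have hδ2 : δ ≤ 1 / 2 := hδ0.le.trans (min_le_right _ _)
  have hn2 : ∀ t : ℝ, ‖i u + t • v‖ ^ 2 = 1 + t ^ 2 := fun t => by
    rw [norm_slice_sq i hv ho, hu, one_pow]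
  have hn : ∀ t : ℝ, ‖i u + t • v‖ = √(1 + t ^ 2) := fun t => by
    rw [← hn2, Real.sqrt_sq (norm_nonneg _)]
  have hab : inner ℝ (i u) x₀ ^ 2 + inner ℝ v x₀ ^ 2 ≤ 1 :=
    sq_inner_add_sq_inner_le hx₀ (by rw [i.norm_map, hu]) hv (ho u)
  have hsmall := harc δ hδ (hδ0.trans_le (min_le_left _ _)) _ _ hab
  set T := arcSet (inner ℝ (i u) x₀) (inner ℝ v x₀) δ
  have hcos : ∀ t : ℝ, cosSq x₀ (i u + t • v) =
      (inner ℝ (i u) x₀ + inner ℝ v x₀ * t) ^ 2 / (1 + t ^ 2) := by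
    intro t
    rw [cosSq, inner_smul_left, inner_add_left, inner_smul_left, conj_trivial, conj_trivial,
      mul_pow, inv_pow, hn2, mul_comm t, inv_mul_eq_div]
  have hle : ∀ t : ℝ, (√(1 + t ^ 2) ^ k)⁻¹ - 2 * T.indicator (fun t => (1 + t ^ 2)⁻¹) t ≤
      oneSubBump x₀ δ (i u + t • v) * (‖i u + t • v‖ ^ k)⁻¹ := by
    intro t
    rw [hn, oneSubBump]
    have hw0 : 0 < (√(1 + t ^ 2) ^ k)⁻¹ := by positivity
    by_cases ht : t ∈ T
    · rw [indicator_of_mem ht]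
      have h1 := bumpProfile_le_two hδ (cosSq_le_one hx₀ (i u + t • v))
      nlinarith [hwi t]
    · rw [indicator_of_notMem ht, bumpProfile_eq_zero hδ]
      · simp
      · apply Real.sqrt_le_iff.2 ⟨by linarith, ?_⟩
        rw [hcos, div_le_iff₀ (by positivity)]
        exact not_lt.1 ht
  have hiT := (integrable_inv_one_add_sq.indicator (measurableSet_arcSet (inner ℝ (i u) x₀)
    (inner ℝ v x₀) δ)).const_mul 2
  have hiG : Integrable fun t : ℝ => oneSubBump x₀ δ (i u + t • v) * (‖i u + t • v‖ ^ k)⁻¹ := by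
    obtain ⟨C, hC0, hC⟩ := (isEvenAngular_oneSubBump x₀ δ).exists_bound
    refine (hi.const_mul C).mono' ?_ (.of_forall fun t => ?_)
    · have := (isEvenAngular_oneSubBump x₀ δ).measurable
      have : Measurable fun t : ℝ => i u + t • v := by fun_prop
      apply Measurable.aestronglyMeasurable
      fun_prop
    · rw [norm_mul, norm_inv, norm_pow, norm_norm, hn]
      gcongr
      exact hC _
  have hfin := integral_mono (hi.sub hiT) hiG hle
  replace hfin := (integral_sub hi hiT).symm.trans_le hfin
  rw [integral_const_mul] at hfin
  change _ ≤ lineIntegral (oneSubBump x₀ δ) i v k u at hfin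
  change J - _ ≤ _ at hfin
  linarith

end Positivity

/-! ### Hyperplane sections as intersection bodies. -/

section HyperplaneSections

open Set Metric Module Filter
open scoped Topology

variable {E : Type*} [NormedAddCommGroup E] [InnerProductSpace ℝ E] [FiniteDimensional ℝ E]

theorem IsEvenAngular.isMinkowskiFunctional {q : E → ℝ} (h : IsEvenAngular q)
    (hpos : ∀ x, x ≠ 0 → 0 < q x) : IsMinkowskiFunctional fun x => ‖x‖ * q x where
  continuous := by
    rw [continuous_iff_continuousAt]
    intro x
    rcases eq_or_ne x 0 with rfl | hx
    · obtain ⟨C, -, hC⟩ := h.exists_bound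
      have h1 : Tendsto (fun x : E => ‖x‖ * C) (𝓝 0) (𝓝 0) := by
        have : Continuous fun x : E => ‖x‖ * C := by fun_prop
        simpa using this.tendsto 0
      rw [ContinuousAt, norm_zero, zero_mul]
      refine squeeze_zero_norm (fun x => ?_) h1
      rw [norm_mul, norm_norm]
      gcongr
      exact hC x
    · exact continuous_norm.continuousAt.mul
        (h.continuousOn.continuousAt (isOpen_compl_singleton.mem_nhds hx))
  smul c x := by
    rcases eq_or_ne c 0 with rfl | hc
    · simp
    · rw [h.smul c x hc, norm_smul, Real.norm_eq_abs, mul_assoc]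
  pos x hx := mul_pos (norm_pos_iff.2 hx) (hpos x hx)

variable [MeasurableSpace E] [BorelSpace E]

/-- For a hyperplane `V`, the spherical Radon transform of `g` at `ξ ∈ V` is the spherical Radon
transform within `V` of the projection of `g ‖x‖⁻¹⁻ᵈ` along the normal of `V`. -/
theorem sphericalRadon_eq_sphericalRadon_lineIntegral {d : ℕ} (hd : 1 ≤ d)
    (hE : finrank ℝ E = d + 2) {g : E → ℝ} (hg : IsEvenAngular g) {V : Submodule ℝ E}
    (hV : finrank ℝ V = d + 1) {v : E} (hv : ‖v‖ = 1) (ho : ∀ u : V, inner ℝ (u : E) v = 0)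
    {ξ : V} (hξ : ξ ≠ 0) :
    sphericalRadon g (ξ : E) =
      sphericalRadon (fun u => lineIntegral g V.subtypeₗᵢ v (d + 1) (‖u‖⁻¹ • u)) ξ := by
  have hξ' : (ξ : E) ≠ 0 := by simpa using hξ
  have hU := finrank_orthogonal_span hV hξ
  have hW := finrank_orthogonal_span (k := d + 1) hE hξ'
  have : Nontrivial (ℝ ∙ ξ)ᗮ := nontrivial_of_finrank_pos (R := ℝ) (by omega)
  have : Nontrivial (ℝ ∙ (ξ : E))ᗮ := nontrivial_of_finrank_pos (R := ℝ) (by omega)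
  have hmem : ∀ y : (ℝ ∙ ξ)ᗮ, ((y : V) : E) ∈ (ℝ ∙ (ξ : E))ᗮ := fun y =>
    Submodule.mem_orthogonal_singleton_iff_inner_right.2
      ((Submodule.mem_orthogonal_singleton_iff_inner_right (𝕜 := ℝ) (u := ξ)).1 y.2)
  let i : (ℝ ∙ ξ)ᗮ →ₗᵢ[ℝ] (ℝ ∙ (ξ : E))ᗮ :=
    { toLinearMap := (V.subtype ∘ₗ (ℝ ∙ ξ)ᗮ.subtype).codRestrict _ hmem
      norm_map' := fun y => rfl }
  let w : (ℝ ∙ (ξ : E))ᗮ := ⟨v, Submodule.mem_orthogonal_singleton_iff_inner_right.2 (ho ξ)⟩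
  have key := setIntegral_ball_eq_lineIntegral i (v := w) hv (fun y => ho y) hU hW
    (hg.comp_linearIsometry (ℝ ∙ (ξ : E))ᗮ.subtypeₗᵢ)
  rw [sphericalRadon, sphericalRadon, hU, hW]
  push_cast
  exact key

/-- If the radial function of a body is the spherical Radon transform of `g`, then a hyperplane
section is an intersection body as soon as the projection of `g` to the hyperplane is positive. -/
theorem isIntersectionBody_section {d : ℕ} (hd : 1 ≤ d) (hE : finrank ℝ E = d + 2) {g : E → ℝ}
    (hg : IsEvenAngular g) {N : E → ℝ} (hN : IsMinkowskiFunctional N)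
    (hNg : ∀ ξ, ‖ξ‖ = 1 → (N ξ)⁻¹ = Real.pi * sphericalRadon g ξ) {V : Submodule ℝ E}
    (hV : finrank ℝ V = d + 1) {v : E} (hv : ‖v‖ = 1) (ho : ∀ u : V, inner ℝ (u : E) v = 0)
    (hpos : ∀ u : V, ‖u‖ = 1 → 0 < lineIntegral g V.subtypeₗᵢ v (d + 1) u) :
    IsIntersectionBody {w : V | N w ≤ 1} := by
  have hNV : IsMinkowskiFunctional fun w : V => N w := hN.comp_linearIsometry V.subtypeₗᵢ
  set H : V → ℝ := fun u => lineIntegral g V.subtypeₗᵢ v (d + 1) (‖u‖⁻¹ • u) with hH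
  have hHe : IsEvenAngular H := isEvenAngular_lineIntegral V.subtypeₗᵢ hv ho hd hg
  have hHpos : ∀ u, u ≠ 0 → 0 < H u := fun u hu =>
    hpos _ (by rw [norm_smul, norm_inv, norm_norm, inv_mul_cancel₀ (norm_ne_zero_iff.2 hu)])
  have hd0 : (0 : ℝ) < d := by exact_mod_cast hd
  have hcH : ∀ u, u ≠ 0 → 0 < Real.pi * d * H u := fun u hu =>
    mul_pos (mul_pos Real.pi_pos hd0) (hHpos u hu)
  -- On the unit sphere of `V`, `q` is the reciprocal of the radial function `(π d H)^(1/d)`, chosen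
  -- so that its `d`-th power is `π d H`; the factor `d` cancels the one in the polar volume
  -- formula.
  set q : V → ℝ := fun u => ((Real.pi * d * H u) ^ (d : ℝ)⁻¹)⁻¹ with hq
  have hqe : IsEvenAngular q :=
    { continuousOn := ((continuousOn_const.mul hHe.continuousOn).rpow_const fun u hu =>
          Or.inl (hcH u hu).ne').inv₀ fun u hu => (Real.rpow_pos_of_pos (hcH u hu) _).ne'
      smul := fun c u hc => by simp only [hq, hHe.smul c u hc] }
  have hL := hqe.isMinkowskiFunctional fun u hu => inv_pos.2 (Real.rpow_pos_of_pos (hcH u hu) _)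
  have hof : IsIntersectionBodyOf {w : V | N w ≤ 1} {w : V | ‖w‖ * q w ≤ 1} :=
    { starBody_left := hNV.isStarBody
      symmetric_left := hNV.isOriginSymmetric
      starBody_right := hL.isStarBody
      symmetric_right := hL.isOriginSymmetric
      radial_eq := fun ξ hξ => by
        have hξ0 : ξ ≠ 0 := by rintro rfl; simp at hξ
        have hU := finrank_orthogonal_span hV hξ0
        have : Nontrivial (ℝ ∙ ξ)ᗮ := nontrivial_of_finrank_pos (R := ℝ) (by omega)
        have h1 := centralSectionVolume_eq_sphericalRadon hd hV hL hξ0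
        have h2 : sphericalRadon (fun x : V => (‖x‖ * (‖x‖ * q x)⁻¹) ^ d) ξ =
            d * (Real.pi * sphericalRadon H ξ) := by
          simp only [sphericalRadon, hU]
          have h3 : ∫ y in ball (0 : (ℝ ∙ ξ)ᗮ) 1,
              (‖(y : V)‖ * (‖(y : V)‖ * q y)⁻¹) ^ d ∂lebesgue (ℝ ∙ ξ)ᗮ =
              ∫ y in ball (0 : (ℝ ∙ ξ)ᗮ) 1, Real.pi * d * H y ∂lebesgue (ℝ ∙ ξ)ᗮ := by
            refine integral_congr_ae (ae_restrict_of_ae ?_)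
            have hae : ∀ᵐ y ∂lebesgue (ℝ ∙ ξ)ᗮ, y ≠ 0 :=
              compl_mem_ae_iff.2 (measure_singleton 0)
            filter_upwards [hae] with y hy
            have hy' : (y : V) ≠ 0 := by simpa using hy
            have hn : ‖(y : V)‖ ≠ 0 := norm_ne_zero_iff.2 hy'
            rw [mul_inv, mul_inv_cancel_left₀ hn, hq, inv_inv,
              Real.rpow_inv_natCast_pow (hcH _ hy').le (by omega)]
          rw [h3, integral_const_mul]
          ring
        rw [h2] at h1
        rw [mul_left_cancel₀ hd0.ne' h1, radialFunction, hNV.gauge_eq, hNg ξ hξ,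
          sphericalRadon_eq_sphericalRadon_lineIntegral hd hE hg hV hv ho hξ0] }
  -- The section is itself the intersection body of a star body, so it approximates itself at
  -- distance zero.
  exact ⟨hof.starBody_left, hof.symmetric_left, fun δ hδ => ⟨_, _, hof, fun ξ _ => by
    rw [sub_self, abs_zero]; exact hδ.le⟩⟩

theorem exists_unit_orthogonal {d : ℕ} (hE : finrank ℝ E = d + 1) {V : Submodule ℝ E}
    (hV : finrank ℝ V = d) : ∃ v : E, ‖v‖ = 1 ∧ ∀ u : V, inner ℝ (u : E) v = 0 := by
  have h := V.finrank_add_finrank_orthogonal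
  have : Nontrivial Vᗮ := nontrivial_of_finrank_pos (R := ℝ) (by omega)
  obtain ⟨v, hv⟩ := exists_norm_eq Vᗮ zero_le_one
  exact ⟨v, hv, fun u => Submodule.inner_right_of_mem_orthogonal u.2 v.2⟩

end HyperplaneSections

/-! ### The Radon transform of `1 - f` as a function of `⟨ξ, x₀⟩`. -/

section BumpRadon

open Set Metric Module Filter
open scoped Topology

variable {E F : Type*} [NormedAddCommGroup E] [InnerProductSpace ℝ E] [FiniteDimensional ℝ E]
  [MeasurableSpace E] [BorelSpace E] [NormedAddCommGroup F] [InnerProductSpace ℝ F]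
  [FiniteDimensional ℝ F] [MeasurableSpace F] [BorelSpace F]

/-- The vector `w` is the normalized projection of `x₀` to `ξ^⊥`, which has squared norm `1 - ⟨ξ,
x₀⟩²`. If the projection vanishes, both sides are zero and any unit vector serves. -/
theorem exists_unit_inner_sq_eq {x₀ ξ : E} (hx₀ : ‖x₀‖ = 1) (hξ : ‖ξ‖ = 1)
    [Nontrivial (ℝ ∙ ξ)ᗮ] : ∃ w : (ℝ ∙ ξ)ᗮ, ‖w‖ = 1 ∧ ∀ y : (ℝ ∙ ξ)ᗮ,
      inner ℝ (y : E) x₀ ^ 2 = (1 - inner ℝ ξ x₀ ^ 2) * inner ℝ y w ^ 2 := by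
  have hp : x₀ - inner ℝ ξ x₀ • ξ ∈ (ℝ ∙ ξ)ᗮ := by
    rw [Submodule.mem_orthogonal_singleton_iff_inner_right, inner_sub_right, inner_smul_right,
      real_inner_self_eq_norm_sq, hξ]
    simp
  set p : (ℝ ∙ ξ)ᗮ := ⟨x₀ - inner ℝ ξ x₀ • ξ, hp⟩ with hpd
  have hinner : ∀ y : (ℝ ∙ ξ)ᗮ, inner ℝ (y : E) x₀ = inner ℝ y p := by
    intro y
    have hy : inner ℝ (y : E) ξ = 0 := Submodule.mem_orthogonal_singleton_iff_inner_left.1 y.2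
    rw [Submodule.coe_inner, hpd, inner_sub_right, inner_smul_right, hy]
    simp
  have hnorm : ‖p‖ ^ 2 = 1 - inner ℝ ξ x₀ ^ 2 := by
    rw [Submodule.coe_norm, hpd, norm_sub_sq_real, inner_smul_right, norm_smul, hξ, hx₀,
      real_inner_comm, Real.norm_eq_abs, mul_one, sq_abs]
    ring
  rw [← hnorm]
  rcases eq_or_ne p 0 with h0 | h0
  · obtain ⟨w, hw⟩ := exists_norm_eq (ℝ ∙ ξ)ᗮ zero_le_one
    exact ⟨w, hw, fun y => by rw [hinner, h0]; simp⟩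
  · have hn : ‖p‖ ≠ 0 := norm_ne_zero_iff.2 h0
    refine ⟨‖p‖⁻¹ • p, by rw [norm_smul, norm_inv, norm_norm, inv_mul_cancel₀ hn], fun y => ?_⟩
    rw [hinner, inner_smul_right]
    field_simp

/-- An isometry taking `w` to `e` carries every `ξ^⊥` to one fixed model space `F`. All dependence
on `ξ` is then through one real parameter, in which the integral can be differentiated. -/
theorem sphericalRadon_oneSubBump {k : ℕ} (hk : 1 ≤ k) (hE : finrank ℝ E = k + 1)
    (hF : finrank ℝ F = k) {e : F} (he : ‖e‖ = 1) {x₀ ξ : E} (hx₀ : ‖x₀‖ = 1) (hξ : ‖ξ‖ = 1)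
    {δ : ℝ} (hδ : 0 < δ) : sphericalRadon (oneSubBump x₀ δ) ξ =
      k * ((lebesgue F).real (ball 0 1) - capIntegral e δ (inner ℝ ξ x₀)) := by
  have hξ0 : ξ ≠ 0 := by rintro rfl; simp at hξ
  have hU := finrank_orthogonal_span hE hξ0
  have : Nontrivial (ℝ ∙ ξ)ᗮ := nontrivial_of_finrank_pos (R := ℝ) (by omega)
  obtain ⟨w, hw, hin⟩ := exists_unit_inner_sq_eq hx₀ hξ
  obtain ⟨f, hf⟩ := exists_linearIsometryEquiv_map_unit (hU.trans hF.symm) hw he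
  set z := inner ℝ ξ x₀
  have hcos : ∀ y : (ℝ ∙ ξ)ᗮ, cosSq x₀ (y : E) = (1 - z ^ 2) * cosSq e (f y) := by
    intro y
    have h1 := hin (‖y‖⁻¹ • y)
    rw [cosSq, cosSq, ← hf, f.norm_map, ← map_smul, f.inner_map_map, ← h1]
    rfl
  have h2 := (lebesgue_measurePreserving f).setIntegral_preimage_emb
    f.toHomeomorph.measurableEmbedding (fun x => 1 - bumpProfile δ ((1 - z ^ 2) * cosSq e x))
    (ball 0 1)
  have h3 : f ⁻¹' ball 0 1 = ball 0 1 := by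
    ext y; simp
  have hb : IntegrableOn (fun x => bumpProfile δ ((1 - z ^ 2) * cosSq e x)) (ball 0 1)
      (lebesgue F) := by
    refine integrableOn_ball_of_bound (C := 2) ?_ fun x => ?_
    · exact (continuous_bumpProfile δ).measurable.comp ((measurable_cosSq e).const_mul _)
    · rw [abs_of_nonneg (bumpProfile_nonneg _ _)]
      exact bumpProfile_le_two hδ (capArg_le_one he z x)
  rw [sphericalRadon, hU]
  congr 1
  rw [h3] at h2
  simp only [oneSubBump, hcos]
  have h1 : IntegrableOn (fun _ => (1 : ℝ)) (ball (0 : F) 1) (lebesgue F) :=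
    integrableOn_const measure_ball_lt_top.ne
  rw [h2, integral_sub h1 hb, setIntegral_const,
    smul_eq_mul, mul_one]
  rfl

end BumpRadon

/-! ### Construction of the body and proof of the theorem. -/

section Assembly

open Set Metric Module Filter
open scoped Topology

variable {k : ℕ}

theorem perturbedKernel_eq (hk : 1 ≤ k) {x₀ : EuclideanSpace ℝ (Fin (k + 1))} (hx₀ : ‖x₀‖ = 1)
    {ε : ℝ} (hε : 0 < ε) (hε1 : ε ≤ 1) :
    perturbedKernel x₀ ε = fun x => oneSubBump x₀ (ε ^ 2 / 2) x * (‖x‖ ^ k)⁻¹ := by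
  funext x
  have hpow : ‖x‖ ^ (-((k + 1 : ℕ) : ℤ) + 1) = (‖x‖ ^ k)⁻¹ := by
    rw [show -((k + 1 : ℕ) : ℤ) + 1 = -(k : ℤ) by push_cast; ring, zpow_neg, zpow_natCast]
  rw [perturbedKernel, hpow]
  rcases eq_or_ne x 0 with rfl | hx
  -- At the origin both sides are zero because the inverse of `0 ^ k` is zero.
  · simp [show k ≠ 0 by omega]
  · have hn : ‖‖x‖⁻¹ • x‖ = 1 := by
      rw [norm_smul, norm_inv, norm_norm, inv_mul_cancel₀ (norm_ne_zero_iff.2 hx)]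
    rw [bump_eq_bumpProfile hx₀ hn hε hε1]
    rfl

theorem oneSubBump_self {x₀ : EuclideanSpace ℝ (Fin (k + 1))} (hx₀ : ‖x₀‖ = 1)
    {ε : ℝ} (hε : 0 < ε) (hε1 : ε ≤ 1) : oneSubBump x₀ (ε ^ 2 / 2) x₀ = -1 := by
  have h := bump_eq_bumpProfile hx₀ hx₀ hε hε1
  rw [oneSubBump, cosSq, hx₀, inv_one, one_smul, ← h, bump]
  norm_num [hε]

theorem exists_convex_isMinkowskiFunctional (hk : 4 ≤ k) {x₀ : EuclideanSpace ℝ (Fin (k + 1))}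
    (hx₀ : ‖x₀‖ = 1) : ∃ δ₀, 0 < δ₀ ∧ ∀ δ, 0 < δ → δ < δ₀ →
      ∃ N : EuclideanSpace ℝ (Fin (k + 1)) → ℝ, IsMinkowskiFunctional N ∧ ConvexOn ℝ univ N ∧
        ∀ ξ, ‖ξ‖ = 1 → (N ξ)⁻¹ = Real.pi * sphericalRadon (oneSubBump x₀ δ) ξ := by
  have hF : finrank ℝ (EuclideanSpace ℝ (Fin k)) = k := finrank_euclideanSpace_fin
  have hE : finrank ℝ (EuclideanSpace ℝ (Fin (k + 1))) = k + 1 := finrank_euclideanSpace_fin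
  have : Nontrivial (EuclideanSpace ℝ (Fin k)) := nontrivial_of_finrank_pos (R := ℝ) (by omega)
  obtain ⟨e, he⟩ := exists_norm_eq (EuclideanSpace ℝ (Fin k)) zero_le_one
  set ω := (lebesgue (EuclideanSpace ℝ (Fin k))).real (ball 0 1) with hω
  have hω0 : 0 < ω :=
    ENNReal.toReal_pos (measure_ball_pos _ _ one_pos).ne' measure_ball_lt_top.ne
  obtain ⟨δ₀, hδ₀, hδ2, hsmall⟩ := exists_capIntegral_small (hk.trans hF.ge) he
    (show 0 < ω / 10 by positivity)
  refine ⟨δ₀, hδ₀, fun δ hδ hδ1 => ?_⟩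
  have hc : 0 < Real.pi * k := mul_pos Real.pi_pos (by exact_mod_cast (by omega : 0 < k))
  obtain ⟨m₁, m₂, h1, h2, h3⟩ := inv_sub_bound
    (hasDerivAt_capIntegral he hδ (hδ1.le.trans hδ2))
    (hasDerivAt_capIntegralDeriv he hδ (hδ1.le.trans hδ2)) hω0 hc (hsmall δ hδ hδ1)
  have hpos : ∀ z, 0 < (Real.pi * k * (ω - capIntegral e δ z))⁻¹ := fun z => by
    have := (abs_le.1 (hsmall δ hδ hδ1 z).1).2
    exact inv_pos.2 (mul_pos hc (by linarith))
  have heven : ∀ z, (Real.pi * k * (ω - capIntegral e δ (-z)))⁻¹ =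
      (Real.pi * k * (ω - capIntegral e δ z))⁻¹ := fun z => by
    simp only [capIntegral, neg_sq]
  have hN := isMinkowskiFunctional_revolutionGauge
    (continuous_iff_continuousAt.2 fun z => (h1 z).continuousAt) heven hpos x₀
  refine ⟨_, hN, convexOn_revolutionGauge h1 h2 h3 hx₀ hN, fun ξ hξ => ?_⟩
  rw [revolutionGauge, hξ, inv_one, one_smul, one_mul, inv_inv,
    sphericalRadon_oneSubBump (by omega) hE hF he hx₀ hξ hδ, mul_assoc]

end Assembly

end

theorem theorem1 (n : ℕ) (hn : 5 ≤ n) (x₀ : EuclideanSpace ℝ (Fin n)) (hx₀ : ‖x₀‖ = 1) :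
    ∃ ε₀ : ℝ, 0 < ε₀ ∧ ∀ ε : ℝ, 0 < ε → ε < ε₀ →
      ∃ K : Set (EuclideanSpace ℝ (Fin n)),
        IsConvexBody K ∧ IsOriginSymmetric K ∧
        IsDistributionalFourierTransform (perturbedKernel x₀ ε) (fun x => (gauge K x)⁻¹) ∧
        ¬ IsIntersectionBody K ∧
        ∀ V : Submodule ℝ (EuclideanSpace ℝ (Fin n)), Module.finrank ℝ V = n - 1 →
          IsIntersectionBody {v : V | (v : EuclideanSpace ℝ (Fin n)) ∈ K} := by
  obtain ⟨k, rfl⟩ : ∃ k, n = k + 2 := ⟨n - 2, by omega⟩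
  obtain ⟨δ₁, hδ₁, hbody⟩ := exists_convex_isMinkowskiFunctional (k := k + 1) (by omega) hx₀
  obtain ⟨δ₂, hδ₂, hline⟩ := exists_lineIntegral_oneSubBump_pos (k := k + 1) (by omega)
  -- The width is `δ = ε² / 2`, and `ε ≤ 1` gives `δ < ε`, so bounds on `ε` suffice.
  refine ⟨min 1 (min δ₁ δ₂), by positivity, fun ε hε hε0 => ?_⟩
  have hε1 : ε ≤ 1 := hε0.le.trans (min_le_left _ _)
  have hδ : 0 < ε ^ 2 / 2 := by positivity
  have hδε : ε ^ 2 / 2 < min δ₁ δ₂ := by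
    have := hε0.trans_le (min_le_right _ _)
    nlinarith
  obtain ⟨N, hN, hconv, hrad⟩ := hbody _ hδ (hδε.trans_le (min_le_left _ _))
  have hg := isEvenAngular_oneSubBump x₀ (ε ^ 2 / 2)
  have hE : Module.finrank ℝ (EuclideanSpace ℝ (Fin (k + 2))) = k + 2 := finrank_euclideanSpace_fin
  refine ⟨{x | N x ≤ 1}, hN.isConvexBody hconv, hN.isOriginSymmetric, ?_, ?_, fun V hV => ?_⟩
  · rw [perturbedKernel_eq (k := k + 1) (by omega) hx₀ hε hε1, hN.gauge_eq]
    -- The radial function is known on the sphere only; homogeneity of degree `-1` extends the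
    -- formula, and at the origin both sides are zero.
    convert isDistributionalFourierTransform_angular (k := k + 1) (by omega) hg using 1
    funext x
    rcases eq_or_ne x 0 with rfl | hx
    · simp [hN.zero]
    · have hn : ‖x‖ ≠ 0 := norm_ne_zero_iff.2 hx
      have h1 := hrad (‖x‖⁻¹ • x) (by rw [norm_smul, norm_inv, norm_norm, inv_mul_cancel₀ hn])
      rw [hN.smul, sphericalRadon_smul _ (inv_ne_zero hn), abs_inv, abs_norm, mul_inv,
        inv_inv] at h1
      rw [mul_right_comm, ← h1]
      field_simp
  · refine not_isIntersectionBody_of_neg (k := k + 1) (by omega) hg (fun ξ hξ => ?_)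
      (x₀ := x₀) (by rintro rfl; simp at hx₀) (by rw [oneSubBump_self hx₀ hε hε1]; norm_num)
    rw [radialFunction, hN.gauge_eq, hrad ξ hξ]
  · replace hV : Module.finrank ℝ V = k + 1 := hV
    obtain ⟨v, hv, ho⟩ := exists_unit_orthogonal hE hV
    exact isIntersectionBody_section (by omega) hE hg hN hrad hV hv ho
      (hline _ hδ (hδε.trans_le (min_le_right _ _)) V.subtypeₗᵢ v x₀ hv ho hx₀)
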